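/- Let $p$ be a prime and $G$ a finite abelian group. For $n\ge 0$ put $R_n=\mathbb Z_p[[X_1,\dots,X_n]]$ and let $\rho_{n+1}:R_{n+1}\to R_n$ be the $\mathbb Z_p$-linear ring map that sends $X_{n+1}$ to $0$ and fixes $X_1,\dots,X_n$. Put $R=\varprojlim_n R_n$ (the ring of all formal power series over $\mathbb Z_p$ in $X_1,X_2,\dots$), $A=R[G]$ and $A_n=R_n[G]$. Write $\rho_{n+1}:A_{n+1}\to A_n$ and $\rho_{\langle n\rangle}:A\to A_n$ also for the induced surjections, and set $M_{(n)}=M/\ker(\rho_{\langle n\rangle})M\cong A_n\otimes_A M$ for an $A$-module $M$. Definitions, for a commutative ring $B$ and a $B$-module $N$. $\mathcal P_B(N)$ is the set of primes $\mathfrak q$ of $B$ of height one with $(N_{\mathrm{tor}})_{\mathfrak q}\ne 0$, where $N_{\mathrm{tor}}$ is the set of elements of $N$ killed by a non-zero-divisor of $B$; $N$ is torsion if $N=N_{\mathrm{tor}}$. $N$ is amenable if it is finitely generated, $\mathcal P_B(N)$ is finite and consists of finitely generated ideals, and, for every prime $\mathfrak q$ maximal among those contained in $\bigcup_{\mathfrak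 r\in\mathcal P_B(N)}\mathfrak r$, the ideals of $B_{\mathfrak q}$ are linearly ordered by inclusion. $N$ is pseudo-null if $N_{\mathfrak q}=0$ for all primes $\mathfrak q$ of height at most one; a pseudo-isomorphism is a homomorphism with pseudo-null kernel and cokernel. $N$ is quadratically presented if there is an exact sequence $B^d\to B^d\to N\to 0$ for some $d$. If $\mathcal P_B(N)$ is finite and there is a pseudo-isomorphism $N\to\bigoplus_{\mathfrak q\in\mathcal P_B(N)}\bigoplus_{i=1}^{m_{\mathfrak q}}B/\mathfrak q^{e_{\mathfrak q,i}}$, then $\mathrm{char}_B(N):=\prod_{\mathfrak q\in\mathcal P_B(N)}\mathfrak q^{\sum_i e_{\mathfrak q,i}}$. For an integer $n_0\ge 1$, say that an ideal $J$ of $A$ is the pro-characteristic ideal $\varprojlim_n\mathrm{char}_{A_n}(M_{(n)})$ computed from level $n_0$ on if, for all $n\ge n_0$, $M_{(n)}$ is torsion over $A_n$, $\mathrm{char}_{A_n}(M_{(n)})$ exists and is independent of the choice of pseudo-isomorphism, and $\rho_{n+1}(\mathrm{char}_{A_{n+1}}(M_{(n+1)}))\subseteq\mathrm{char}_{A_n}(M_{(n)})$,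 and if $J=\{x\in A:\rho_{\langle n\rangle}(x)\in\mathrm{char}_{A_n}(M_{(n)})\text{ for all }n\ge n_0\}$. (Such a $J$ does not depend on $n_0$.) **Proposition.** Let $M$ be a quadratically presented amenable torsion $A$-module such that the $A_n$-module $M_{(n)}$ is amenable for every $n\ge 1$. (i) For every $n$ for which the $A_n$-module $M_{(n)}$ is torsion, the $A_n$-module $(M_{(n+1)})^{X_{n+1}=0}=\{x\in M_{(n+1)}:X_{n+1}x=0\}$ is pseudo-null. (ii) The ideal $\mathrm{char}_A(M)$ exists and is independent of the choice of pseudo-isomorphism. There is an $n_0\ge 1$ such that $\mathrm{char}_A(M)$ is the pro-characteristic ideal $\varprojlim_n\mathrm{char}_{A_n}(M_{(n)})$ computed from level $n_0$ on; if $p\nmid |G|$, this holds for every $n_0\ge 1$ for which the $A_{n_0}$-module $M_{(n_0)}$ is torsion. -/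

import Mathlib

open scoped TensorProduct DirectSum nonZeroDivisors

noncomputable section

namespace ProChar

/-! ### Amenable modules, pseudo-isomorphisms and characteristic ideals -/

section General

variable (A : Type*) [CommRing A] (M : Type*) [AddCommGroup M] [Module A M]

/-- The set `P_A(M)` of the prime ideals of height one in the support of the torsion submodule
(elements killed by a non-zero-divisor) of `M`. -/
def torsionPrimes : Set (PrimeSpectrum A) :=
  {q | q.asIdeal.height = 1 ∧ q ∈ Module.support A (Submodule.torsion A M)}

/-- A (not necessarily integral) valuation ring: its ideals are linearly ordered by inclusion. -/
def IsValuationRing (B : Type*) [CommRing B] : Prop :=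
  ∀ I J : Ideal B, I ≤ J ∨ J ≤ I

/-- Amenable modules: finitely generated, with properties (P1) and (P2). -/
structure IsAmenable : Prop where
  /-- `M` is finitely generated. -/
  finite : Module.Finite A M
  /-- (P1): the localization at each prime that is maximal among the primes contained in the
  union of the primes in `P_A(M)` is a valuation ring. -/
  localization : ∀ q : PrimeSpectrum A,
    Maximal (fun q' : PrimeSpectrum A ↦
      (q'.asIdeal : Set A) ⊆ ⋃ r ∈ torsionPrimes A M, (r.asIdeal : Set A)) q →
    IsValuationRing (Localization.AtPrime q.asIdeal)
  /-- (P2), first part. -/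
  finite_torsionPrimes : (torsionPrimes A M).Finite
  /-- (P2), second part. -/
  fg : ∀ q ∈ torsionPrimes A M, q.asIdeal.FG

/-- `M` is quadratically presented: there is an exact sequence `A^d → A^d → M → 0`. -/
def IsQuadraticallyPresented : Prop :=
  ∃ (d : ℕ) (θ : (Fin d → A) →ₗ[A] (Fin d → A)) (π : (Fin d → A) →ₗ[A] M),
    Function.Exact θ π ∧ Function.Surjective π

/-- `M` is pseudo-null: its localization at each prime of height at most one vanishes. -/
def IsPseudoNull : Prop :=
  ∀ q : PrimeSpectrum A, q.asIdeal.height ≤ 1 →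
    Subsingleton (LocalizedModule q.asIdeal.primeCompl M)

variable {A M} in
/-- A pseudo-isomorphism: kernel and cokernel are pseudo-null. -/
def IsPseudoIso {N : Type*} [AddCommGroup N] [Module A N] (f : M →ₗ[A] N) : Prop :=
  IsPseudoNull A (LinearMap.ker f) ∧ IsPseudoNull A (N ⧸ LinearMap.range f)

/-- `I` is a characteristic ideal of `M`: the set `P_A(M)` is finite and there is a
pseudo-isomorphism from `M` to `⨁_{(q, i)} A / q ^ (e q i)`, over `q ∈ P_A(M)` and `i < m q`, for which `I` is the
product over `q ∈ P_A(M)` of the ideals `q ^ (∑_{i < m q} e q i)`. -/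
def IsCharIdeal (I : Ideal A) : Prop :=
  ∃ (hfin : (torsionPrimes A M).Finite)
    (m : PrimeSpectrum A → ℕ) (e : PrimeSpectrum A → ℕ → ℕ)
    (f : M →ₗ[A] ⨁ i : Σ q : torsionPrimes A M, Fin (m q), A ⧸ (i.1.1.asIdeal ^ e i.1 i.2)),
    IsPseudoIso f ∧
    I = ∏ q ∈ hfin.toFinset, q.asIdeal ^ (∑ i ∈ Finset.range (m q), e q i)

open Classical in
/-- The characteristic ideal `char_A(M)`, obtained from any choice of a pseudo-isomorphism as in
`IsCharIdeal` (and the unit ideal, as a default value, if there is none). -/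
def charIdeal : Ideal A :=
  if h : ∃ I, IsCharIdeal A M I then h.choose else ⊤

variable {A} {B : Type*} [CommRing B]

/-- The base change `B ⊗_A M` along a ring homomorphism `f : A → B`. If `f` is surjective with
kernel `I`, this is the `B`-module `M / I M`. -/
def BaseChange (f : A →+* B) : Type _ :=
  letI := f.toAlgebra
  B ⊗[A] M

instance (f : A →+* B) : AddCommGroup (BaseChange M f) :=
  letI := f.toAlgebra
  (TensorProduct.addCommGroup : AddCommGroup (B ⊗[A] M))

instance (f : A →+* B) : Module B (BaseChange M f) :=
  letI := f.toAlgebra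
  (TensorProduct.leftModule : Module B (B ⊗[A] M))

end General

/-! ### Power series rings and their group rings -/

section Iwasawa

variable (p : ℕ) [Fact p.Prime]

/-- `R_n = ℤ_p[[X_1, …, X_n]]`; the variable `X_{i+1}` is the one of index `i : Fin n`. -/
abbrev Rn (n : ℕ) : Type := MvPowerSeries (Fin n) ℤ_[p]

/-- `R`, the inverse limit of the `R_n` under `X_n ↦ 0`: it is the ring of all formal power series
in the variables `X_1, X_2, …` (of index `0, 1, …`), see `existsUnique_toRn_eq`. -/
abbrev R : Type := MvPowerSeries ℕ ℤ_[p]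

/-- `ρ_{n+1} : R_{n+1} → R_n`, sending `X_{n+1}` to `0` and fixing the other variables. -/
def Rn.proj (n : ℕ) : Rn p (n + 1) →+* Rn p n :=
  (MvPowerSeries.killCompl (R := ℤ_[p]) (Fin.castSuccEmb (n := n))).toRingHom

/-- The inclusion `R_n → R_{n+1}`. -/
def Rn.incl (n : ℕ) : Rn p n →+* Rn p (n + 1) :=
  (MvPowerSeries.rename (R := ℤ_[p]) (Fin.castSuccEmb (n := n))).toRingHom

/-- `ρ_⟨n⟩ : R → R_n`, sending `X_i` to `0` for `i > n` and fixing `X_1, …, X_n`. -/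
def R.toRn (n : ℕ) : R p →+* Rn p n :=
  (MvPowerSeries.killCompl (R := ℤ_[p]) (Fin.valEmbedding (n := n))).toRingHom

theorem Rn.proj_incl (n : ℕ) (a : Rn p n) : Rn.proj p n (Rn.incl p n a) = a := by
  exact MvPowerSeries.killCompl_rename_app (e := Fin.castSuccEmb) a

theorem Rn.X_dvd_sub (n : ℕ) (b : Rn p (n + 1)) :
    MvPowerSeries.X (Fin.last n) ∣ b - Rn.incl p n (Rn.proj p n b) := by
  rw [MvPowerSeries.X_dvd_iff]
  intro m hm
  have hmem : m ∈ Set.range (Finsupp.embDomain (Fin.castSuccEmb (n := n)) (M := ℕ)) := by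
    rw [Finsupp.mem_range_embDomain_iff]
    intro i hi
    refine Fin.lastCases (fun h ↦ ?_) (fun j _ ↦ ⟨j, rfl⟩) i hi
    exact absurd hm (by simpa using h)
  obtain ⟨x, rfl⟩ := hmem
  rw [map_sub, sub_eq_zero]
  exact ((MvPowerSeries.coeff_embDomain_rename Fin.castSuccEmb _ x).trans
    (MvPowerSeries.coeff_killCompl (e := Fin.castSuccEmb) b x)).symm

/-- `R` is the inverse limit of the rings `R_n`. -/
theorem existsUnique_toRn_eq (f : ∀ n, Rn p n) (hf : ∀ n, Rn.proj p n (f (n + 1)) = f n) :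
    ∃! F : R p, ∀ n, R.toRn p n F = f n := by
  have hstep : ∀ n (x : Fin n →₀ ℕ), MvPowerSeries.coeff x (f n) =
      MvPowerSeries.coeff (x.embDomain Fin.castSuccEmb) (f (n + 1)) := fun n x ↦ by
    conv_lhs => rw [← hf n]
    exact MvPowerSeries.coeff_killCompl _ _
  have hle : ∀ n k (h : n ≤ k) (x : Fin n →₀ ℕ) (y : Fin k →₀ ℕ),
      x.embDomain Fin.valEmbedding = y.embDomain Fin.valEmbedding →
      MvPowerSeries.coeff x (f n) = MvPowerSeries.coeff y (f k) := by
    intro n k h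
    induction k, h using Nat.le_induction with
    | base =>
      intro x y hxy
      rw [Finsupp.embDomain_injective _ hxy]
    | succ k hk ih =>
      intro x y hxy
      have hcomp : (Fin.castLEEmb hk).trans Fin.valEmbedding =
          (Fin.valEmbedding : Fin n ↪ ℕ) := by ext; rfl
      have hcomp' : (Fin.castSuccEmb (n := k)).trans Fin.valEmbedding =
          (Fin.valEmbedding : Fin k ↪ ℕ) := by ext; rfl
      have h1 : x.embDomain Fin.valEmbedding =
          (x.embDomain (Fin.castLEEmb hk)).embDomain Fin.valEmbedding := by
        rw [← Finsupp.embDomain_trans_apply, hcomp]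
      rw [ih x _ h1, hstep]
      congr 1
      have h2 : ((x.embDomain (Fin.castLEEmb hk)).embDomain
          (Fin.castSuccEmb (n := k))).embDomain Fin.valEmbedding =
          y.embDomain Fin.valEmbedding := by
        rw [← Finsupp.embDomain_trans_apply, hcomp', ← h1, hxy]
      rw [Finsupp.embDomain_injective _ h2]
  have hex : ∀ x : ℕ →₀ ℕ, ∃ (n : ℕ) (y : Fin n →₀ ℕ), y.embDomain Fin.valEmbedding = x := by
    intro x
    refine ⟨x.support.sup id + 1, ?_⟩
    have : x ∈ Set.range
        (Finsupp.embDomain (Fin.valEmbedding (n := x.support.sup id + 1)) (M := ℕ)) := by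
      rw [Finsupp.mem_range_embDomain_iff]
      intro i hi
      exact ⟨⟨i, Nat.lt_succ_of_le (Finset.le_sup (f := id) hi)⟩, rfl⟩
    exact this
  choose N Y hY using hex
  have hcoeff : ∀ (F : R p) n (x : Fin n →₀ ℕ), MvPowerSeries.coeff x (R.toRn p n F) =
      MvPowerSeries.coeff (x.embDomain Fin.valEmbedding) F :=
    fun F n x ↦ MvPowerSeries.coeff_killCompl _ _
  let F₀ : R p := fun x ↦ MvPowerSeries.coeff (Y x) (f (N x))
  have hF₀ : ∀ x, MvPowerSeries.coeff x F₀ = MvPowerSeries.coeff (Y x) (f (N x)) := fun _ ↦ rfl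
  refine ⟨F₀, fun n ↦ ?_, fun F hF ↦ ?_⟩
  · ext x
    rw [hcoeff, hF₀]
    rcases le_total (N (x.embDomain Fin.valEmbedding)) n with h | h
    · exact hle _ _ h _ _ (hY _)
    · exact (hle _ _ h _ _ (hY _).symm).symm
  · ext x
    rw [hF₀, ← hF, hcoeff, hY]

variable (G : Type*) [CommGroup G]

/-- `A = R[G]`. -/
abbrev Alg : Type _ := MonoidAlgebra (R p) G

/-- `A_n = R_n[G]`. -/
abbrev AlgLevel (n : ℕ) : Type _ := MonoidAlgebra (Rn p n) G

/-- The map `A → A_n` induced by `ρ_⟨n⟩`. -/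
def toLevel (n : ℕ) : Alg p G →+* AlgLevel p G n :=
  MonoidAlgebra.mapRingHom G (R.toRn p n)

/-- The map `A_{n+1} → A_n` induced by `ρ_{n+1}`. -/
def levelProj (n : ℕ) : AlgLevel p G (n + 1) →+* AlgLevel p G n :=
  MonoidAlgebra.mapRingHom G (Rn.proj p n)

/-- The map `A_n → A_{n+1}` induced by the inclusion `R_n → R_{n+1}`. -/
def levelIncl (n : ℕ) : AlgLevel p G n →+* AlgLevel p G (n + 1) :=
  MonoidAlgebra.mapRingHom G (Rn.incl p n)

/-- The element `X_{n+1}` of `A_{n+1}`. -/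
def lastVar (n : ℕ) : AlgLevel p G (n + 1) :=
  algebraMap (Rn p (n + 1)) (AlgLevel p G (n + 1)) (MvPowerSeries.X (Fin.last n))

theorem lastVar_dvd_sub (n : ℕ) (b : AlgLevel p G (n + 1)) :
    lastVar p G n ∣ b - levelIncl p G n (levelProj p G n b) := by
  induction b using MonoidAlgebra.induction_linear with
  | zero => simp
  | add f g hf hg =>
    have h := dvd_add hf hg
    rwa [show ∀ a b c d : AlgLevel p G (n + 1), a - b + (c - d) = a + c - (b + d) from
      fun a b c d ↦ by ring, ← map_add, ← map_add] at h
  | single g r =>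
    obtain ⟨c, hc⟩ := Rn.X_dvd_sub p n r
    refine ⟨MonoidAlgebra.single g c, ?_⟩
    simp only [lastVar, levelIncl, levelProj, MonoidAlgebra.mapRingHom_single,
      MonoidAlgebra.coe_algebraMap, Function.comp_apply, Algebra.algebraMap_self, RingHom.id_apply,
      MonoidAlgebra.single_mul_single, one_mul, ← hc]
    exact (MonoidAlgebra.single_sub g _ _).symm

/-- `M_(n) = M / I_n M = A_n ⊗_A M`, where `I_n` is the kernel of `A → A_n`. -/
abbrev Level (M : Type*) [AddCommGroup M] [Module (Alg p G) M] (n : ℕ) : Type _ :=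
  BaseChange M (toLevel p G n)

/-- The invariants `N^{X_{n+1} = 0}` of an `A_{n+1}`-module `N`: the elements killed by
`X_{n+1}`. -/
def Invariants (n : ℕ) (N : Type*) [AddCommGroup N] [Module (AlgLevel p G (n + 1)) N] : Type _ :=
  Submodule.torsionBy (AlgLevel p G (n + 1)) N (lastVar p G n)

instance (n : ℕ) (N : Type*) [AddCommGroup N] [Module (AlgLevel p G (n + 1)) N] :
    AddCommGroup (Invariants p G n N) :=
  (Submodule.addCommGroup (Submodule.torsionBy (AlgLevel p G (n + 1)) N (lastVar p G n)))

/-- The natural structure of an `A_n`-module on `N^{X_{n+1} = 0}`, through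
`A_n = A_{n+1} / (X_{n+1})`: an element of `A_n` acts as its image in `A_{n+1}`, a lift of it under
`A_{n+1} → A_n`. -/
instance (n : ℕ) (N : Type*) [AddCommGroup N] [Module (AlgLevel p G (n + 1)) N] :
    Module (AlgLevel p G n) (Invariants p G n N) :=
  Module.compHom
    (Submodule.torsionBy (AlgLevel p G (n + 1)) N (lastVar p G n)) (levelIncl p G n)

/-- The structure of an `A_n`-module on `N^{X_{n+1} = 0}` is the one for which `b ∈ A_{n+1}` acts
through its image in `A_n`. -/
theorem Invariants.levelProj_smul (n : ℕ) (N : Type*) [AddCommGroup N]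
    [Module (AlgLevel p G (n + 1)) N] (b : AlgLevel p G (n + 1))
    (x : Submodule.torsionBy (AlgLevel p G (n + 1)) N (lastVar p G n)) :
    (levelProj p G n b • (show Invariants p G n N from x) : Invariants p G n N) =
      (show Invariants p G n N from b • x) := by
  obtain ⟨c, hc⟩ := lastVar_dvd_sub p G n b
  change levelIncl p G n (levelProj p G n b) • x = b • x
  have hx : lastVar p G n • (x : N) = 0 := (Submodule.mem_torsionBy_iff _ _).1 x.2
  have h : (b - levelIncl p G n (levelProj p G n b)) • (x : N) = 0 := by
    rw [hc, mul_comm, mul_smul, hx, smul_zero]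
  have h' : b • (x : N) = levelIncl p G n (levelProj p G n b) • (x : N) :=
    sub_eq_zero.1 ((sub_smul _ _ _).symm.trans h)
  exact Subtype.ext h'.symm

/-- For modules `N n` over the rings `A_n`, the ideal `J` of `A` is the pro-characteristic ideal
`lim_n char_{A_n}(N n)`, computed from the level `n₀` on: for `n ≥ n₀` the modules `N n` are torsion
and their characteristic ideals form an inverse system under the maps `A_{n+1} → A_n`, and `J` is
the limit of this system, as a subset of `A = lim_n A_n`. (The limit of an inverse system is not
changed if finitely many levels are removed, so `J` does not depend on `n₀`.) -/
structure IsProCharIdealFrom (N : ℕ → Type*) [∀ n, AddCommGroup (N n)]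
    [∀ n, Module (AlgLevel p G n) (N n)] (n₀ : ℕ) (J : Ideal (Alg p G)) : Prop where
  isTorsion : ∀ n, n₀ ≤ n → Module.IsTorsion (AlgLevel p G n) (N n)
  existsUnique : ∀ n, n₀ ≤ n → ∃! I, IsCharIdeal (AlgLevel p G n) (N n) I
  map_le : ∀ n, n₀ ≤ n →
    (charIdeal (AlgLevel p G (n + 1)) (N (n + 1))).map (levelProj p G n) ≤
      charIdeal (AlgLevel p G n) (N n)
  mem_iff : ∀ x : Alg p G, x ∈ J ↔
    ∀ n, n₀ ≤ n → toLevel p G n x ∈ charIdeal (AlgLevel p G n) (N n)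

end Iwasawa

end ProChar

end

namespace ProChar

/-! ### Compact rings -/

/-! Fix a square presentation matrix `T` of `M` and put `δ = T.det`. Everything is read off from
`δ`: the module is torsion exactly when `δ` is a non-zero-divisor, its height one support is the set
of height one primes containing `δ`, and the same holds at level `n` with the image of `δ`, because
presentations are stable under base change. Part (i) is a diagram chase: if the image of `δ` in
`A_n` is a non-zero-divisor, then `T` is injective modulo `X_{n+1}`, and the invariants of `M_(n+1)`
even vanish (`subsingleton_invariants`).

For (ii), amenability makes the localization at each prime in the torsion support a discrete
valuation ring. Smith normal form there, glued over the finitely many primes, gives the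
pseudo-isomorphism. Comparing lengths shows that the exponent of `q` in the characteristic ideal is
the order of `δ` at `q` (`isCharIdeal_iff`).

To compute these orders, embed `A` into the product of the rings `O_ψ[[X_1, X_2, …]]`, where `O_ψ`
runs over the quotients of `ℤ_p[G]` by its minimal primes. Each `O_ψ` is a compact discrete
valuation ring (`isDiscreteValuationRing_quotient`). If each component `δ_ψ` is factored into primes
`f`, then the characteristic ideal is the product of the preimages in `A` of all the ideals `(f)`
(`HasComponents.isCharIdeal_iff`), and likewise at each level.

It remains to choose factorizations compatible with the levels. In finitely many variables,
Weierstrass preparation gives unique factorization (`uniqueFactorizationMonoid_mvPowerSeries`).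
Killing a variable sends non-units to non-units, so the number of prime factors of the image of
`δ_ψ` is non-increasing in `n`, hence eventually constant. By compactness the factorizations can be
lifted to the limit, with factors that stay prime at every large level (`exists_stable_factors`).
The preimage of `(f)` maps onto the corresponding preimage at level `n` (`map_comap_span`), so the
characteristic ideals at large levels are the images of `char_A(M)`. As this ideal is finitely
generated, it is closed in the compact ring `A`, hence equal to the limit.

If `p ∤ |G|`, the kernels of the projections to the components are idempotent, and the product of
the preimages of the `(f)` is the preimage of `(δ_ψ)` (`prod_comap_span`). No stability of the
factorization is then needed for the transition maps, so every torsion level can serve as starting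
point. -/

theorem isClosed_of_fg {S : Type*} [CommRing S] [TopologicalSpace S] [IsTopologicalRing S]
    [CompactSpace S] [T2Space S] {I : Ideal S} (hI : I.FG) : IsClosed (I : Set S) := by
  obtain ⟨n, f, rfl⟩ := (Submodule.fg_iff_exists_fin_linearMap _ _).1 hI
  exact (isCompact_range (LinearMap.continuous_on_pi f)).isClosed

/-- The candidates for the limit modulo `I ^ n` form a decreasing sequence of nonempty closed sets,
which has a common point by compactness. -/
theorem isPrecomplete_of_fg {S : Type*} [CommRing S] [TopologicalSpace S] [IsTopologicalRing S]
    [CompactSpace S] [T2Space S] {I : Ideal S} (hI : I.FG) : IsPrecomplete I S := by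
  refine ⟨fun f hf ↦ ?_⟩
  have hmem : ∀ n (x y : S), x ≡ y [SMOD (I ^ n • ⊤ : Submodule S S)] ↔ x - y ∈ I ^ n := fun n x y ↦ by
    rw [SModEq.sub_mem, smul_eq_mul, Ideal.mul_top]
  have hcl : ∀ n, IsClosed {x : S | f n - x ∈ I ^ n} := fun n ↦
    (isClosed_of_fg hI.pow).preimage (f := fun x ↦ f n - x) (by fun_prop)
  have hdec : ∀ n, {x : S | f (n + 1) - x ∈ I ^ (n + 1)} ⊆ {x | f n - x ∈ I ^ n} := fun n x hx ↦ by
    have h1 : f (n + 1) - x ∈ I ^ n := Ideal.pow_le_pow_right n.le_succ hx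
    have h2 := (hmem n _ _).1 (hf n.le_succ)
    simpa using add_mem h2 h1
  obtain ⟨x, hx⟩ := IsCompact.nonempty_iInter_of_sequence_nonempty_isCompact_isClosed
    _ hdec (fun n ↦ ⟨f n, by simp⟩) (hcl 0).isCompact hcl
  exact ⟨x, fun n ↦ (hmem _ _ _).2 (Set.mem_iInter.1 hx n)⟩

instance compactSpace_mvPowerSeries (σ S : Type*) [TopologicalSpace S] [CompactSpace S] :
    @CompactSpace (MvPowerSeries σ S) (MvPowerSeries.WithPiTopology.instTopologicalSpace S) :=
  Pi.compactSpace

open scoped MvPowerSeries.WithPiTopology in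
theorem isAdicComplete_mvPowerSeries (σ S : Type*) [Finite σ] [CommRing S] [IsNoetherianRing S]
    [IsLocalRing S] [TopologicalSpace S] [IsTopologicalRing S] [CompactSpace S] [T2Space S] :
    IsAdicComplete (IsLocalRing.maximalIdeal (MvPowerSeries σ S)) (MvPowerSeries σ S) where
  haus' := IsHausdorff.haus inferInstance
  prec' := (isPrecomplete_of_fg (IsNoetherian.noetherian _)).prec'

/-! ### Weierstrass preparation and unique factorization -/

/-- By Dickson's lemma `D` has finitely many minimal exponents. Weights that are powers of a bound
`B` on their entries separate them, by uniqueness of base `B` digits, and a non-minimal exponent is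
strictly heavier than a minimal one below it. -/
theorem exists_weight {n : ℕ} (D : Set (Fin (n + 1) →₀ ℕ)) (hD : D.Nonempty) :
    ∃ w : Fin (n + 1) → ℕ, w 0 = 1 ∧ (∀ i, 0 < w i) ∧ ∃ d₀ ∈ D, ∀ d ∈ D, d ≠ d₀ →
      ∑ i, d₀ i * w i < ∑ i, d i * w i := by
  have hfin : {d | Minimal (· ∈ D) d}.Finite :=
    WellQuasiOrderedLE.finite_of_isAntichain (setOfPred_minimal_antichain _)
  obtain ⟨B, hB⟩ : ∃ B, ∀ d, Minimal (· ∈ D) d → ∀ i, d i < B := by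
    refine ⟨(hfin.toFinset.sup fun d ↦ Finset.univ.sup d) + 1, fun d hd i ↦ Nat.lt_succ_of_le ?_⟩
    exact (Finset.le_sup (f := d) (Finset.mem_univ i)).trans
      (Finset.le_sup (f := fun d : Fin (n + 1) →₀ ℕ ↦ Finset.univ.sup d) (by simpa using hd))
  obtain ⟨d₁, hd₁⟩ : {d | Minimal (· ∈ D) d}.Nonempty := by
    obtain ⟨d, hd⟩ := hD
    obtain ⟨a, -, ha⟩ := (Set.isPWO_of_wellQuasiOrderedLE D).exists_le_minimal hd
    exact ⟨a, ha⟩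
  have hB0 : 0 < B := (Nat.zero_le _).trans_lt (hB d₁ hd₁ 0)
  let W : (Fin (n + 1) →₀ ℕ) → ℕ := fun d ↦ ∑ i, d i * B ^ (i : ℕ)
  obtain ⟨d₀, hd₀, hmin⟩ := hfin.exists_minimalFor W _ ⟨d₁, hd₁⟩
  refine ⟨fun i ↦ B ^ (i : ℕ), by simp, fun i ↦ pow_pos hB0 _, d₀, hd₀.1, fun d hd hne ↦ ?_⟩
  obtain ⟨d', hle, hd'⟩ := (Set.isPWO_of_wellQuasiOrderedLE D).exists_le_minimal hd
  have h1 : W d₀ ≤ W d' := (le_total _ _).elim id (hmin hd')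
  rcases eq_or_ne d' d with rfl | hne'
  · refine lt_of_le_of_ne h1 fun h ↦ hne ?_
    have : finFunctionFinEquiv (fun i ↦ (⟨d₀ i, hB d₀ hd₀ i⟩ : Fin B)) =
        finFunctionFinEquiv (fun i ↦ (⟨d' i, hB d' hd' i⟩ : Fin B)) := by
      apply Fin.ext
      simpa only [finFunctionFinEquiv_apply] using h
    ext i
    simpa using (congrFun (finFunctionFinEquiv.injective this) i).symm
  · refine h1.trans_lt (Finset.sum_lt_sum (fun i _ ↦ Nat.mul_le_mul_right _ (hle i)) ?_)
    obtain ⟨i, hi⟩ : ∃ i, d' i ≠ d i := by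
      by_contra! h
      exact hne' (Finsupp.ext h)
    exact ⟨i, Finset.mem_univ i,
      Nat.mul_lt_mul_of_pos_right (lt_of_le_of_ne (hle i) hi) (pow_pos hB0 _)⟩

/-- The series `X_0` and `X_i + c X_0 ^ (w i)`. -/
noncomputable def shearVar {n : ℕ} (S : Type*) [CommRing S] (c : S) (w : Fin (n + 1) → ℕ)
    (i : Fin (n + 1)) : MvPowerSeries (Fin (n + 1)) S :=
  if i = 0 then MvPowerSeries.X 0
  else MvPowerSeries.X i + MvPowerSeries.C c * MvPowerSeries.X 0 ^ w i

/-! ### A change of variables producing Weierstrass regularity -/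

section Shear

variable {n : ℕ} {S : Type*} [CommRing S] {w : Fin (n + 1) → ℕ}

open MvPowerSeries

theorem hasSubst_shearVar (hw : ∀ i, 0 < w i) (c : S) : HasSubst (shearVar S c w) := by
  refine hasSubst_of_constantCoeff_zero fun i ↦ ?_
  rw [shearVar]
  split_ifs
  · simp
  · simp [(hw i).ne']

theorem subst_shearVar_subst (hw : ∀ i, 0 < w i) (c : S) (f : MvPowerSeries (Fin (n + 1)) S) :
    subst (shearVar S c w) (subst (shearVar S (-c) w) f) = f := by
  have hc := hasSubst_shearVar hw c
  rw [subst_comp_subst_apply (hasSubst_shearVar hw _) hc]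
  have : (fun s ↦ subst (shearVar S c w) (shearVar S (-c) w s)) = X := by
    funext i
    have h0 : subst (shearVar S c w) (X 0 : MvPowerSeries (Fin (n + 1)) S) = X 0 := by
      rw [subst_X hc, shearVar, if_pos rfl]
    by_cases hi : i = 0
    · rw [shearVar, if_pos hi, h0, hi]
    · rw [shearVar, if_neg hi, subst_add hc, subst_mul hc, subst_pow hc, h0, subst_X hc,
        subst_C, shearVar, if_neg hi]
      simp
  rw [this, subst_self, id]

/-- The automorphism `X_i ↦ X_i + X_0 ^ (w i)`, for `i ≠ 0`. -/
noncomputable def shear (S : Type*) [CommRing S] (w : Fin (n + 1) → ℕ) (hw : ∀ i, 0 < w i) :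
    MvPowerSeries (Fin (n + 1)) S ≃+* MvPowerSeries (Fin (n + 1)) S where
  toFun := subst (shearVar S 1 w)
  invFun := subst (shearVar S (-1) w)
  left_inv f := by simpa using subst_shearVar_subst hw (-1 : S) f
  right_inv f := subst_shearVar_subst hw 1 f
  map_add' f g := subst_add (hasSubst_shearVar hw _) f g
  map_mul' f g := subst_mul (hasSubst_shearVar hw _) f g

/-- The coefficients of `X_0 ^ m` in the image of a power series under a change of variables. -/
theorem coeff_single_shear (hw : ∀ i, 0 < w i) (hw0 : w 0 = 1)
    (f : MvPowerSeries (Fin (n + 1)) S) (m : ℕ) :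
    coeff (Finsupp.single 0 m) (shear S w hw f) =
      ∑ᶠ d : Fin (n + 1) →₀ ℕ, coeff d f * if ∑ i, d i * w i = m then 1 else 0 := by
  rw [show shear S w hw f = subst (shearVar S 1 w) f from rfl, coeff_subst (hasSubst_shearVar hw _)]
  refine finsum_congr fun d ↦ ?_
  rw [smul_eq_mul]
  congr 1
  let e : Fin 1 ↪ Fin (n + 1) := ⟨fun _ ↦ 0, fun _ _ _ ↦ Subsingleton.elim _ _⟩
  have h1 : ∀ g : MvPowerSeries (Fin (n + 1)) S, coeff (Finsupp.single 0 m) g =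
      coeff (Finsupp.single 0 m) (killCompl (R := S) e g) := fun g ↦ by
    rw [coeff_killCompl, Finsupp.embDomain_single]
    rfl
  have h0 : killCompl (R := S) e (X 0) = X 0 := killCompl_X (R := S) (e := e) 0
  have h2 : ∀ i, killCompl (R := S) e (shearVar S 1 w i) = X 0 ^ w i := fun i ↦ by
    rw [shearVar]
    split_ifs with hi
    · rw [hi, hw0, pow_one, h0]
    · rw [map_add, killCompl_X_eq_zero (h := by rintro ⟨_, rfl⟩; exact hi rfl)]
      simp [h0]
  rw [h1, Finsupp.prod_fintype _ _ (by simp), map_prod]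
  simp_rw [map_pow, h2, ← pow_mul]
  rw [Finset.prod_pow_eq_pow_sum, coeff_X_pow]
  refine if_congr ?_ rfl rfl
  rw [(Finsupp.single_injective _).eq_iff, eq_comm]
  simp_rw [mul_comm (w _)]

/-- Among the exponents with unit coefficient there is a unique lightest one, `d₀`. All other
exponents of the same weight contribute elements of the maximal ideal to the coefficient of that
power of `X_0`, so the sum is a unit. -/
theorem exists_isUnit_coeff_shear [IsLocalRing S] (f : MvPowerSeries (Fin (n + 1)) S)
    (hf : ∃ d, IsUnit (coeff d f)) :
    ∃ (w : Fin (n + 1) → ℕ) (hw : ∀ i, 0 < w i) (m : ℕ),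
      IsUnit (coeff (Finsupp.single 0 m) (shear S w hw f)) := by
  obtain ⟨w, hw0, hw, d₀, hd₀, hmin⟩ := exists_weight {d | IsUnit (coeff d f)} hf
  refine ⟨w, hw, ∑ i, d₀ i * w i, ?_⟩
  have hfin : {d : Fin (n + 1) →₀ ℕ | ∑ i, d i * w i = ∑ i, d₀ i * w i}.Finite := by
    refine (Set.finite_Iic
      (Finsupp.equivFunOnFinite.symm fun _ ↦ ∑ i, d₀ i * w i)).subset fun d hd i ↦ ?_
    change d i ≤ ∑ i, d₀ i * w i
    rw [← hd]
    exact (Nat.le_mul_of_pos_right _ (hw i)).trans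
      (Finset.single_le_sum (f := fun i ↦ d i * w i) (fun _ _ ↦ Nat.zero_le _) (Finset.mem_univ i))
  classical
  rw [coeff_single_shear hw hw0, finsum_eq_sum_of_support_subset (s := hfin.toFinset) _ (by
    intro d hd
    simp only [Set.Finite.coe_toFinset]
    by_contra h
    exact hd (mul_eq_zero_of_right _ (if_neg h))),
    ← Finset.add_sum_erase _ _ (hfin.mem_toFinset.2 rfl : d₀ ∈ _), if_pos rfl, mul_one]
  have hrest : ∑ d ∈ hfin.toFinset.erase d₀,
      coeff d f * (if ∑ i, d i * w i = ∑ i, d₀ i * w i then 1 else 0) ∈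
        IsLocalRing.maximalIdeal S := by
    refine sum_mem fun d hd ↦ Ideal.mul_mem_right _ _ ?_
    rw [Finset.mem_erase, hfin.mem_toFinset] at hd
    intro hu
    exact (hmin d hu hd.1).ne' hd.2
  by_contra h
  exact (IsLocalRing.mem_maximalIdeal _).1
    ((Ideal.add_mem_iff_left _ hrest).1 ((IsLocalRing.mem_maximalIdeal _).2 h)) hd₀

end Shear

/-! ### Weierstrass preparation and factoriality in finitely many variables -/

section UFD

-- Weierstrass preparation replaces `g` by a distinguished polynomial `P`, which has a prime factor
-- in `Q` since `T[X]` is factorial. Made monic, this factor is again distinguished, and it stays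
-- prime among power series because the two quotients agree.
open Polynomial in
theorem exists_prime_mem_of_map_ne_zero {T : Type*} [CommRing T] [IsDomain T] [IsLocalRing T]
    [UniqueFactorizationMonoid T] [IsAdicComplete (IsLocalRing.maximalIdeal T) T]
    (Q : Ideal (PowerSeries T)) [hQ : Q.IsPrime] (g : PowerSeries T) (hg : g ∈ Q)
    (hg0 : g.map (IsLocalRing.residue T) ≠ 0) : ∃ x ∈ Q, Prime x := by
  obtain ⟨P, h, H⟩ := g.exists_isWeierstrassFactorization hg0
  have hPQ : (P : PowerSeries T) ∈ Q := by
    rw [H.eq_mul] at hg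
    exact (hQ.mem_or_mem hg).resolve_right fun h' ↦ hQ.ne_top (Q.eq_top_of_isUnit_mem h' H.isUnit)
  have hPm := H.isDistinguishedAt.monic
  have hQ' : (Q.comap (Polynomial.coeToPowerSeries.ringHom (R := T))).IsPrime := inferInstance
  obtain ⟨q, hqP, hq, hqQ⟩ : ∃ q, q ∣ P ∧ Prime q ∧ (q : PowerSeries T) ∈ Q := by
    obtain ⟨s, hs, u, hu⟩ := UniqueFactorizationMonoid.exists_prime_factors P hPm.ne_zero
    have h1 : (s.prod : T[X]) ∈ Q.comap (Polynomial.coeToPowerSeries.ringHom (R := T)) := by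
      refine (hQ'.mem_or_mem (x := s.prod) (y := u) ?_).resolve_right fun h' ↦
        hQ'.ne_top (Ideal.eq_top_of_isUnit_mem _ h' u.isUnit)
      rw [hu]
      exact hPQ
    obtain ⟨q, hqs, hq⟩ := (Ideal.IsPrime.multiset_prod_mem_iff_exists_mem hQ' s).1 h1
    exact ⟨q, (Multiset.dvd_prod hqs).trans ⟨u, hu.symm⟩, hs q hqs, hq⟩
  have hlc : IsUnit q.leadingCoeff := by
    obtain ⟨r, rfl⟩ := hqP
    rw [Monic, leadingCoeff_mul] at hPm
    exact IsUnit.of_mul_eq_one _ hPm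
  obtain ⟨u, hu⟩ := hlc
  set q' : T[X] := C (↑u⁻¹ : T) * q with hq'
  have hass : Associated q q' := by
    refine ⟨(Polynomial.isUnit_C.2 u⁻¹.isUnit).unit, ?_⟩
    rw [hq', mul_comm]; rfl
  have hm : q'.Monic := by
    rw [Monic, hq', leadingCoeff_mul, leadingCoeff_C, ← hu, Units.inv_mul]
  have hprime : Prime q' := hass.prime hq
  have hdist : q'.IsDistinguishedAt (IsLocalRing.maximalIdeal T) := by
    refine ⟨⟨fun {i} hi ↦ ?_⟩, hm⟩
    -- Modulo the maximal ideal `P` becomes a power of `X`, so its monic divisors are powers of `X`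
    -- as well.
    have h1 : q'.map (IsLocalRing.residue T) ∣ X ^ P.natDegree := by
      have h2 : P.map (IsLocalRing.residue T) = X ^ P.natDegree :=
        H.isDistinguishedAt.map_eq_X_pow
      rw [← h2]
      exact Polynomial.map_dvd _ (hass.dvd_iff_dvd_left.1 hqP)
    obtain ⟨k, -, hk⟩ := (dvd_prime_pow Polynomial.prime_X _).1 h1
    have h3 : q'.map (IsLocalRing.residue T) = X ^ k :=
      eq_of_monic_of_associated (hm.map _) (monic_X_pow k) hk
    have h4 : k = q'.natDegree := by
      rw [← hm.natDegree_map (IsLocalRing.residue T), h3, natDegree_X_pow]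
    rw [← IsLocalRing.residue_eq_zero_iff, ← coeff_map, h3, coeff_X_pow, if_neg (by omega)]
  refine ⟨(q' : PowerSeries T), ?_, ?_⟩
  · obtain ⟨v, hv⟩ := hass
    rw [← hv, Polynomial.coe_mul]
    exact Ideal.mul_mem_right _ _ hqQ
  · have h1 := (Ideal.span_singleton_prime hprime.ne_zero).2 hprime
    have h2 : IsDomain (PowerSeries T ⧸ Ideal.span {(q' : PowerSeries T)}) :=
      (hdist.algEquivQuotient).symm.toMulEquiv.isDomain (T[X] ⧸ Ideal.span {q'})
    have h3 : (q' : PowerSeries T) ≠ 0 := by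
      rw [Ne, Polynomial.coe_eq_zero_iff]
      exact hprime.ne_zero
    exact (Ideal.span_singleton_prime h3).1 ((Ideal.Quotient.isDomain_iff_prime _).1 h2)

theorem C_dvd_iff {σ S : Type*} [CommRing S] (ϖ : S) (f : MvPowerSeries σ S) :
    MvPowerSeries.C ϖ ∣ f ↔ ∀ d, ϖ ∣ MvPowerSeries.coeff d f := by
  refine ⟨fun ⟨g, hg⟩ d ↦ ⟨MvPowerSeries.coeff d g, ?_⟩, fun h ↦ ?_⟩
  · rw [hg, MvPowerSeries.coeff_C_mul]
  · choose g hg using h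
    exact ⟨(show MvPowerSeries σ S from g), MvPowerSeries.ext fun d ↦
      (hg d).trans (MvPowerSeries.coeff_C_mul d (show MvPowerSeries σ S from g) ϖ).symm⟩

variable {O : Type*} [CommRing O] [IsDomain O] [IsDiscreteValuationRing O]

instance isDomain_mvPowerSeries (σ : Type*) : IsDomain (MvPowerSeries σ O) :=
  NoZeroDivisors.to_isDomain _

theorem prime_C {σ : Type*} {ϖ : O} (hϖ : Irreducible ϖ) :
    Prime (MvPowerSeries.C ϖ : MvPowerSeries σ O) := by
  have hp := hϖ.prime
  have : (Ideal.span {ϖ}).IsPrime := (Ideal.span_singleton_prime hp.ne_zero).2 hp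
  have hker : RingHom.ker (MvPowerSeries.map (σ := σ) (Ideal.Quotient.mk (Ideal.span {ϖ}))) =
      Ideal.span {MvPowerSeries.C ϖ} := by
    ext f
    rw [Ideal.mem_span_singleton, C_dvd_iff, RingHom.mem_ker, MvPowerSeries.ext_iff]
    refine forall_congr' fun d ↦ ?_
    rw [MvPowerSeries.coeff_map, map_zero, Ideal.Quotient.eq_zero_iff_mem,
      Ideal.mem_span_singleton]
  have hne : (MvPowerSeries.C ϖ : MvPowerSeries σ O) ≠ 0 := fun h ↦
    hp.ne_zero (by simpa using congrArg MvPowerSeries.constantCoeff h)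
  rw [← Ideal.span_singleton_prime hne, ← hker]
  have : IsDomain (MvPowerSeries σ (O ⧸ Ideal.span {ϖ})) := NoZeroDivisors.to_isDomain _
  exact RingHom.ker_isPrime _

theorem exists_eq_C_pow_mul {σ : Type*} {ϖ : O} (hϖ : Irreducible ϖ) {f : MvPowerSeries σ O}
    (hf : f ≠ 0) :
    ∃ (k : ℕ) (g : MvPowerSeries σ O), f = MvPowerSeries.C ϖ ^ k * g ∧
      ∃ d, IsUnit (MvPowerSeries.coeff d g) := by
  obtain ⟨d, hd⟩ : ∃ d, MvPowerSeries.coeff d f ≠ 0 := by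
    by_contra! h
    exact hf (MvPowerSeries.ext h)
  have hfm : FiniteMultiplicity (MvPowerSeries.C ϖ) f := by
    obtain ⟨n, hn⟩ := FiniteMultiplicity.of_not_isUnit hϖ.not_isUnit hd
    refine ⟨n, fun h ↦ hn ?_⟩
    rw [← map_pow, C_dvd_iff] at h
    exact h d
  obtain ⟨g, hg, hndvd⟩ := hfm.exists_eq_pow_mul_and_not_dvd
  refine ⟨_, g, hg, ?_⟩
  rw [C_dvd_iff] at hndvd
  push Not at hndvd
  obtain ⟨d, hd⟩ := hndvd
  refine ⟨d, ?_⟩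
  by_contra h
  have h' := (IsLocalRing.mem_maximalIdeal _).2 h
  rw [hϖ.maximalIdeal_eq, Ideal.mem_span_singleton] at h'
  exact hd h'

variable [TopologicalSpace O] [IsTopologicalRing O] [CompactSpace O] [T2Space O]

/-- Kaplansky's criterion: every nonzero prime must contain a prime element. If the uniformizer is
not in the prime, its powers can be divided out of an element; a shear then makes the element
regular in `X_0`, and the Weierstrass argument applies over the ring in one variable fewer. -/
theorem uniqueFactorizationMonoid_mvPowerSeries (n : ℕ) :
    UniqueFactorizationMonoid (MvPowerSeries (Fin n) O) := by
  induction n with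
  | zero =>
    exact (MvPowerSeries.isEmptyEquiv (σ := Fin 0) (R := O)).symm.toMulEquiv.uniqueFactorizationMonoid
      inferInstance
  | succ n ih =>
    rw [UniqueFactorizationMonoid.iff_exists_prime_mem_of_isPrime]
    intro Q hQ0 hQ
    obtain ⟨ϖ, hϖ⟩ := IsDiscreteValuationRing.exists_irreducible O
    by_cases hϖQ : MvPowerSeries.C ϖ ∈ Q
    · exact ⟨_, hϖQ, prime_C hϖ⟩
    obtain ⟨f, hfQ, hf⟩ := Submodule.exists_mem_ne_zero_of_ne_bot hQ0
    obtain ⟨k, g, rfl, hg⟩ := exists_eq_C_pow_mul hϖ hf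
    have hgQ : g ∈ Q := (hQ.mem_or_mem hfQ).resolve_left fun h ↦ hϖQ (hQ.mem_of_pow_mem _ h)
    obtain ⟨w, hw, m, hm⟩ := exists_isUnit_coeff_shear g hg
    let e : MvPowerSeries (Fin (n + 1)) O ≃+* PowerSeries (MvPowerSeries (Fin n) O) :=
      (shear O w hw).trans (MvPowerSeries.finSuccEquiv O n).toRingEquiv
    have := isAdicComplete_mvPowerSeries (Fin n) O
    have hQ' : (Q.comap e.symm).IsPrime := inferInstance
    have hne : (e g).map (IsLocalRing.residue _) ≠ 0 := fun h ↦ by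
      have h1 := congrArg (PowerSeries.coeff m) h
      rw [PowerSeries.coeff_map, map_zero, IsLocalRing.residue_eq_zero_iff,
        IsLocalRing.mem_maximalIdeal, mem_nonunits_iff, MvPowerSeries.isUnit_iff_constantCoeff,
        ← MvPowerSeries.coeff_zero_eq_constantCoeff_apply] at h1
      refine h1 ?_
      change IsUnit (MvPowerSeries.coeff 0 (PowerSeries.coeff m
        (MvPowerSeries.finSuccEquiv O n (shear O w hw g))))
      rw [MvPowerSeries.coeff_coeff_finSuccEquiv]
      have hs : (0 : Fin n →₀ ℕ).cons m = Finsupp.single 0 m := by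
        ext i
        refine Fin.cases ?_ (fun j ↦ ?_) i <;> simp
      rwa [hs]
    obtain ⟨x, hxQ, hx⟩ := exists_prime_mem_of_map_ne_zero (Q.comap e.symm) (e g) (by simpa) hne
    exact ⟨e.symm x, hxQ, (MulEquiv.prime_iff e.symm.toMulEquiv).2 hx⟩

end UFD

end ProChar

namespace ProChar

/-! ### Power series in infinitely many variables -/

section Limit

open MvPowerSeries

/-- The map `S[[X_0, X_1, …]] → S[[X_0, …, X_{n-1}]]` setting the other variables to zero. -/
noncomputable def toFin (S : Type*) [CommRing S] (n : ℕ) :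
    MvPowerSeries ℕ S →+* MvPowerSeries (Fin n) S :=
  (killCompl (R := S) (Fin.valEmbedding (n := n))).toRingHom

/-- The map `S[[X_0, …, X_n]] → S[[X_0, …, X_{n-1}]]` setting `X_n` to zero. -/
noncomputable def finStep (S : Type*) [CommRing S] (n : ℕ) :
    MvPowerSeries (Fin (n + 1)) S →+* MvPowerSeries (Fin n) S :=
  (killCompl (R := S) (Fin.castSuccEmb (n := n))).toRingHom

/-- The inclusion `S[[X_0, …, X_{n-1}]] → S[[X_0, X_1, …]]`. -/
noncomputable def ofFin (S : Type*) [CommRing S] (n : ℕ) :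
    MvPowerSeries (Fin n) S →+* MvPowerSeries ℕ S :=
  (rename (R := S) (Fin.valEmbedding (n := n))).toRingHom

variable {S : Type*} [CommRing S]

theorem coeff_toFin (n : ℕ) (f : MvPowerSeries ℕ S) (x : Fin n →₀ ℕ) :
    coeff x (toFin S n f) = coeff (x.embDomain Fin.valEmbedding) f :=
  coeff_killCompl _ _

theorem coeff_finStep (n : ℕ) (f : MvPowerSeries (Fin (n + 1)) S) (x : Fin n →₀ ℕ) :
    coeff x (finStep S n f) = coeff (x.embDomain Fin.castSuccEmb) f :=
  coeff_killCompl _ _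

theorem toFin_ofFin (n : ℕ) (f : MvPowerSeries (Fin n) S) : toFin S n (ofFin S n f) = f :=
  killCompl_rename_app (e := Fin.valEmbedding) f

theorem toFin_surjective (n : ℕ) : Function.Surjective (toFin S n) :=
  fun f ↦ ⟨_, toFin_ofFin n f⟩

theorem finStep_toFin (n : ℕ) (f : MvPowerSeries ℕ S) :
    finStep S n (toFin S (n + 1) f) = toFin S n f := by
  ext x
  rw [coeff_finStep, coeff_toFin, coeff_toFin, ← Finsupp.embDomain_trans_apply]
  rfl

theorem toFin_eq_of_le {m n : ℕ} (h : m ≤ n) {f g : MvPowerSeries ℕ S}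
    (hfg : toFin S n f = toFin S n g) : toFin S m f = toFin S m g := by
  induction n, h using Nat.le_induction with
  | base => exact hfg
  | succ n _ ih => exact ih (by rw [← finStep_toFin, hfg, finStep_toFin])

/-- A monomial involves only finitely many variables, so its coefficient is visible at every large
level. -/
theorem eq_of_forall_toFin (n₀ : ℕ) {f g : MvPowerSeries ℕ S}
    (h : ∀ n, n₀ ≤ n → toFin S n f = toFin S n g) : f = g := by
  ext x
  have hx : x ∈ Set.range
      (Finsupp.embDomain (Fin.valEmbedding (n := x.support.sup id + 1)) (M := ℕ)) := by
    rw [Finsupp.mem_range_embDomain_iff]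
    intro i hi
    exact ⟨⟨i, Nat.lt_succ_of_le (Finset.le_sup (f := id) hi)⟩, rfl⟩
  obtain ⟨y, hy⟩ := hx
  rw [← hy, ← coeff_toFin, ← coeff_toFin, toFin_eq_of_le (le_max_right n₀ _) (h _ (le_max_left _ _))]

theorem exists_toFin_ne_zero {f : MvPowerSeries ℕ S} (hf : f ≠ 0) :
    ∃ n₀, ∀ n, n₀ ≤ n → toFin S n f ≠ 0 := by
  by_contra! h
  refine hf (eq_of_forall_toFin 0 fun n _ ↦ ?_)
  obtain ⟨m, hm, hm'⟩ := h n
  exact toFin_eq_of_le hm (by rw [hm', map_zero])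

theorem constantCoeff_toFin (n : ℕ) (f : MvPowerSeries ℕ S) :
    constantCoeff (toFin S n f) = constantCoeff f := by
  rw [← coeff_zero_eq_constantCoeff_apply, ← coeff_zero_eq_constantCoeff_apply, coeff_toFin,
    Finsupp.embDomain_zero]

theorem isUnit_toFin_iff (n : ℕ) (f : MvPowerSeries ℕ S) : IsUnit (toFin S n f) ↔ IsUnit f := by
  rw [isUnit_iff_constantCoeff, isUnit_iff_constantCoeff, constantCoeff_toFin]

theorem isUnit_finStep_iff (n : ℕ) (f : MvPowerSeries (Fin (n + 1)) S) :
    IsUnit (finStep S n f) ↔ IsUnit f := by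
  rw [isUnit_iff_constantCoeff, isUnit_iff_constantCoeff, ← coeff_zero_eq_constantCoeff_apply,
    ← coeff_zero_eq_constantCoeff_apply, coeff_finStep, Finsupp.embDomain_zero]

/-! ### Compactness arguments in infinitely many variables -/

section Compact

open scoped MvPowerSeries.WithPiTopology

theorem continuous_toFin [TopologicalSpace S] (n : ℕ) : Continuous (toFin S n) :=
  continuous_pi fun x ↦ by
    have h : (fun f ↦ toFin S n f x) = fun f ↦ coeff (x.embDomain Fin.valEmbedding) f :=
      funext fun f ↦ coeff_toFin n f x
    rw [h]
    exact WithPiTopology.continuous_coeff S _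


variable [TopologicalSpace S] [IsTopologicalRing S] [CompactSpace S] [T2Space S]

/-- Finitely generated ideals are closed for the topology defined by the `toFin`. -/
theorem mem_of_forall_toFin {I : Ideal (MvPowerSeries ℕ S)} (hI : I.FG) (n₀ : ℕ)
    {f : MvPowerSeries ℕ S} (h : ∀ n, n₀ ≤ n → ∃ g ∈ I, toFin S n g = toFin S n f) : f ∈ I := by
  let V : ℕ → Set (MvPowerSeries ℕ S) := fun n ↦
    (I : Set (MvPowerSeries ℕ S)) ∩ {g | toFin S (n₀ + n) g = toFin S (n₀ + n) f}
  have hcl : ∀ n, IsClosed (V n) := fun n ↦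
    (isClosed_of_fg hI).inter (isClosed_eq (continuous_toFin _) continuous_const)
  have hne : ∀ n, (V n).Nonempty := fun n ↦ by
    obtain ⟨g, hg, hg'⟩ := h (n₀ + n) (Nat.le_add_right _ _)
    exact ⟨g, hg, hg'⟩
  obtain ⟨g, hg⟩ := IsCompact.nonempty_iInter_of_sequence_nonempty_isCompact_isClosed
    V (fun n g hg ↦ ⟨hg.1, toFin_eq_of_le (Nat.le_succ (n₀ + n)) hg.2⟩) hne (hcl 0).isCompact hcl
  rw [Set.mem_iInter] at hg
  have hgf : g = f := eq_of_forall_toFin n₀ fun n hn ↦ by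
    obtain ⟨k, rfl⟩ := Nat.exists_eq_add_of_le hn
    exact (hg k).2
  exact hgf ▸ (hg 0).1

theorem dvd_of_forall_toFin (n₀ : ℕ) {f g : MvPowerSeries ℕ S}
    (h : ∀ n, n₀ ≤ n → toFin S n f ∣ toFin S n g) : f ∣ g := by
  rw [← Ideal.mem_span_singleton]
  refine mem_of_forall_toFin ⟨{f}, by simp⟩ n₀ fun n hn ↦ ?_
  obtain ⟨c, hc⟩ := h n hn
  refine ⟨f * ofFin S n c, Ideal.mul_mem_right _ _ (Ideal.mem_span_singleton_self f), ?_⟩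
  rw [map_mul, toFin_ofFin, hc]

/-- Failure of divisibility is detected at some level and persists at all higher ones. Two failures
are therefore visible at a common level, where they contradict primality. -/
theorem prime_of_forall_toFin (n₀ : ℕ) {f : MvPowerSeries ℕ S}
    (h : ∀ n, n₀ ≤ n → Prime (toFin S n f)) : Prime f := by
  refine ⟨fun h0 ↦ (h n₀ le_rfl).ne_zero (by rw [h0, map_zero]),
    fun hu ↦ (h n₀ le_rfl).not_isUnit (hu.map _), fun a b hab ↦ ?_⟩
  have hdvd : ∀ {m n c}, m ≤ n → toFin S n f ∣ toFin S n c → toFin S m f ∣ toFin S m c := by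
    intro m n c hmn ⟨d, hd⟩
    refine ⟨toFin S m (ofFin S n d), ?_⟩
    rw [← map_mul]
    exact toFin_eq_of_le hmn (by rw [hd, map_mul, toFin_ofFin])
  by_contra! hcon
  obtain ⟨ha, hb⟩ := hcon
  obtain ⟨m, hm, hma⟩ : ∃ m, n₀ ≤ m ∧ ¬ toFin S m f ∣ toFin S m a := by
    by_contra! h'
    exact ha (dvd_of_forall_toFin n₀ h')
  obtain ⟨k, hk, hkb⟩ : ∃ m, n₀ ≤ m ∧ ¬ toFin S m f ∣ toFin S m b := by
    by_contra! h'
    exact hb (dvd_of_forall_toFin n₀ h')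
  have hab' := map_dvd (toFin S (max m k)) hab
  rw [map_mul] at hab'
  rcases (h (max m k) (hm.trans (le_max_left _ _))).dvd_or_dvd hab' with h1 | h1
  · exact hma (hdvd (le_max_left _ _) h1)
  · exact hkb (hdvd (le_max_right _ _) h1)

end Compact

end Limit

/-! ### Counting prime factors along the levels -/

section Factors

open UniqueFactorizationMonoid

theorem card_factors_mul {α : Type*} [CommMonoidWithZero α] [UniqueFactorizationMonoid α] {x y : α}
    (hx : x ≠ 0) (hy : y ≠ 0) :
    (factors (x * y)).card = (factors x).card + (factors y).card := by
  rw [← Multiset.card_add]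
  exact Multiset.card_eq_card_of_rel (factors_mul hx hy)

theorem card_factors_eq {α : Type*} [CommMonoidWithZero α] [UniqueFactorizationMonoid α] {x y : α}
    (h : Associated x y) (hx : x ≠ 0) :
    (factors x).card = (factors y).card := by
  have hy : y ≠ 0 := (h.ne_zero_iff).1 hx
  exact Multiset.card_eq_card_of_rel (factors_unique (fun _ ↦ irreducible_of_factor _)
    (fun _ ↦ irreducible_of_factor _) ((factors_prod hx).trans (h.trans (factors_prod hy).symm)))

theorem card_factors_pos {α : Type*} [CommMonoidWithZero α] [UniqueFactorizationMonoid α] {x : α}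
    (hx : x ≠ 0) (hu : ¬ IsUnit x) : 0 < (factors x).card :=
  Multiset.card_pos.2 fun h ↦ hu ((associated_one_iff_isUnit).1
    (by simpa [h] using (factors_prod hx).symm))

theorem prime_of_card_factors {α : Type*} [CommMonoidWithZero α] [UniqueFactorizationMonoid α]
    {x : α} (hx : x ≠ 0) (h : (factors x).card = 1) : Prime x := by
  obtain ⟨y, hy⟩ := Multiset.card_eq_one.1 h
  have h1 := factors_prod hx
  rw [hy, Multiset.prod_singleton] at h1
  exact h1.prime (prime_of_factor y (hy ▸ Multiset.mem_singleton_self y))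

/-- Each non-unit contributes at least one prime factor. If the counts agree, each contributes
exactly one and is prime. -/
theorem card_le_card_factors {α : Type*} [CommMonoidWithZero α] [UniqueFactorizationMonoid α]
    [Nontrivial α] (t : Multiset α) (h0 : t.prod ≠ 0) (ht : ∀ x ∈ t, ¬ IsUnit x) :
    t.card ≤ (factors t.prod).card ∧ (t.card = (factors t.prod).card → ∀ x ∈ t, Prime x) := by
  induction t using Multiset.induction with
  | empty => simp
  | cons a t ih =>
    rw [Multiset.prod_cons] at h0 ⊢
    have ha := left_ne_zero_of_mul h0
    have hp := right_ne_zero_of_mul h0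
    obtain ⟨h1, h2⟩ := ih hp fun x hx ↦ ht x (Multiset.mem_cons_of_mem hx)
    have h3 := card_factors_pos ha (ht a (Multiset.mem_cons_self a t))
    rw [card_factors_mul ha hp, Multiset.card_cons]
    refine ⟨by omega, fun h x hx ↦ ?_⟩
    rcases Multiset.mem_cons.1 hx with rfl | hx
    · exact prime_of_card_factors ha (by omega)
    · exact h2 (by omega) x hx

variable {O : Type*} [CommRing O] [IsDomain O] [IsDiscreteValuationRing O]
  [TopologicalSpace O] [IsTopologicalRing O] [CompactSpace O] [T2Space O]

attribute [local instance] uniqueFactorizationMonoid_mvPowerSeries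

/-- A non-unit remains a non-unit after killing a variable, since its constant coefficient is
unchanged. The factors at level `n + 1` thus give as many non-unit factors at level `n`. -/
theorem card_factors_toFin_succ_le (F : MvPowerSeries ℕ O) (n : ℕ) (hF : toFin O n F ≠ 0) :
    (factors (toFin O (n + 1) F)).card ≤ (factors (toFin O n F)).card := by
  have hF' : toFin O (n + 1) F ≠ 0 := fun h ↦ hF (by rw [← finStep_toFin, h, map_zero])
  have h1 := (factors_prod hF').map (finStep O n)
  rw [finStep_toFin, ← Multiset.prod_hom] at h1
  have h0 := (h1.ne_zero_iff).2 hF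
  refine le_trans (le_of_eq ?_) ((card_le_card_factors
    ((factors (toFin O (n + 1) F)).map (finStep O n)) h0 ?_).1.trans (card_factors_eq h1 h0).le)
  · rw [Multiset.card_map]
  · simp only [Multiset.mem_map]
    rintro _ ⟨x, hx, rfl⟩
    rw [isUnit_finStep_iff]
    exact (prime_of_factor x hx).not_isUnit

theorem exists_forall_card_factors_eq {F : MvPowerSeries ℕ O} (hF : F ≠ 0) :
    ∃ n₀ k, ∀ n, n₀ ≤ n → toFin O n F ≠ 0 ∧ (factors (toFin O n F)).card = k := by
  obtain ⟨n₁, hn₁⟩ := exists_toFin_ne_zero hF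
  let ν : ℕ → ℕ := fun m ↦ (factors (toFin O (n₁ + m) F)).card
  have hanti : Antitone ν := antitone_nat_of_succ_le fun m ↦
    card_factors_toFin_succ_le F (n₁ + m) (hn₁ _ (Nat.le_add_right _ _))
  obtain ⟨m, hm⟩ := WellFoundedLT.antitone_chain_condition hanti
  refine ⟨n₁ + m, ν m, fun n hn ↦ ⟨hn₁ n (by omega), ?_⟩⟩
  obtain ⟨j, rfl⟩ := Nat.exists_eq_add_of_le hn
  rw [hm (m + j) (Nat.le_add_right _ _), add_assoc]

open scoped MvPowerSeries.WithPiTopology in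
/-- A non-zero power series in infinitely many variables is a product of prime elements which
remain prime modulo all but finitely many of the variables. -/
theorem exists_stable_factors {F : MvPowerSeries ℕ O} (hF : F ≠ 0) :
    ∃ (n₀ : ℕ) (s : Multiset (MvPowerSeries ℕ O)), Associated s.prod F ∧
      ∀ n, n₀ ≤ n → toFin O n F ≠ 0 ∧ ∀ g ∈ s, Prime (toFin O n g) := by
  obtain ⟨n₀, k, hk⟩ := exists_forall_card_factors_eq hF
  let B := MvPowerSeries ℕ O
  -- Approximate factorizations into `k` non-units and a unit. Being a non-unit is expressed through
  -- the constant coefficient, and the unit carries its inverse, so that all the conditions are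
  -- closed.
  let V : ℕ → Set ((Fin k → B) × B × B) := fun n ↦
    {x | (∀ i, MvPowerSeries.constantCoeff (x.1 i) ∈ IsLocalRing.maximalIdeal O) ∧
      x.2.1 * x.2.2 = 1 ∧
      toFin O (n₀ + n) ((∏ i, x.1 i) * x.2.1) = toFin O (n₀ + n) F}
  have hcl : ∀ n, IsClosed (V n) := fun n ↦ by
    refine IsClosed.and ?_ (IsClosed.and ?_ ?_)
    · have h1 : IsClosed (IsLocalRing.maximalIdeal O : Set O) :=
        isClosed_of_fg (IsNoetherian.noetherian _)
      simp only [Set.ofPred_forall]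
      exact isClosed_iInter fun i ↦ h1.preimage
        ((MvPowerSeries.WithPiTopology.continuous_constantCoeff O).comp (by fun_prop))
    · exact isClosed_eq (by fun_prop) continuous_const
    · exact isClosed_eq ((continuous_toFin _).comp (by fun_prop)) continuous_const
  have hne : ∀ n, (V n).Nonempty := fun n ↦ by
    obtain ⟨h0, hc⟩ := hk (n₀ + n) (Nat.le_add_right _ _)
    obtain ⟨u, hu⟩ := factors_prod h0
    obtain ⟨l, hl⟩ := Quot.exists_rep (factors (toFin O (n₀ + n) F))
    have hlen : l.length = k := by rw [← hc, ← hl]; rfl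
    subst hlen
    refine ⟨(fun i ↦ ofFin O _ (l.get i), ofFin O (n₀ + n) (u : MvPowerSeries (Fin (n₀ + n)) O),
      ofFin O _ (↑u⁻¹ : MvPowerSeries (Fin (n₀ + n)) O)), fun i ↦ ?_, ?_, ?_⟩
    · rw [IsLocalRing.mem_maximalIdeal, mem_nonunits_iff, ← MvPowerSeries.isUnit_iff_constantCoeff,
        ← isUnit_toFin_iff (n₀ + n), toFin_ofFin]
      refine (prime_of_factor (l.get i) (a := toFin O (n₀ + n) F) ?_).not_isUnit
      rw [← hl]
      exact List.get_mem l i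
    · rw [← map_mul, Units.mul_inv, map_one]
    · rw [map_mul, map_prod]
      simp_rw [toFin_ofFin]
      rw [← hu, ← hl]
      congr 1
      exact (List.prod_ofFn (f := l.get)).symm.trans (by rw [List.ofFn_get]; rfl)
  obtain ⟨⟨g, u, v⟩, hg⟩ := IsCompact.nonempty_iInter_of_sequence_nonempty_isCompact_isClosed
    V (fun n x hx ↦ ⟨hx.1, hx.2.1, toFin_eq_of_le (Nat.le_succ (n₀ + n)) hx.2.2⟩) hne
    (hcl 0).isCompact hcl
  rw [Set.mem_iInter] at hg
  have hu : u * v = 1 := (hg 0).2.1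
  have hprod : (∏ i, g i) * u = F := eq_of_forall_toFin n₀ fun n hn ↦ by
    obtain ⟨j, rfl⟩ := Nat.exists_eq_add_of_le hn
    exact (hg j).2.2
  have hass : Associated (∏ i, g i) F := ⟨Units.mkOfMulEqOne u v hu, hprod⟩
  refine ⟨n₀, Finset.univ.val.map g, hass, fun n hn ↦ ?_⟩
  obtain ⟨h0, hc⟩ := hk n hn
  refine ⟨h0, ?_⟩
  have h1 : Associated ((Finset.univ.val.map g).map (toFin O n)).prod (toFin O n F) := by
    rw [Multiset.prod_hom]
    exact hass.map _
  have h2 := (h1.ne_zero_iff).2 h0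
  -- At each level there are `k` non-units whose product has exactly `k` prime factors, which forces
  -- them to be prime.
  have h3 := (card_le_card_factors ((Finset.univ.val.map g).map (toFin O n)) h2 (by
    simp only [Multiset.mem_map]
    rintro _ ⟨_, ⟨i, -, rfl⟩, rfl⟩
    rw [isUnit_toFin_iff, MvPowerSeries.isUnit_iff_constantCoeff]
    exact (hg 0).1 i)).2 (by
      rw [card_factors_eq h1 h2, hc]
      simp)
  exact fun x hx ↦ h3 _ (Multiset.mem_map_of_mem _ hx)

theorem finiteMultiplicity_of_toFin {n₀ : ℕ} {f : MvPowerSeries ℕ O}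
    (h : ∀ n, n₀ ≤ n → Prime (toFin O n f)) {x : MvPowerSeries ℕ O} (hx : x ≠ 0) :
    FiniteMultiplicity f x := by
  obtain ⟨n₁, hn₁⟩ := exists_toFin_ne_zero hx
  obtain ⟨k, hk⟩ := FiniteMultiplicity.of_not_isUnit
    (h (max n₀ n₁) (le_max_left _ _)).not_isUnit (hn₁ (max n₀ n₁) (le_max_right _ _))
  refine ⟨k, fun hd ↦ hk ?_⟩
  rw [← map_pow]
  exact map_dvd _ hd

end Factors

end ProChar

namespace ProChar

/-! ### Localizations at height one primes -/

section LocalRing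

variable {A : Type*} [CommRing A] (q : Ideal A) [q.IsPrime]

/-- If `x * y = 0` and `x` is a multiple of `y`, then `x ^ 2 = 0`, so `x = 0` by reducedness;
comparability of principal ideals covers all pairs. -/
theorem isDomain_localization [IsReduced A] (hv : IsValuationRing (Localization.AtPrime q)) :
    IsDomain (Localization.AtPrime q) := by
  have hred : IsReduced (Localization.AtPrime q) :=
    isReduced_localizationPreserves q.primeCompl _ inferInstance
  have : NoZeroDivisors (Localization.AtPrime q) := by
    have key : ∀ x y : Localization.AtPrime q, x * y = 0 → Ideal.span {x} ≤ Ideal.span {y} → x = 0 := by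
      intro x y hxy h
      obtain ⟨c, rfl⟩ := Ideal.mem_span_singleton.1 (h (Ideal.mem_span_singleton_self x))
      have : (y * c) ^ 2 = 0 := by linear_combination c * hxy
      exact pow_eq_zero_iff (two_ne_zero) |>.1 this
    refine ⟨fun {x y} hxy ↦ (hv (Ideal.span {x}) (Ideal.span {y})).imp (key x y hxy)
      (key y x (by rwa [mul_comm]))⟩
  exact NoZeroDivisors.to_isDomain _

/-- Finitely generated ideals are principal in a valuation ring, so the maximal ideal has a
generator `ϖ`. Height one makes it the only nonzero prime, so every nonzero `x` divides a power of
`ϖ`. -/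
theorem isDiscreteValuationRing_localization [IsDomain (Localization.AtPrime q)]
    (hv : IsValuationRing (Localization.AtPrime q)) (hq : q.height = 1) (hfg : q.FG) :
    IsDiscreteValuationRing (Localization.AtPrime q) := by
  let B := Localization.AtPrime q
  have hval : ValuationRing B := ValuationRing.iff_ideal_total.2 ⟨hv⟩
  have hmax : (IsLocalRing.maximalIdeal B).IsPrincipal := by
    refine IsBezout.isPrincipal_of_FG _ ?_
    rw [← IsLocalization.AtPrime.map_eq_maximalIdeal q B]
    exact hfg.map _
  have hht : (IsLocalRing.maximalIdeal B).height = 1 := by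
    rw [← IsLocalization.height_under q.primeCompl (A := B),
      IsLocalization.AtPrime.under_maximalIdeal (R := A) B q, hq]
  have hne : IsLocalRing.maximalIdeal B ≠ ⊥ := Ideal.ne_bot_of_height_eq_one hht
  obtain ⟨ϖ, hϖ⟩ := hmax
  have hϖ0 : ϖ ≠ 0 := by
    rintro rfl
    exact hne (by rw [hϖ]; simp)
  have hprime : Prime ϖ := by
    rw [← Ideal.span_singleton_prime hϖ0, Ideal.span, ← hϖ]
    infer_instance
  refine IsDiscreteValuationRing.ofHasUnitMulPowIrreducibleFactorization
    ⟨ϖ, hprime.irreducible, fun {x} hx ↦ ?_⟩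
  have hrad : ϖ ∈ (Ideal.span {x}).radical := by
    rw [Ideal.radical_eq_sInf, Submodule.mem_sInf]
    rintro P ⟨hxP, hP⟩
    have hP0 : P ≠ ⊥ := by
      rintro rfl
      exact hx (by simpa using hxP)
    by_contra h
    have hlt : P < IsLocalRing.maximalIdeal B := lt_of_le_of_ne (IsLocalRing.le_maximalIdeal hP.ne_top)
      (by rintro rfl; exact h (by rw [hϖ]; exact Ideal.mem_span_singleton_self ϖ))
    have h1 := Ideal.height_le_iff.1 (le_of_eq hht : _ ≤ ((1 : ℕ) : ℕ∞)) P hP hlt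
    exact hP0 (Ideal.height_eq_zero_iff_eq_bot.1 (by simpa using h1))
  classical
  have hex : ∃ n, x ∣ ϖ ^ n := hrad.imp fun _ ↦ Ideal.mem_span_singleton.1
  obtain ⟨y, hy⟩ := Nat.find_spec hex
  refine ⟨Nat.find hex, ?_⟩
  -- For the least such power the cofactor is a unit: otherwise a factor `ϖ` could be cancelled,
  -- contradicting minimality.
  by_cases hyu : IsUnit y
  · rw [hy]
    exact (associated_mul_unit_right x y hyu).symm
  · exfalso
    have hyϖ : y ∈ IsLocalRing.maximalIdeal B := hyu
    rw [hϖ] at hyϖ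
    obtain ⟨z, rfl⟩ := Ideal.mem_span_singleton.1 hyϖ
    rcases h0 : Nat.find hex with _ | n
    · rw [h0, pow_zero] at hy
      exact hprime.not_isUnit (IsUnit.of_mul_eq_one (x * z) (by rw [hy]; ring))
    · refine Nat.find_min hex (m := n) (by omega) ⟨z, ?_⟩
      rw [h0, pow_succ] at hy
      exact mul_right_cancel₀ hϖ0 (by rw [hy]; ring)

end LocalRing

/-! ### Smith normal form of a square matrix -/

section Smith

theorem mulVecLin_injective {B : Type*} [CommRing B] {d : ℕ} {T : Matrix (Fin d) (Fin d) B}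
    (hT : T.det ∈ B⁰) : Function.Injective T.mulVecLin := by
  rw [injective_iff_map_eq_zero]
  intro x hx
  have h1 : T.det • x = 0 := by
    rw [← Matrix.one_mulVec x, ← Matrix.smul_mulVec, ← Matrix.adjugate_mul, ← Matrix.mulVec_mulVec]
    rw [Matrix.mulVecLin_apply] at hx
    rw [hx, Matrix.mulVec_zero]
  funext i
  exact (mem_nonZeroDivisors_iff_left.1 hT) _ (congrFun h1 i)

theorem exists_quotient_range_equiv {B : Type*} [CommRing B] [IsDomain B] [IsPrincipalIdealRing B]
    {d : ℕ} (T : Matrix (Fin d) (Fin d) B) (hT : T.det ≠ 0) :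
    ∃ a : Fin d → B, Associated (∏ i, a i) T.det ∧
      Nonempty (((Fin d → B) ⧸ LinearMap.range T.mulVecLin) ≃ₗ[B] Π i, B ⧸ Ideal.span {a i}) := by
  have hinj : Function.Injective T.mulVecLin := mulVecLin_injective (mem_nonZeroDivisors_of_ne_zero hT)
  let N := LinearMap.range T.mulVecLin
  let e : (Fin d → B) ≃ₗ[B] N := LinearEquiv.ofInjective _ hinj
  have hrk : Module.finrank B N = Module.finrank B (Fin d → B) := e.finrank_eq.symm
  let b := Pi.basisFun B (Fin d)
  let a := Submodule.smithNormalFormCoeffs b hrk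
  let b' := Submodule.smithNormalFormTopBasis b hrk
  let ab := Submodule.smithNormalFormBotBasis b hrk
  have hab : ∀ i, (ab i : Fin d → B) = a i • b' i := Submodule.smithNormalFormBotBasis_def b hrk
  refine ⟨a, ?_, ⟨Submodule.quotientEquivPiSpan N b hrk⟩⟩
  -- In the adapted basis `φ` is diagonal, and `T` is `φ` composed with an automorphism. Hence the
  -- product of the elementary divisors differs from `T.det` by a unit.
  let φ : (Fin d → B) →ₗ[B] (Fin d → B) := b'.constr B fun i ↦ a i • b' i
  let ψ : (Fin d → B) ≃ₗ[B] (Fin d → B) := e.trans (ab.equiv b' (Equiv.refl _))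
  have h1 : ∀ n : N, φ (ab.equiv b' (Equiv.refl _) n) = n := by
    intro n
    have : φ ∘ₗ (ab.equiv b' (Equiv.refl _)).toLinearMap = N.subtype := ab.ext fun i ↦ by
      simp [φ, hab]
    exact LinearMap.congr_fun this n
  have h2 : T.mulVecLin = φ ∘ₗ ψ.toLinearMap := LinearMap.ext fun x ↦ (h1 (e x)).symm
  have h3 : T.det = LinearMap.det φ * LinearMap.det ψ.toLinearMap := by
    rw [← LinearMap.det_comp, ← h2, ← Matrix.toLin'_apply', LinearMap.det_toLin']
  have h4 : LinearMap.det φ = ∏ i, a i := by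
    rw [← LinearMap.det_toMatrix b']
    have : LinearMap.toMatrix b' b' φ = Matrix.diagonal a := by
      ext i j
      rw [LinearMap.toMatrix_apply, Matrix.diagonal_apply]
      simp only [φ, Module.Basis.constr_basis, map_smul, Module.Basis.repr_self, Finsupp.smul_apply,
        Finsupp.single_apply, smul_eq_mul, mul_ite, mul_one, mul_zero, eq_comm]
      split_ifs with h
      · rw [h]
      · rfl
    rw [this, Matrix.det_diagonal]
  rw [h3, h4]
  exact associated_mul_unit_right _ _ (LinearEquiv.isUnit_det' ψ)

end Smith


/-! ### Local isomorphisms and localized presentations -/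

section LocalIso

variable {A : Type*} [CommRing A]

/-- A linear map which becomes bijective after localization at a prime ideal. -/
def IsIsoAt (q : Ideal A) {M N : Type*} [AddCommGroup M] [Module A M] [AddCommGroup N] [Module A N]
    (f : M →ₗ[A] N) : Prop :=
  (∀ x, f x = 0 → ∃ s ∉ q, s • x = 0) ∧ ∀ y, ∃ s ∉ q, ∃ x, f x = s • y

theorem isPseudoNull_iff (M : Type*) [AddCommGroup M] [Module A M] :
    IsPseudoNull A M ↔ ∀ q : PrimeSpectrum A, q.asIdeal.height ≤ 1 →
      ∀ m : M, ∃ s ∉ q.asIdeal, s • m = 0 :=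
  forall₂_congr fun _ _ ↦ LocalizedModule.subsingleton_iff

theorem isPseudoIso_iff {M N : Type*} [AddCommGroup M] [Module A M] [AddCommGroup N] [Module A N]
    (f : M →ₗ[A] N) :
    IsPseudoIso f ↔ ∀ q : PrimeSpectrum A, q.asIdeal.height ≤ 1 → IsIsoAt q.asIdeal f := by
  rw [IsPseudoIso, isPseudoNull_iff, isPseudoNull_iff, ← forall₂_and]
  refine forall₂_congr fun q _ ↦ and_congr ⟨fun h x hx ↦ ?_, fun h x ↦ ?_⟩
    ⟨fun h y ↦ ?_, fun h y ↦ ?_⟩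
  · exact (h ⟨x, hx⟩).imp fun s hs ↦ ⟨hs.1, congrArg Subtype.val hs.2⟩
  · exact (h x x.2).imp fun s hs ↦ ⟨hs.1, Subtype.ext hs.2⟩
  · obtain ⟨s, hs, h'⟩ := h (Submodule.Quotient.mk y)
    rw [← Submodule.Quotient.mk_smul, Submodule.Quotient.mk_eq_zero] at h'
    exact ⟨s, hs, h'⟩
  · obtain ⟨y, rfl⟩ := Submodule.Quotient.mk_surjective _ y
    obtain ⟨s, hs, h'⟩ := h y
    refine ⟨s, hs, ?_⟩
    rw [← Submodule.Quotient.mk_smul, Submodule.Quotient.mk_eq_zero]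
    exact h'

variable (q : Ideal A) [q.IsPrime]

theorem IsIsoAt.isLocalizedModule {M N N' : Type*} [AddCommGroup M] [Module A M] [AddCommGroup N]
    [Module A N] [AddCommGroup N'] [Module A N'] {f : M →ₗ[A] N} (hf : IsIsoAt q f)
    (l : N →ₗ[A] N') [IsLocalizedModule q.primeCompl l] :
    IsLocalizedModule q.primeCompl (l ∘ₗ f) where
  map_units := IsLocalizedModule.map_units l
  surj y := by
    obtain ⟨⟨n, s⟩, hn⟩ := IsLocalizedModule.surj q.primeCompl l y
    obtain ⟨t, ht, x, hx⟩ := hf.2 n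
    refine ⟨(x, ⟨t, ht⟩ * s), ?_⟩
    change _ = l (f x)
    rw [hx, map_smul, ← hn, mul_smul]
    rfl
  exists_of_eq {x y} hxy := by
    obtain ⟨c, hc⟩ := IsLocalizedModule.exists_of_eq (S := q.primeCompl) (f := l) hxy
    obtain ⟨t, ht, h⟩ := hf.1 (c • x - c • y) (by
      rw [map_sub, Submonoid.smul_def, Submonoid.smul_def, map_smul, map_smul]
      exact sub_eq_zero.2 hc)
    refine ⟨⟨t, ht⟩ * c, ?_⟩
    rw [mul_smul, mul_smul, ← sub_eq_zero, ← smul_sub]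
    exact h

/-- The localization of `A / I` at a prime ideal. -/
noncomputable def quotLoc (I : Ideal A) : A ⧸ I →ₗ[A]
    Localization.AtPrime q ⧸ I.map (algebraMap A (Localization.AtPrime q)) :=
  ((Submodule.quotEquivOfEq _ _
    (Ideal.localized'_eq_map (Localization.AtPrime q) q.primeCompl I)).restrictScalars A).toLinearMap
    ∘ₗ Submodule.toLocalizedQuotient' (Localization.AtPrime q) q.primeCompl
      (Algebra.linearMap A (Localization.AtPrime q)) I

instance isLocalizedModule_quotLoc (I : Ideal A) :
    IsLocalizedModule q.primeCompl (quotLoc q I) :=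
  IsLocalizedModule.of_linearEquiv _ _ _

theorem length_eq_of_isLocalizedModule {M N N' : Type*} [AddCommGroup M] [Module A M]
    [AddCommGroup N] [Module A N] [AddCommGroup N'] [Module A N'] [Module (Localization.AtPrime q) N]
    [Module (Localization.AtPrime q) N'] [IsScalarTower A (Localization.AtPrime q) N]
    [IsScalarTower A (Localization.AtPrime q) N'] (f : M →ₗ[A] N) (g : M →ₗ[A] N')
    [IsLocalizedModule q.primeCompl f] [IsLocalizedModule q.primeCompl g] :
    Module.length (Localization.AtPrime q) N = Module.length (Localization.AtPrime q) N' :=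
  (LinearEquiv.extendScalarsOfIsLocalization q.primeCompl (Localization.AtPrime q)
    (IsLocalizedModule.linearEquiv q.primeCompl f g)).length_eq

theorem map_pow_eq_maximalIdeal_pow (n : ℕ) : (q ^ n).map (algebraMap A (Localization.AtPrime q)) =
    IsLocalRing.maximalIdeal (Localization.AtPrime q) ^ n := by
  rw [Ideal.map_pow, IsLocalization.AtPrime.map_eq_maximalIdeal]

/-- Smith normal form over the localization identifies the localized module with a product of
quotients by powers of the maximal ideal. This is also the localization of the product of the `A ⧸ q
^ e i`, and finite presentation allows descent to `A`. -/
theorem exists_isIsoAt [IsDomain (Localization.AtPrime q)]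
    [IsDiscreteValuationRing (Localization.AtPrime q)] {M : Type*} [AddCommGroup M] [Module A M]
    {d : ℕ} (T : Matrix (Fin d) (Fin d) A) (π : (Fin d → A) →ₗ[A] M)
    (hπ : Function.Surjective π) (hker : LinearMap.ker π = LinearMap.range T.mulVecLin)
    (hT : algebraMap A (Localization.AtPrime q) T.det ≠ 0) :
    ∃ (e : Fin d → ℕ) (h : M →ₗ[A] Π i, A ⧸ q ^ e i), IsIsoAt q h ∧
      (Ideal.span {T.det}).map (algebraMap A (Localization.AtPrime q)) =
        IsLocalRing.maximalIdeal (Localization.AtPrime q) ^ ∑ i, e i := by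
  let B := Localization.AtPrime q
  let T' := T.map (algebraMap A B)
  have hdet : T'.det = algebraMap A B T.det := ((algebraMap A B).map_det T).symm
  obtain ⟨a, ha, ⟨E₀⟩⟩ := exists_quotient_range_equiv T' (by rwa [hdet])
  have ha0 : ∀ i, a i ≠ 0 := fun i h ↦ (ha.ne_zero_iff.2 (by rwa [hdet]))
    (Finset.prod_eq_zero (Finset.mem_univ i) h)
  obtain ⟨ϖ, hϖ⟩ := IsDiscreteValuationRing.exists_irreducible B
  choose e he using fun i ↦ IsDiscreteValuationRing.associated_pow_irreducible (ha0 i) hϖ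
  have hspan : ∀ i, Ideal.span {a i} = (q ^ e i).map (algebraMap A B) := fun i ↦ by
    rw [map_pow_eq_maximalIdeal_pow, hϖ.maximalIdeal_eq, Ideal.span_singleton_pow,
      Ideal.span_singleton_eq_span_singleton]
    exact he i
  let f : (Fin d → A) →ₗ[A] (Fin d → B) :=
    LinearMap.pi fun i ↦ Algebra.linearMap A B ∘ₗ LinearMap.proj i
  have hrange : (LinearMap.range T.mulVecLin).localized' B q.primeCompl f =
      LinearMap.range T'.mulVecLin := by
    rw [Matrix.range_mulVecLin, Matrix.range_mulVecLin, Submodule.localized'_span, ← Set.range_comp]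
    rfl
  let eM : M ≃ₗ[A] (Fin d → A) ⧸ LinearMap.range T.mulVecLin :=
    (π.quotKerEquivOfSurjective hπ).symm.trans (Submodule.quotEquivOfEq _ _ hker)
  let E : ((Fin d → B) ⧸ (LinearMap.range T.mulVecLin).localized' B q.primeCompl f) ≃ₗ[B]
      Π i, B ⧸ (q ^ e i).map (algebraMap A B) :=
    ((Submodule.quotEquivOfEq _ _ hrange).trans E₀).trans
      (LinearEquiv.piCongrRight fun i ↦ Submodule.quotEquivOfEq _ _ (hspan i))
  let g : M →ₗ[A] Π i, B ⧸ (q ^ e i).map (algebraMap A B) :=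
    ((E.restrictScalars A).toLinearMap ∘ₗ
      Submodule.toLocalizedQuotient' B q.primeCompl f (LinearMap.range T.mulVecLin)) ∘ₗ eM.toLinearMap
  have hg : IsLocalizedModule q.primeCompl g := inferInstance
  let l : (Π i, A ⧸ q ^ e i) →ₗ[A] Π i, B ⧸ (q ^ e i).map (algebraMap A B) :=
    LinearMap.pi fun i ↦ quotLoc q (q ^ e i) ∘ₗ LinearMap.proj i
  have hl : IsLocalizedModule q.primeCompl l := inferInstance
  have : Module.FinitePresentation A M := Module.finitePresentation_of_surjective π hπ (by
    rw [hker, Matrix.range_mulVecLin]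
    exact Submodule.fg_span (Set.finite_range _))
  -- The map `g` to the localization lifts to the product over `A` after multiplication by an
  -- element `s` outside `q`; that factor is invertible locally and harmless.
  obtain ⟨h, s, hs⟩ := Module.FinitePresentation.exists_lift_of_isLocalizedModule q.primeCompl l g
  have hs' : ∀ x, l (h x) = s • g x := fun x ↦ LinearMap.congr_fun hs x
  refine ⟨e, h, ⟨fun x hx ↦ ?_, fun y ↦ ?_⟩, ?_⟩
  · have h1 : g x = 0 := IsLocalizedModule.smul_injective g s (by
      change s • g x = s • 0
      rw [← hs', hx, map_zero, smul_zero])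
    obtain ⟨t, ht⟩ := (IsLocalizedModule.eq_zero_iff q.primeCompl g).1 h1
    exact ⟨t, t.2, ht⟩
  · obtain ⟨⟨x, t⟩, hx⟩ := IsLocalizedModule.surj q.primeCompl g (l y)
    obtain ⟨u, hu⟩ := IsLocalizedModule.exists_of_eq (S := q.primeCompl) (f := l)
      (x₁ := h x) (x₂ := (s * t) • y) (by
        rw [hs', ← hx, Submonoid.smul_def (s * t), map_smul, ← Submonoid.smul_def, mul_smul])
    refine ⟨((u * (s * t) : q.primeCompl) : A), (u * (s * t)).2, u • x, ?_⟩
    rw [Submonoid.smul_def, map_smul]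
    change u • h x = _
    rw [hu, ← mul_smul]
    rfl
  · rw [Ideal.map_span, Set.image_singleton, ← hdet, hϖ.maximalIdeal_eq, Ideal.span_singleton_pow,
      Ideal.span_singleton_eq_span_singleton, ← Finset.prod_pow_eq_pow_sum]
    exact ha.symm.trans (Associated.prod _ _ _ fun i _ ↦ he i)

end LocalIso

end ProChar

namespace ProChar

/-! ### Characteristic ideals of quadratically presented modules -/

section Presentation

variable {A : Type*} [CommRing A] {M : Type*} [AddCommGroup M] [Module A M]

theorem IsQuadraticallyPresented.exists_matrix (h : IsQuadraticallyPresented A M) :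
    ∃ (d : ℕ) (T : Matrix (Fin d) (Fin d) A) (π : (Fin d → A) →ₗ[A] M),
      Function.Surjective π ∧ LinearMap.ker π = LinearMap.range T.mulVecLin := by
  obtain ⟨d, θ, π, hex, hπ⟩ := h
  refine ⟨d, LinearMap.toMatrix' θ, π, hπ, ?_⟩
  rw [← Matrix.toLin'_apply', Matrix.toLin'_toMatrix', LinearMap.exact_iff.1 hex]

variable {d : ℕ} {T : Matrix (Fin d) (Fin d) A} {π : (Fin d → A) →ₗ[A] M}

theorem det_smul_eq_zero (hπ : Function.Surjective π)
    (hker : LinearMap.ker π = LinearMap.range T.mulVecLin) (x : M) : T.det • x = 0 := by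
  obtain ⟨v, rfl⟩ := hπ x
  rw [← map_smul, ← LinearMap.mem_ker, hker]
  refine ⟨T.adjugate.mulVec v, ?_⟩
  rw [Matrix.mulVecLin_apply, Matrix.mulVec_mulVec, Matrix.mul_adjugate, Matrix.smul_mulVec,
    Matrix.one_mulVec]

/-- If `r` kills the cokernel, then `r` times the identity factors through `T`; take determinants.
-/
theorem det_dvd_pow (hker : LinearMap.ker π = LinearMap.range T.mulVecLin)
    {r : A} (hr : ∀ x : M, r • x = 0) : T.det ∣ r ^ d := by
  have h : ∀ j : Fin d, ∃ v, T.mulVec v = r • (Pi.single j 1 : Fin d → A) := fun j ↦ by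
    have h1 : r • (Pi.single j 1 : Fin d → A) ∈ LinearMap.ker π := by
      rw [LinearMap.mem_ker, map_smul, hr]
    rw [hker] at h1
    exact h1
  choose v hv using h
  have h2 : T * (Matrix.of v).transpose = r • (1 : Matrix (Fin d) (Fin d) A) := by
    ext i j
    have h3 := congrFun (hv j) i
    rw [Matrix.smul_apply, Matrix.one_apply]
    rw [Pi.smul_apply, Pi.single_apply] at h3
    exact h3
  refine ⟨(Matrix.of v).transpose.det, ?_⟩
  rw [← Matrix.det_mul, h2, Matrix.det_smul, Matrix.det_one, mul_one, Fintype.card_fin]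

theorem exists_smul_eq_zero (hπ : Function.Surjective π) (S : Submonoid A)
    (h : ∀ x : M, ∃ s ∈ S, s • x = 0) : ∃ s ∈ S, ∀ x : M, s • x = 0 := by
  choose s hs hs0 using fun j ↦ h (π (Pi.single j 1))
  refine ⟨∏ j, s j, Submonoid.prod_mem _ fun j _ ↦ hs j, fun x ↦ ?_⟩
  obtain ⟨v, rfl⟩ := hπ x
  rw [← map_smul, pi_eq_sum_univ v, Finset.smul_sum, map_sum]
  refine Finset.sum_eq_zero fun j _ ↦ ?_
  have h1 : (fun k ↦ if j = k then (1 : A) else 0) = Pi.single j 1 := by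
    ext k
    rw [Pi.single_apply]
    exact if_congr eq_comm rfl rfl
  rw [h1, map_smul, map_smul, ← Finset.mul_prod_erase _ _ (Finset.mem_univ j), mul_smul, smul_comm,
    smul_comm (s j), hs0, smul_zero, smul_zero]

theorem det_mem_nonZeroDivisors (hπ : Function.Surjective π)
    (hker : LinearMap.ker π = LinearMap.range T.mulVecLin) (htors : Module.IsTorsion A M) :
    T.det ∈ A⁰ := by
  obtain ⟨r, hr, hr0⟩ := exists_smul_eq_zero hπ A⁰ fun x ↦ by
    obtain ⟨s, hs⟩ := @htors x
    exact ⟨s, s.2, hs⟩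
  obtain ⟨c, hc⟩ := det_dvd_pow hker hr0
  have h : T.det * c ∈ A⁰ := hc ▸ pow_mem hr d
  exact (mul_mem_nonZeroDivisors.1 h).1

theorem isTorsion_of_det_mem (hπ : Function.Surjective π)
    (hker : LinearMap.ker π = LinearMap.range T.mulVecLin) (hT : T.det ∈ A⁰) :
    Module.IsTorsion A M :=
  fun {x} ↦ ⟨⟨T.det, hT⟩, det_smul_eq_zero hπ hker x⟩

/-- `T.det` kills `M`, and conversely it divides a power of anything that kills `M`. So the support
of `M` is the vanishing locus of `T.det`. -/
theorem mem_torsionPrimes_iff (hπ : Function.Surjective π)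
    (hker : LinearMap.ker π = LinearMap.range T.mulVecLin) (htors : Module.IsTorsion A M)
    (q : PrimeSpectrum A) :
    q ∈ torsionPrimes A M ↔ q.asIdeal.height = 1 ∧ T.det ∈ q.asIdeal := by
  refine and_congr_right fun _ ↦ ?_
  have htop : Submodule.torsion A M = ⊤ := (Submodule.isTorsion'_iff_torsion'_eq_top _).1 htors
  rw [← not_iff_not, Module.notMem_support_iff']
  constructor
  · intro h hd
    obtain ⟨s, hs, hs0⟩ := exists_smul_eq_zero hπ q.asIdeal.primeCompl fun x ↦ by
      obtain ⟨r, hr, hr0⟩ := h ⟨x, htop ▸ Submodule.mem_top⟩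
      exact ⟨r, hr, congrArg Subtype.val hr0⟩
    exact hs (q.2.mem_of_pow_mem d (Ideal.mem_of_dvd _ (det_dvd_pow hker hs0) hd))
  · exact fun h x ↦ ⟨T.det, h, Subtype.ext (det_smul_eq_zero hπ hker x)⟩

/-- By prime avoidance, a prime inside the finite union lies in one member. All members have height
one, so each of them is maximal among the primes in the union and the amenability condition applies
to it. -/
theorem IsAmenable.isValuationRing (ham : IsAmenable A M) {q : PrimeSpectrum A}
    (hq : q ∈ torsionPrimes A M) : IsValuationRing (Localization.AtPrime q.asIdeal) := by
  refine ham.localization q ⟨fun x hx ↦ Set.mem_biUnion hq hx, fun q' hq' hle ↦ ?_⟩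
  have h1 : (q'.asIdeal : Set A) ⊆ ⋃ r ∈ (↑ham.finite_torsionPrimes.toFinset : Set (PrimeSpectrum A)),
      (r.asIdeal : Set A) := by simpa using hq'
  obtain ⟨r, hr, hqr⟩ := (Ideal.subset_union_prime q q fun i _ _ _ ↦ i.2).1 h1
  have hr' : r ∈ torsionPrimes A M := by simpa using hr
  have : q.asIdeal.FiniteHeight := ⟨Or.inr (by rw [hq.1]; exact ENat.one_ne_top)⟩
  have hqr' : q.asIdeal = r.asIdeal := by
    by_contra hne
    have := Ideal.height_strict_mono_of_isPrime (lt_of_le_of_ne (le_trans hle hqr) hne)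
    rw [hq.1, hr'.1] at this
    exact lt_irrefl _ this
  exact hqr.trans hqr'.symm.le

end Presentation

/-! ### Lengths at height one primes -/

section IsIsoAt

variable {A : Type*} [CommRing A]

theorem IsIsoAt.equiv_comp {q : Ideal A} {M N N' : Type*} [AddCommGroup M] [Module A M]
    [AddCommGroup N] [Module A N] [AddCommGroup N'] [Module A N'] {f : M →ₗ[A] N}
    (hf : IsIsoAt q f) (e : N ≃ₗ[A] N') : IsIsoAt q (e.toLinearMap ∘ₗ f) := by
  refine ⟨fun x hx ↦ hf.1 x (e.map_eq_zero_iff.1 hx), fun y ↦ ?_⟩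
  obtain ⟨s, hs, x, hx⟩ := hf.2 (e.symm y)
  refine ⟨s, hs, x, ?_⟩
  rw [LinearMap.comp_apply, hx, map_smul]
  simp

theorem length_quotient_pow_localization (q r : PrimeSpectrum A)
    [IsDomain (Localization.AtPrime q.asIdeal)]
    [IsDiscreteValuationRing (Localization.AtPrime q.asIdeal)] (h : r.asIdeal ≤ q.asIdeal → r = q)
    [Decidable (r = q)] (n : ℕ) :
    Module.length (Localization.AtPrime q.asIdeal) (Localization.AtPrime q.asIdeal ⧸
      (r.asIdeal ^ n).map (algebraMap A (Localization.AtPrime q.asIdeal))) =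
        if r = q then (n : ℕ∞) else 0 := by
  split_ifs with hrq
  · subst hrq
    rw [map_pow_eq_maximalIdeal_pow, IsDiscreteValuationRing.length_quotient_pow_maximalIdeal]
  · obtain ⟨x, hxr, hxq⟩ := Set.not_subset.1 fun h' ↦ hrq (h h')
    have : (r.asIdeal ^ n).map (algebraMap A (Localization.AtPrime q.asIdeal)) = ⊤ :=
      Ideal.eq_top_of_isUnit_mem _ (Ideal.mem_map_of_mem _ (Ideal.pow_mem_pow hxr n))
        (IsLocalization.map_units _ (⟨x ^ n, (q.asIdeal.primeCompl.pow_mem hxq n)⟩ : q.asIdeal.primeCompl))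
    rw [this, Module.length_eq_zero_iff]
    exact Submodule.Quotient.subsingleton_iff.2 rfl

theorem maximalIdeal_pow_injective (B : Type*) [CommRing B] [IsDomain B] [IsDiscreteValuationRing B]
    {m n : ℕ} (h : IsLocalRing.maximalIdeal B ^ m = IsLocalRing.maximalIdeal B ^ n) : m = n := by
  have h1 := IsDiscreteValuationRing.length_quotient_pow_maximalIdeal (R := B) m
  rw [h, IsDiscreteValuationRing.length_quotient_pow_maximalIdeal] at h1
  exact_mod_cast h1.symm

theorem eq_of_le_of_height {q r : PrimeSpectrum A} (hr : r.asIdeal.height = 1)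
    (hq : q.asIdeal.height ≤ 1) (h : r.asIdeal ≤ q.asIdeal) : r = q := by
  have : r.asIdeal.FiniteHeight := ⟨Or.inr (by rw [hr]; exact ENat.one_ne_top)⟩
  by_contra hne
  have h1 := Ideal.height_strict_mono_of_isPrime (lt_of_le_of_ne h fun h' ↦ hne (PrimeSpectrum.ext h'))
  rw [hr] at h1
  exact absurd hq (not_le.2 h1)

-- This is what makes the characteristic ideal unique: the sum of the exponents at `q` is an
-- invariant of `M`, whatever pseudo-isomorphism is used.
open Classical in
theorem length_of_isIsoAt (q : PrimeSpectrum A) [IsDomain (Localization.AtPrime q.asIdeal)]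
    [IsDiscreteValuationRing (Localization.AtPrime q.asIdeal)] {M : Type*} [AddCommGroup M]
    [Module A M] {ι : Type*} [Fintype ι] (r : ι → PrimeSpectrum A)
    (hr : ∀ i, (r i).asIdeal ≤ q.asIdeal → r i = q) (e : ι → ℕ)
    (F : M →ₗ[A] Π i, A ⧸ (r i).asIdeal ^ e i) (hF : IsIsoAt q.asIdeal F) :
    Module.length (Localization.AtPrime q.asIdeal) (LocalizedModule q.asIdeal.primeCompl M) =
      ((∑ i, if r i = q then e i else 0 : ℕ) : ℕ∞) := by
  let l : (Π i, A ⧸ (r i).asIdeal ^ e i) →ₗ[A] Π i, Localization.AtPrime q.asIdeal ⧸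
      ((r i).asIdeal ^ e i).map (algebraMap A (Localization.AtPrime q.asIdeal)) :=
    LinearMap.pi fun i ↦ quotLoc q.asIdeal ((r i).asIdeal ^ e i) ∘ₗ LinearMap.proj i
  have h1 : IsLocalizedModule q.asIdeal.primeCompl (l ∘ₗ F) := hF.isLocalizedModule q.asIdeal l
  rw [length_eq_of_isLocalizedModule q.asIdeal
    (LocalizedModule.mkLinearMap q.asIdeal.primeCompl M) (l ∘ₗ F), Module.length_pi_of_fintype]
  push_cast
  refine Finset.sum_congr rfl fun i _ ↦ ?_
  exact length_quotient_pow_localization q (r i) (hr i) (e i)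

theorem exists_notMem_smul_eq_zero (q : PrimeSpectrum A) {ι : Type*} [Fintype ι]
    (r : ι → PrimeSpectrum A) (e : ι → ℕ) :
    ∃ s ∉ q.asIdeal, ∀ i, ¬ (r i).asIdeal ≤ q.asIdeal → s ∈ (r i).asIdeal ^ e i := by
  classical
  have h : ∀ i, ∃ s ∉ q.asIdeal, ¬ (r i).asIdeal ≤ q.asIdeal → s ∈ (r i).asIdeal ^ e i := fun i ↦ by
    by_cases hi : (r i).asIdeal ≤ q.asIdeal
    · exact ⟨1, q.asIdeal.one_notMem, fun h ↦ absurd hi h⟩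
    · obtain ⟨x, hxr, hxq⟩ := Set.not_subset.1 hi
      exact ⟨x ^ e i, fun h ↦ hxq (q.2.mem_of_pow_mem _ h), fun _ ↦ Ideal.pow_mem_pow hxr _⟩
  choose s hs hs' using h
  exact ⟨∏ i, s i, Submonoid.prod_mem q.asIdeal.primeCompl fun i _ ↦ hs i, fun i hi ↦
    Ideal.mem_of_dvd _ (Finset.dvd_prod_of_mem s (Finset.mem_univ i)) (hs' i hi)⟩

end IsIsoAt

/-! ### Existence and uniqueness of the characteristic ideal -/

section CharIdeal

variable {A : Type*} [CommRing A] [IsReduced A] {M : Type*} [AddCommGroup M] [Module A M]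
  {d : ℕ} {T : Matrix (Fin d) (Fin d) A} {π : (Fin d → A) →ₗ[A] M}

theorem IsAmenable.isDomain (ham : IsAmenable A M) {q : PrimeSpectrum A}
    (hq : q ∈ torsionPrimes A M) : IsDomain (Localization.AtPrime q.asIdeal) :=
  isDomain_localization q.asIdeal (ham.isValuationRing hq)

theorem exists_isIsoAt_nat (ham : IsAmenable A M) (hπ : Function.Surjective π)
    (hker : LinearMap.ker π = LinearMap.range T.mulVecLin) (hT : T.det ∈ A⁰) (q : PrimeSpectrum A) :
    ∃ e : ℕ → ℕ, q ∈ torsionPrimes A M → ∃ h : M →ₗ[A] Π i : Fin d, A ⧸ q.asIdeal ^ e i,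
      IsIsoAt q.asIdeal h ∧
      (Ideal.span {T.det}).map (algebraMap A (Localization.AtPrime q.asIdeal)) =
        IsLocalRing.maximalIdeal (Localization.AtPrime q.asIdeal) ^ ∑ i : Fin d, e i := by
  by_cases hq : q ∈ torsionPrimes A M
  · have hdom := ham.isDomain hq
    have := isDiscreteValuationRing_localization q.asIdeal (ham.isValuationRing hq) hq.1 (ham.fg q hq)
    have hT' : algebraMap A (Localization.AtPrime q.asIdeal) T.det ≠ 0 := fun h ↦ by
      obtain ⟨s, hs⟩ := (IsLocalization.map_eq_zero_iff q.asIdeal.primeCompl _ _).1 h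
      exact s.2 (by rw [(mem_nonZeroDivisors_iff_right.1 hT) _ hs]; exact zero_mem _)
    obtain ⟨e, h⟩ := exists_isIsoAt q.asIdeal T π hπ hker hT'
    -- The exponents are padded by zero beyond `d` to match the shape used in `IsCharIdeal`; only
    -- the values below `d` matter.
    obtain ⟨e', rfl⟩ : ∃ e' : ℕ → ℕ, e = fun i : Fin d ↦ e' i :=
      ⟨fun n ↦ if h : n < d then e ⟨n, h⟩ else 0, by ext i; simp⟩
    exact ⟨e', fun _ ↦ h⟩
  · exact ⟨0, fun h ↦ absurd h hq⟩

/-- Uniqueness follows by comparing lengths at each `q` with the local Smith form. For existence,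
the local maps are put together: near one prime of the support the components at the others vanish,
and away from the support both sides vanish. -/
theorem isCharIdeal_iff (ham : IsAmenable A M) (hπ : Function.Surjective π)
    (hker : LinearMap.ker π = LinearMap.range T.mulVecLin) (htors : Module.IsTorsion A M)
    (E : PrimeSpectrum A → ℕ) (hE : ∀ q ∈ torsionPrimes A M,
      (Ideal.span {T.det}).map (algebraMap A (Localization.AtPrime q.asIdeal)) =
        IsLocalRing.maximalIdeal (Localization.AtPrime q.asIdeal) ^ E q) (I : Ideal A) :
    IsCharIdeal A M I ↔ I = ∏ q ∈ ham.finite_torsionPrimes.toFinset, q.asIdeal ^ E q := by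
  classical
  have hT := det_mem_nonZeroDivisors hπ hker htors
  choose e he using exists_isIsoAt_nat ham hπ hker hT
  have : Fintype (torsionPrimes A M) := ham.finite_torsionPrimes.fintype
  constructor
  · rintro ⟨hfin, m, e', f, hf, rfl⟩
    refine Finset.prod_congr rfl fun q hq ↦ ?_
    rw [Set.Finite.mem_toFinset] at hq
    congr 1
    have hdom := ham.isDomain hq
    have hdvr := isDiscreteValuationRing_localization q.asIdeal (ham.isValuationRing hq) hq.1
      (ham.fg q hq)
    obtain ⟨h, hh, hdet⟩ := he q hq
    rw [hE q hq] at hdet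
    rw [maximalIdeal_pow_injective _ hdet]
    have hf' := ((isPseudoIso_iff f).1 hf q hq.1.le).equiv_comp
      (DirectSum.linearEquivFunOnFintype A _ _)
    have hle : ∀ r ∈ torsionPrimes A M, r.asIdeal ≤ q.asIdeal → r = q :=
      fun r hr ↦ eq_of_le_of_height hr.1 hq.1.le
    have h1 := length_of_isIsoAt q (fun i : Σ r : torsionPrimes A M, Fin (m r) ↦ i.1.1)
      (fun i ↦ hle _ i.1.2) (fun i ↦ e' i.1 i.2) _ hf'
    have h2 := length_of_isIsoAt q (fun _ : Fin d ↦ q) (fun _ _ ↦ rfl) (fun i ↦ e q i) h hh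
    rw [h1, Nat.cast_inj, Fintype.sum_sigma, Finset.sum_eq_single ⟨q, hq⟩] at h2
    · simpa [Finset.sum_range] using h2
    · intro r _ hr
      exact Finset.sum_eq_zero fun i _ ↦ if_neg fun h' ↦ hr (Subtype.ext h')
    · exact fun h' ↦ absurd (Finset.mem_univ _) h'
  · rintro rfl
    choose! h hh hdet using he
    let ι := Σ _ : torsionPrimes A M, Fin d
    let F : M →ₗ[A] Π i : ι, A ⧸ (i.1.1.asIdeal ^ e i.1 i.2) :=
      LinearMap.pi fun i ↦ LinearMap.proj i.2 ∘ₗ h i.1.1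
    have hF : ∀ q : PrimeSpectrum A, q.asIdeal.height ≤ 1 → IsIsoAt q.asIdeal F := by
      intro q hq
      obtain ⟨t, ht, ht'⟩ := exists_notMem_smul_eq_zero q (fun i : ι ↦ i.1.1) (fun i ↦ e i.1 i.2)
      have hle : ∀ r ∈ torsionPrimes A M, r.asIdeal ≤ q.asIdeal → r = q :=
        fun r hr ↦ eq_of_le_of_height hr.1 hq
      have hkill : ∀ (i : ι) (y : A ⧸ (i.1.1.asIdeal ^ e i.1 i.2)), i.1.1 ≠ q → t • y = 0 := by
        intro i y hi
        obtain ⟨y, rfl⟩ := Ideal.Quotient.mk_surjective y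
        rw [← Ideal.Quotient.mk_eq_mk, ← Submodule.Quotient.mk_smul, Submodule.Quotient.mk_eq_zero]
        exact Ideal.mul_mem_right _ _ (ht' i fun h' ↦ hi (hle _ i.1.2 h'))
      by_cases hqP : q ∈ torsionPrimes A M
      · refine ⟨fun x hx ↦ (hh q hqP).1 x ?_, fun y ↦ ?_⟩
        · funext i
          exact congrFun hx ⟨⟨q, hqP⟩, i⟩
        · obtain ⟨s, hs, x, hx⟩ := (hh q hqP).2 fun i ↦ y ⟨⟨q, hqP⟩, i⟩
          -- The factor `t` lies outside `q` and kills the components at all primes other than `q`,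
          -- so only the local statement at `q` remains.
          refine ⟨t * s, q.asIdeal.primeCompl.mul_mem ht hs, t • x, ?_⟩
          rw [map_smul, mul_smul]
          funext i
          obtain ⟨⟨r, hr⟩, i⟩ := i
          rcases eq_or_ne r q with rfl | hrq
          · exact congrArg (t • ·) (congrFun hx i)
          · exact (hkill ⟨⟨r, hr⟩, i⟩ _ hrq).trans (hkill ⟨⟨r, hr⟩, i⟩ _ hrq).symm
      -- A prime of height zero cannot contain the non-zero-divisor `T.det`, and one of height one
      -- containing it would belong to the support.
      · have hd : T.det ∉ q.asIdeal := by
          intro hd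
          refine hqP ((mem_torsionPrimes_iff hπ hker htors q).2 ⟨le_antisymm hq ?_, hd⟩)
          rw [Order.one_le_iff_ne_zero, Ne, Ideal.height_eq_zero_iff]
          exact fun hmin ↦ Set.disjoint_left.1
            (Ideal.disjoint_nonZeroDivisors_of_mem_minimalPrimes hmin) hd hT
        refine ⟨fun x _ ↦ ⟨_, hd, det_smul_eq_zero hπ hker x⟩, fun y ↦ ⟨t, ht, 0, ?_⟩⟩
        rw [map_zero]
        funext i
        exact (hkill i _ fun h' ↦ hqP (h' ▸ i.1.2)).symm
    refine ⟨ham.finite_torsionPrimes, fun _ ↦ d, e,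
      (DirectSum.linearEquivFunOnFintype A ι _).symm.toLinearMap ∘ₗ F,
      (isPseudoIso_iff _).2 fun q hq ↦ (hF q hq).equiv_comp _, ?_⟩
    refine Finset.prod_congr rfl fun q hq ↦ ?_
    rw [Set.Finite.mem_toFinset] at hq
    have hdom := ham.isDomain hq
    have hdvr := isDiscreteValuationRing_localization q.asIdeal (ham.isValuationRing hq) hq.1
      (ham.fg q hq)
    have h1 := hdet q hq
    rw [hE q hq] at h1
    rw [maximalIdeal_pow_injective _ h1, Finset.sum_range]

end CharIdeal

end ProChar

namespace ProChar

/-! ### Rings with finitely many components -/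

/-- A ring `A` with surjective maps to finitely many domains `B ψ`, whose kernels are the distinct
minimal primes of `A` and have intersection zero, and such that the height one primes containing
two of the kernels are well behaved. -/
structure HasComponents {A : Type*} [CommRing A] {Ψ : Type*} (B : Ψ → Type*) [∀ ψ, CommRing (B ψ)]
    (pr : ∀ ψ, A →+* B ψ) : Prop where
  surjective : ∀ ψ, Function.Surjective (pr ψ)
  eq_zero : ∀ a, (∀ ψ, pr ψ a = 0) → a = 0
  eq_of_ker_le : ∀ ψ ψ', RingHom.ker (pr ψ) ≤ RingHom.ker (pr ψ') → ψ = ψ'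
  exists_comap_eq : ∀ ψ ψ' (f : B ψ), Prime f → ψ ≠ ψ' →
    RingHom.ker (pr ψ') ≤ (Ideal.span {f}).comap (pr ψ) →
    ∃ f' : B ψ', Prime f' ∧ (∀ x, x ≠ 0 → FiniteMultiplicity f' x) ∧
      (Ideal.span {f}).comap (pr ψ) = (Ideal.span {f'}).comap (pr ψ')

namespace HasComponents

variable {A : Type*} [CommRing A] {Ψ : Type*} {B : Ψ → Type*} [∀ ψ, CommRing (B ψ)]
  {pr : ∀ ψ, A →+* B ψ}

theorem ker_le_comap (ψ : Ψ) (J : Ideal (B ψ)) : RingHom.ker (pr ψ) ≤ J.comap (pr ψ) :=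
  Ideal.comap_mono bot_le

theorem mem_of_mem_comap_span (h : HasComponents B pr) {ψ : Ψ} {q : Ideal A}
    (hq : RingHom.ker (pr ψ) ≤ q) {F : A} (hF : F ∈ q) :
    (Ideal.span {pr ψ F}).comap (pr ψ) ≤ q := by
  intro z hz
  obtain ⟨c, hc⟩ := Ideal.mem_span_singleton.1 hz
  obtain ⟨C, rfl⟩ := h.surjective ψ c
  have h1 : z - F * C ∈ q := hq (by rw [RingHom.mem_ker, map_sub, map_mul, hc, sub_self])
  simpa using q.add_mem h1 (q.mul_mem_right C hF)

theorem isPrime_comap_span {ψ : Ψ} {f : B ψ} (hf : Prime f) :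
    ((Ideal.span {f}).comap (pr ψ)).IsPrime := by
  have := (Ideal.span_singleton_prime hf.ne_zero).2 hf
  infer_instance

/-- For `a ∈ q` with nonzero component, split off the exact power of `f`. Either `f` or the
remaining factor would then lift to an element of `q`, and both contradict strict inclusion in the
preimage of `(f)`. Finite multiplicity of `f` replaces unique factorization here. -/
theorem eq_ker_of_lt (h : HasComponents B pr) {ψ : Ψ} {f : B ψ}
    (hfm : ∀ x, x ≠ 0 → FiniteMultiplicity f x) {q : Ideal A} [hq : q.IsPrime] (hker : RingHom.ker (pr ψ) ≤ q)
    (hlt : q < (Ideal.span {f}).comap (pr ψ)) : q = RingHom.ker (pr ψ) := by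
  refine le_antisymm (fun a ha ↦ ?_) hker
  by_contra hne
  obtain ⟨y, hy, hfy⟩ := (hfm _ hne).exists_eq_pow_mul_and_not_dvd
  obtain ⟨F, rfl⟩ := h.surjective ψ f
  obtain ⟨Y, rfl⟩ := h.surjective ψ y
  have h1 := h.mem_of_mem_comap_span hker ha (x := F ^ multiplicity (pr ψ F) (pr ψ a) * Y) (by
    rw [Ideal.mem_comap, Ideal.mem_span_singleton, map_mul, map_pow]
    exact dvd_of_eq hy)
  rcases hq.mem_or_mem h1 with h2 | h2
  · exact not_le_of_gt hlt (h.mem_of_mem_comap_span hker (hq.mem_of_pow_mem _ h2))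
  · exact hfy (Ideal.mem_span_singleton.1 (hlt.le h2))

theorem exists_ker_le [Finite Ψ] (h : HasComponents B pr) (q : Ideal A) [hq : q.IsPrime] :
    ∃ ψ, RingHom.ker (pr ψ) ≤ q := by
  have := Fintype.ofFinite Ψ
  have h1 : Finset.univ.inf (fun ψ ↦ RingHom.ker (pr ψ)) ≤ q := fun a ha ↦ by
    rw [Submodule.mem_finsetInf] at ha
    rw [h.eq_zero a fun ψ ↦ ha ψ (Finset.mem_univ ψ)]
    exact zero_mem q
  obtain ⟨ψ, -, hψ⟩ := (Ideal.IsPrime.inf_le' hq).1 h1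
  exact ⟨ψ, hψ⟩

variable [∀ ψ, IsDomain (B ψ)]

theorem isReduced (h : HasComponents B pr) : IsReduced A := by
  refine ⟨fun a ⟨n, hn⟩ ↦ h.eq_zero a fun ψ ↦ ?_⟩
  refine eq_zero_of_pow_eq_zero (n := n) ?_
  rw [← map_pow, hn, map_zero]

variable [Fintype Ψ]

theorem ker_mem_minimalPrimes (h : HasComponents B pr) (ψ : Ψ) :
    RingHom.ker (pr ψ) ∈ minimalPrimes A := by
  refine ⟨⟨RingHom.ker_isPrime _, bot_le⟩, fun q ⟨hq, _⟩ hle ↦ ?_⟩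
  obtain ⟨ψ', hψ'⟩ := h.exists_ker_le q
  rwa [h.eq_of_ker_le _ _ (hψ'.trans hle)] at hψ'

theorem mem_nonZeroDivisors_iff (h : HasComponents B pr) (a : A) :
    a ∈ A⁰ ↔ ∀ ψ, pr ψ a ≠ 0 := by
  refine ⟨fun ha ψ h0 ↦ Set.disjoint_left.1
    (Ideal.disjoint_nonZeroDivisors_of_mem_minimalPrimes (h.ker_mem_minimalPrimes ψ)) h0 ha,
    fun ha ↦ mem_nonZeroDivisors_iff_left.2 fun x hx ↦ h.eq_zero x fun ψ ↦ ?_⟩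
  have h1 := congrArg (pr ψ) hx
  rw [map_mul, map_zero] at h1
  exact (mul_eq_zero.1 h1).resolve_left (ha ψ)

/-- A smaller prime contains some component kernel. If it is the kernel of another component,
`exists_comap_eq` rewrites the given prime in terms of that component; in either case the smaller
prime is a minimal one. -/
theorem height_comap_span (h : HasComponents B pr) {ψ : Ψ} {f : B ψ} (hf : Prime f)
    (hfm : ∀ x, x ≠ 0 → FiniteMultiplicity f x) :
    ((Ideal.span {f}).comap (pr ψ)).height = 1 := by
  have hQ := isPrime_comap_span (pr := pr) hf
  refine le_antisymm ?_ ?_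
  · refine Ideal.height_le_iff.2 fun q hq hlt ↦ ?_
    rw [Nat.cast_one, Order.lt_one_iff, Ideal.height_eq_zero_iff]
    obtain ⟨ψ', hψ'⟩ := h.exists_ker_le q
    by_cases hne : ψ = ψ'
    · subst hne
      rw [h.eq_ker_of_lt hfm hψ' hlt]
      exact h.ker_mem_minimalPrimes ψ
    · obtain ⟨f', hf', hfm', heq⟩ := h.exists_comap_eq ψ ψ' f hf hne (hψ'.trans hlt.le)
      rw [heq] at hlt
      rw [h.eq_ker_of_lt hfm' hψ' hlt]
      exact h.ker_mem_minimalPrimes ψ'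
  · rw [Order.one_le_iff_ne_zero, Ne, Ideal.height_eq_zero_iff]
    intro hmin
    have h1 := hmin.2 ⟨RingHom.ker_isPrime (pr ψ), bot_le⟩ (ker_le_comap ψ _)
    obtain ⟨F, rfl⟩ := h.surjective ψ f
    exact hf.ne_zero (h1 (Ideal.mem_span_singleton_self (pr ψ F)))

/-- The kernel of localization is then prime, so it contains a component kernel; incomparability of
the kernels leaves only that of `ψ`. In particular `q` lies over a single component. -/
theorem ker_eq_of_isDomain (h : HasComponents B pr) {q : Ideal A} [q.IsPrime]
    [IsDomain (Localization.AtPrime q)] {ψ : Ψ} (hψ : RingHom.ker (pr ψ) ≤ q) :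
    RingHom.ker (algebraMap A (Localization.AtPrime q)) = RingHom.ker (pr ψ) := by
  have h1 : RingHom.ker (algebraMap A (Localization.AtPrime q)) ≤ RingHom.ker (pr ψ) := fun a ha ↦ by
    obtain ⟨s, hs⟩ := (IsLocalization.map_eq_zero_iff q.primeCompl _ _).1 ha
    have h2 := congrArg (pr ψ) hs
    rw [map_mul, map_zero] at h2
    exact (mul_eq_zero.1 h2).resolve_left fun h3 ↦ s.2 (hψ h3)
  have := RingHom.ker_isPrime (algebraMap A (Localization.AtPrime q))
  obtain ⟨ψ', hψ'⟩ := h.exists_ker_le (RingHom.ker (algebraMap A (Localization.AtPrime q)))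
  rw [h.eq_of_ker_le _ _ (hψ'.trans h1)] at hψ'
  exact le_antisymm h1 hψ'

theorem eq_of_isDomain (h : HasComponents B pr) {q : Ideal A} [q.IsPrime]
    [IsDomain (Localization.AtPrime q)] {ψ ψ' : Ψ} (hψ : RingHom.ker (pr ψ) ≤ q)
    (hψ' : RingHom.ker (pr ψ') ≤ q) : ψ = ψ' :=
  h.eq_of_ker_le _ _ ((h.ker_eq_of_isDomain hψ).symm.trans (h.ker_eq_of_isDomain hψ')).le

open Classical in
theorem span_algebraMap_eq (h : HasComponents B pr) {q : Ideal A} [q.IsPrime]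
    [IsDomain (Localization.AtPrime q)] {ψ : Ψ} {f₀ : B ψ} (hf₀ : Prime f₀)
    (hq : q = (Ideal.span {f₀}).comap (pr ψ)) {F : A} (hF : Prime (pr ψ F)) :
    Ideal.span {algebraMap A (Localization.AtPrime q) F} =
      if (Ideal.span {pr ψ F}).comap (pr ψ) = q then
        IsLocalRing.maximalIdeal (Localization.AtPrime q) else ⊤ := by
  have hker : RingHom.ker (pr ψ) ≤ q := hq ▸ ker_le_comap ψ _
  split_ifs with h1
  · have hFq : F ∈ q := by rw [← h1]; exact Ideal.mem_span_singleton_self _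
    rw [← IsLocalization.AtPrime.map_eq_maximalIdeal q]
    refine le_antisymm ?_ (Ideal.map_le_iff_le_comap.2 ?_)
    · rw [Ideal.span_le, Set.singleton_subset_iff]
      exact Ideal.mem_map_of_mem _ hFq
    · nth_rewrite 1 [← h1]
      refine h.mem_of_mem_comap_span ?_ (Ideal.mem_span_singleton_self _)
      rw [← h.ker_eq_of_isDomain hker]
      exact Ideal.comap_mono bot_le
  · refine Ideal.span_singleton_eq_top.2 (IsLocalization.map_units _ (⟨F, fun hFq ↦ h1 ?_⟩ : q.primeCompl))
    rw [hq] at hFq ⊢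
    have h2 := hf₀.associated_of_dvd hF (Ideal.mem_span_singleton.1 hFq)
    rw [Ideal.span_singleton_eq_span_singleton.2 h2]

variable {M : Type*} [AddCommGroup M] [Module A M] {d : ℕ} {T : Matrix (Fin d) (Fin d) A}
  {π : (Fin d → A) →ₗ[A] M}

/-- The characteristic ideal, in terms of the prime factors of the components of the determinant of
a presentation. -/
theorem isCharIdeal_iff (h : HasComponents B pr) (ham : IsAmenable A M) (hπ : Function.Surjective π)
    (hker : LinearMap.ker π = LinearMap.range T.mulVecLin) (htors : Module.IsTorsion A M)
    (s : ∀ ψ, Multiset (B ψ)) (hs : ∀ ψ, Associated (s ψ).prod (pr ψ T.det))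
    (hp : ∀ ψ, ∀ f ∈ s ψ, Prime f ∧ ∀ x, x ≠ 0 → FiniteMultiplicity f x) (I : Ideal A) :
    IsCharIdeal A M I ↔
      I = ∏ ψ, ((s ψ).map fun f ↦ (Ideal.span {f}).comap (pr ψ)).prod := by
  classical
  have hred := h.isReduced
  -- The preimages of the principal ideals of all prime factors, counted with multiplicity; the
  -- order of the determinant at `q` will be the count of `q` in this multiset.
  let 𝒬 : Multiset (Ideal A) := ∑ ψ, (s ψ).map fun f ↦ (Ideal.span {f}).comap (pr ψ)
  have h𝒬 : ∀ J, J ∈ 𝒬 ↔ ∃ ψ, ∃ f ∈ s ψ, (Ideal.span {f}).comap (pr ψ) = J := fun J ↦ by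
    simp [𝒬, Multiset.mem_sum]
  have hmem : ∀ q : PrimeSpectrum A, q ∈ torsionPrimes A M ↔ q.asIdeal ∈ 𝒬 := by
    intro q
    rw [mem_torsionPrimes_iff hπ hker htors, h𝒬]
    constructor
    · rintro ⟨hq, hd⟩
      obtain ⟨ψ, hψ⟩ := h.exists_ker_le q.asIdeal
      have hprime := Ideal.map_isPrime_of_surjective (h.surjective ψ) hψ
      have h1 : (s ψ).prod ∈ q.asIdeal.map (pr ψ) := by
        obtain ⟨u, hu⟩ := hs ψ
        have h2 : (s ψ).prod * u ∈ q.asIdeal.map (pr ψ) := hu ▸ Ideal.mem_map_of_mem _ hd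
        exact (hprime.mem_or_mem h2).resolve_right fun h3 ↦
          hprime.ne_top (Ideal.eq_top_of_isUnit_mem _ h3 u.isUnit)
      obtain ⟨f, hf, hfq⟩ := (Ideal.IsPrime.multiset_prod_mem_iff_exists_mem hprime _).1 h1
      have hQ := isPrime_comap_span (pr := pr) (hp ψ f hf).1
      obtain ⟨F, hF, rfl⟩ := (Ideal.mem_map_iff_of_surjective _ (h.surjective ψ)).1 hfq
      refine ⟨ψ, _, hf, congrArg PrimeSpectrum.asIdeal (eq_of_le_of_height
        (r := ⟨_, hQ⟩) (h.height_comap_span (hp ψ _ hf).1 (hp ψ _ hf).2) hq.le ?_)⟩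
      exact h.mem_of_mem_comap_span hψ hF
    · rintro ⟨ψ, f, hf, hq⟩
      rw [← hq]
      refine ⟨h.height_comap_span (hp ψ f hf).1 (hp ψ f hf).2, ?_⟩
      rw [Ideal.mem_comap, Ideal.mem_span_singleton]
      exact (Multiset.dvd_prod hf).trans (hs ψ).dvd
  rw [ProChar.isCharIdeal_iff ham hπ hker htors (fun q ↦ 𝒬.count q.asIdeal) fun q hq ↦ ?_]
  · have h1 : ∏ ψ, ((s ψ).map fun f ↦ (Ideal.span {f}).comap (pr ψ)).prod = 𝒬.prod :=
      (Multiset.prod_sum _ _).symm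
    rw [h1, Finset.prod_multiset_count]
    have h2 : ∏ q ∈ ham.finite_torsionPrimes.toFinset, q.asIdeal ^ 𝒬.count q.asIdeal =
        ∏ J ∈ 𝒬.toFinset, J ^ 𝒬.count J := by
      refine Finset.prod_nbij PrimeSpectrum.asIdeal (fun q hq ↦ ?_)
        (fun q _ r _ hqr ↦ PrimeSpectrum.ext hqr) (fun J hJ ↦ ?_) fun _ _ ↦ rfl
      · rw [Multiset.mem_toFinset, ← hmem]
        simpa using hq
      · have hJ' : J ∈ 𝒬 := by simpa using hJ
        obtain ⟨ψ, f, hf, rfl⟩ := (h𝒬 J).1 hJ'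
        refine ⟨⟨_, isPrime_comap_span (pr := pr) (hp ψ f hf).1⟩, ?_, rfl⟩
        simpa [hmem] using hJ'
    rw [h2]
  · have hdom := ham.isDomain hq
    obtain ⟨ψ, f₀, hf₀, hq₀⟩ := (h𝒬 _).1 ((hmem q).1 hq)
    have hψ : RingHom.ker (pr ψ) ≤ q.asIdeal := hq₀ ▸ ker_le_comap ψ _
    have hcount : 𝒬.count q.asIdeal =
        ((s ψ).map fun f ↦ (Ideal.span {f}).comap (pr ψ)).count q.asIdeal := by
      rw [Multiset.count_sum']
      refine Finset.sum_eq_single ψ (fun ψ' _ hne ↦ Multiset.count_eq_zero.2 fun hm ↦ hne ?_)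
        fun h' ↦ absurd (Finset.mem_univ ψ) h'
      obtain ⟨f, -, hf⟩ := Multiset.mem_map.1 hm
      exact h.eq_of_isDomain (hf ▸ ker_le_comap ψ' _) hψ
    let σ := Function.surjInv (h.surjective ψ)
    have hσ : ∀ b, pr ψ (σ b) = b := Function.surjInv_eq (h.surjective ψ)
    let al := algebraMap A (Localization.AtPrime q.asIdeal)
    have hal : ∀ {a b}, pr ψ a = pr ψ b → al a = al b := fun {a b} hab ↦ by
      rw [← sub_eq_zero, ← map_sub, ← RingHom.mem_ker, h.ker_eq_of_isDomain hψ, RingHom.mem_ker,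
        map_sub, hab, sub_self]
    -- At `q` each prime factor of the component `ψ` becomes a uniformizer or a unit, so the order
    -- of a product is the number of factors whose preimage is `q`.
    have key : ∀ t : Multiset (B ψ), (∀ f ∈ t, Prime f) →
        Ideal.span {al (σ t.prod)} = IsLocalRing.maximalIdeal (Localization.AtPrime q.asIdeal) ^
          (t.map fun f ↦ (Ideal.span {f}).comap (pr ψ)).count q.asIdeal := by
      intro t ht
      induction t using Multiset.induction with
      | empty =>
        rw [Multiset.prod_zero, hal (b := 1) (by rw [hσ, map_one]), map_one]
        simp
      | cons f t ih =>
        rw [Multiset.prod_cons, hal (b := σ f * σ t.prod) (by simp [hσ]), map_mul,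
          ← Ideal.span_singleton_mul_span_singleton, ih fun g hg ↦ ht g (Multiset.mem_cons_of_mem hg),
          Multiset.map_cons, Multiset.count_cons,
          h.span_algebraMap_eq (hp ψ f₀ hf₀).1 hq₀.symm (F := σ f)
            (by rw [hσ]; exact ht f (Multiset.mem_cons_self f t)), hσ]
        by_cases hfq : (Ideal.span {f}).comap (pr ψ) = q.asIdeal
        · rw [if_pos hfq, if_pos hfq.symm, pow_succ, mul_comm]
        · rw [if_neg hfq, if_neg (Ne.symm hfq), Ideal.top_mul, add_zero]
    rw [hcount, ← key (s ψ) fun f hf ↦ (hp ψ f hf).1, Ideal.map_span, Set.image_singleton,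
      Ideal.span_singleton_eq_span_singleton]
    obtain ⟨u, hu⟩ := hs ψ
    have h1 : al T.det = al (σ (s ψ).prod) * al (σ u) := by
      rw [← map_mul]
      exact hal (by rw [map_mul, hσ, hσ, hu])
    have h2 : IsUnit (al (σ u)) :=
      IsLocalization.map_units _ (⟨σ u, fun hm ↦ by
        have hm : σ u ∈ (Ideal.span {f₀}).comap (pr ψ) := hq₀ ▸ hm
        rw [Ideal.mem_comap, hσ, Ideal.mem_span_singleton] at hm
        exact (hp ψ f₀ hf₀).1.not_isUnit (isUnit_of_dvd_unit hm u.isUnit)⟩ : q.asIdeal.primeCompl)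
    change Associated (al T.det) _
    rw [h1]
    exact (associated_mul_unit_right _ _ h2).symm

end HasComponents

end ProChar

namespace ProChar

/-! ### The group ring of a finite abelian group over the `p`-adic integers -/

/-- Modulo `ϖ` the power `x ^ (N - 1)` is idempotent. By Hensel's lemma it lifts to an idempotent of
the domain `S`, which is `0` or `1`; so `x` is divisible by `ϖ` or a unit, and `ϖ` generates the
maximal ideal. -/
theorem isDiscreteValuationRing_of_dvd_pow_sub {S : Type*} [CommRing S] [IsDomain S]
    [IsNoetherianRing S] [TopologicalSpace S] [IsTopologicalRing S] [CompactSpace S] [T2Space S]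
    {ϖ : S} (h0 : ϖ ≠ 0) (hu : ¬ IsUnit ϖ) {N : ℕ} (hN : 2 ≤ N) (h : ∀ x : S, ϖ ∣ x ^ N - x) :
    IsDiscreteValuationRing S := by
  have hne : Ideal.span {ϖ} ≠ ⊤ := by rwa [Ne, Ideal.span_singleton_eq_top]
  have hcomp : IsAdicComplete (Ideal.span {ϖ}) S :=
    { haus' := have := IsHausdorff.of_isDomain _ hne; IsHausdorff.haus this
      prec' := (isPrecomplete_of_fg ⟨{ϖ}, by simp⟩).prec' }
  have hhens : HenselianRing S (Ideal.span {ϖ}) := inferInstance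
  have hunit : ∀ x : S, ¬ ϖ ∣ x → IsUnit x := by
    intro x hx
    have hmod : Ideal.Quotient.mk (Ideal.span {ϖ}) (x ^ (N - 1) * x) =
        Ideal.Quotient.mk (Ideal.span {ϖ}) x := by
      rw [← pow_succ, Nat.sub_add_cancel (by omega), Ideal.Quotient.mk_eq_mk_iff_sub_mem,
        Ideal.mem_span_singleton]
      exact h x
    have hidem : Ideal.Quotient.mk (Ideal.span {ϖ}) (x ^ (N - 1) * x ^ (N - 1)) =
        Ideal.Quotient.mk (Ideal.span {ϖ}) (x ^ (N - 1)) := by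
      rw [show N - 1 = 1 + (N - 2) by omega, pow_add, pow_one, ← mul_assoc, map_mul,
        show x * x ^ (N - 2) * x = x ^ (N - 1) * x by
          rw [← pow_succ', show N - 2 + 1 = N - 1 by omega], hmod, ← map_mul]
    obtain ⟨a, ha, hax⟩ := hhens.is_henselian (Polynomial.X ^ 2 - Polynomial.X)
      (Polynomial.monic_X_pow_sub (by rw [Polynomial.degree_X]; norm_num)) (x ^ (N - 1))
      (by
        rw [Polynomial.eval_sub, Polynomial.eval_pow, Polynomial.eval_X,
          ← Ideal.Quotient.mk_eq_mk_iff_sub_mem, pow_two, hidem]) (by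
        simp only [Polynomial.derivative_sub, Polynomial.derivative_X_pow, Polynomial.derivative_X]
        -- The derivative of `X ^ 2 - X` at an idempotent `e` is `2 * e - 1`, whose square is `1`.
        refine IsUnit.of_mul_eq_one (Ideal.Quotient.mk (Ideal.span {ϖ}) (2 * x ^ (N - 1) - 1)) ?_
        have : Ideal.Quotient.mk (Ideal.span {ϖ}) ((2 * x ^ (N - 1) - 1) * (2 * x ^ (N - 1) - 1)) =
          4 * (Ideal.Quotient.mk (Ideal.span {ϖ}) (x ^ (N - 1) * x ^ (N - 1)) -
            Ideal.Quotient.mk (Ideal.span {ϖ}) (x ^ (N - 1))) + 1 := by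
          simp only [map_mul, map_sub, map_one, map_ofNat]; ring
        rw [hidem, sub_self, mul_zero, zero_add] at this
        rw [← this]
        simp)
    have hq : Ideal.Quotient.mk (Ideal.span {ϖ}) a =
        Ideal.Quotient.mk (Ideal.span {ϖ}) (x ^ (N - 1)) :=
      (Ideal.Quotient.mk_eq_mk_iff_sub_mem _ _).2 hax
    have ha' : a * (a - 1) = 0 := by
      have := ha
      simp only [Polynomial.IsRoot, Polynomial.eval_sub, Polynomial.eval_pow,
        Polynomial.eval_X] at this
      rw [← this]; ring
    rcases mul_eq_zero.1 ha' with h1 | h1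
    · exact absurd (Ideal.mem_span_singleton.1 (Ideal.Quotient.eq_zero_iff_mem.1
        (by rw [← hmod, map_mul, ← hq, h1, map_zero, zero_mul]))) hx
    · rw [sub_eq_zero.1 h1, map_one] at hq
      have h2 : IsUnit (x ^ (N - 1)) := by
        have h3 := (Ideal.Quotient.mk_eq_mk_iff_sub_mem _ _).1 hq
        have h4 := Ideal.mem_jacobson_bot.1 (hhens.jac h3) (-1)
        convert h4 using 1
        ring
      exact (isUnit_pow_iff (by omega)).1 h2
  have hloc : IsLocalRing S := IsLocalRing.of_nonunits_add fun {a b} ha hb => by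
    have h1 : ∀ c ∈ nonunits S, ϖ ∣ c := fun c hc ↦ by_contra fun h2 ↦ hc (hunit c h2)
    exact fun h2 ↦ hu (isUnit_of_dvd_unit (dvd_add (h1 a ha) (h1 b hb)) h2)
  have hmax : IsLocalRing.maximalIdeal S = Ideal.span {ϖ} := by
    refine le_antisymm (fun x hx ↦ ?_) ?_
    · exact Ideal.mem_span_singleton.2 (by_contra fun h2 ↦ hx (hunit x h2))
    · rw [Ideal.span_le, Set.singleton_subset_iff]
      exact hu
  have hfield : ¬ IsField S := by
    rw [IsLocalRing.isField_iff_maximalIdeal_eq, hmax, Ideal.span_singleton_eq_bot]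
    exact h0
  have hirr : (IsLocalRing.maximalIdeal S).IsPrincipal := ⟨ϖ, hmax⟩
  exact ((IsDiscreteValuationRing.TFAE S hfield).out 0 4).2 hirr

section

variable {p : ℕ} [Fact p.Prime] {S : Type*} [CommRing S] [Algebra ℤ_[p] S] [Module.Finite ℤ_[p] S]

theorem exists_compact_topology [Module.IsTorsionFree ℤ_[p] S] :
    ∃ _ : TopologicalSpace S, IsTopologicalRing S ∧ CompactSpace S ∧ T2Space S := by
  let : TopologicalSpace S := moduleTopology ℤ_[p] S
  have : IsModuleTopology ℤ_[p] S := ⟨rfl⟩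
  have : ContinuousAdd S := IsModuleTopology.toContinuousAdd ℤ_[p] S
  let b := Module.Free.chooseBasis ℤ_[p] S
  have h1 : Continuous b.equivFun :=
    IsModuleTopology.continuous_of_linearMap b.equivFun.toLinearMap
  have h2 : Continuous b.equivFun.symm :=
    IsModuleTopology.continuous_of_linearMap b.equivFun.symm.toLinearMap
  exact ⟨_, IsModuleTopology.isTopologicalRing ℤ_[p] S,
    b.equivFun.symm.surjective.compactSpace h2, .of_injective_continuous b.equivFun.injective h1⟩

theorem not_isUnit_natCast [Module.IsTorsionFree ℤ_[p] S] [Nontrivial S] : ¬ IsUnit (p : S) := by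
  intro h
  have hint : Algebra.IsIntegral ℤ_[p] S := inferInstance
  rw [← map_natCast (algebraMap ℤ_[p] S)] at h
  exact PadicInt.irreducible_p.not_isUnit
    (isUnit_of_map_unit (algebraMap ℤ_[p] S) _ h)

end

section

variable {p : ℕ} [Fact p.Prime] {G : Type*} [CommGroup G] {S : Type*} [CommRing S]

/-- Modulo `ϖ` the `p ^ r`-th power map is additive, it fixes `ℤ_[p]` by Fermat, and it fixes group
elements because `m` divides `p ^ r - 1`. Hence it is the identity on the quotient. -/
theorem dvd_pow_sub_of_forall (φ : MonoidAlgebra ℤ_[p] G →+* S) (hφ : Function.Surjective φ) {ϖ : S}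
    (hp : ϖ ∣ p) {r m : ℕ} (hr : m ∣ p ^ r - 1)
    (h : ∀ g : G, ϖ ∣ φ (MonoidAlgebra.of ℤ_[p] G g) ^ m - 1) (x : S) : ϖ ∣ x ^ p ^ r - x := by
  have hpp : p.Prime := Fact.out
  let mk := Ideal.Quotient.mk (Ideal.span {ϖ})
  have hmk : ∀ y, mk y = 0 ↔ ϖ ∣ y := fun y ↦ by
    rw [Ideal.Quotient.eq_zero_iff_mem, Ideal.mem_span_singleton]
  have hp0 : mk p = 0 := (hmk _).2 hp
  rw [← hmk, map_sub, map_pow, sub_eq_zero]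
  obtain ⟨y, rfl⟩ := hφ x
  induction y using MonoidAlgebra.induction_linear with
  | zero => simp [hpp.ne_zero]
  | add f g hf hg =>
    obtain ⟨c, hc⟩ := exists_add_pow_prime_pow_eq hpp (mk (φ f)) (mk (φ g)) r
    rw [map_natCast] at hp0
    rw [map_add, map_add, hc, hf, hg, hp0]
    ring
  | single g c =>
    have h1 : (MonoidAlgebra.single g c : MonoidAlgebra ℤ_[p] G) =
        algebraMap ℤ_[p] _ c * MonoidAlgebra.of ℤ_[p] G g := by simp
    have h2 : mk (φ (algebraMap ℤ_[p] _ c)) ^ p ^ r = mk (φ (algebraMap ℤ_[p] _ c)) := by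
      have h3 : c ^ p ^ r - c ∈ IsLocalRing.maximalIdeal ℤ_[p] := by
        rw [← PadicInt.ker_toZMod, RingHom.mem_ker, map_sub, map_pow, ZMod.pow_card_pow, sub_self]
      rw [PadicInt.maximalIdeal_eq_span_p, Ideal.mem_span_singleton] at h3
      obtain ⟨d, hd⟩ := h3
      rw [← sub_eq_zero, ← map_pow, ← map_sub, ← map_pow, ← map_sub, ← map_pow, ← map_sub, hd,
        map_mul, map_mul, map_mul, map_natCast, map_natCast, hp0, zero_mul]
    have h4 : mk (φ (MonoidAlgebra.of ℤ_[p] G g)) ^ p ^ r = mk (φ (MonoidAlgebra.of ℤ_[p] G g)) := by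
      have h5 := (hmk _).2 (h g)
      rw [map_sub, map_one, map_pow, sub_eq_zero] at h5
      obtain ⟨k, hk⟩ := hr
      rw [show p ^ r = m * k + 1 by have := Nat.pow_pos (n := r) hpp.pos; omega, pow_succ, pow_mul, h5,
        one_pow, one_mul]
    rw [h1, map_mul, map_mul, mul_pow, h2, h4]

/-- The image of `G` in the units has exponent `p ^ a * m` with `p ∤ m`. One takes `ϖ = p` if `a =
0`, and otherwise `ϖ = ζ - 1` for a primitive `p ^ a`-th root of unity `ζ` in the image; the `m`-th
powers of the image are then powers of `ζ`, hence `1` modulo `ϖ`. -/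
theorem exists_dvd_pow_sub [Finite G] [IsDomain S] (φ : MonoidAlgebra ℤ_[p] G →+* S)
    (hφ : Function.Surjective φ) (hp0 : (p : S) ≠ 0) (hp : ¬ IsUnit (p : S)) :
    ∃ ϖ : S, ϖ ≠ 0 ∧ ¬ IsUnit ϖ ∧ ∃ N, 2 ≤ N ∧ ∀ x : S, ϖ ∣ x ^ N - x := by
  have hpp : p.Prime := Fact.out
  let γ : G →* Sˣ := ((φ : MonoidAlgebra ℤ_[p] G →* S).comp (MonoidAlgebra.of ℤ_[p] G)).toHomUnits
  have hγ : ∀ g, ((γ g : Sˣ) : S) = φ (MonoidAlgebra.of ℤ_[p] G g) := fun g ↦ rfl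
  have hfin : Finite γ.range := Finite.of_surjective _ γ.rangeRestrict_surjective
  have hex : Monoid.ExponentExists γ.range := .of_finite
  obtain ⟨z, hz⟩ := Monoid.exists_orderOf_eq_exponent hex
  have hn : Monoid.exponent γ.range ≠ 0 := Monoid.exponent_ne_zero.2 hex
  have hzn : IsPrimitiveRoot ((z : Sˣ) : S) (Monoid.exponent γ.range) := by
    rw [IsPrimitiveRoot.coe_units_iff, ← hz, ← Subgroup.orderOf_coe]
    exact IsPrimitiveRoot.orderOf _
  have hpow : ∀ g, φ (MonoidAlgebra.of ℤ_[p] G g) ^ Monoid.exponent γ.range = 1 := fun g ↦ by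
    have := congrArg (fun u : γ.range ↦ ((u : Sˣ) : S))
      (Monoid.pow_exponent_eq_one (γ.rangeRestrict g))
    simpa [hγ] using this
  obtain ⟨a, m, hm, hnm⟩ := Nat.exists_eq_pow_mul_and_not_dvd hn p hpp.ne_one
  rw [hnm] at hzn hpow hn
  have hm0 : m ≠ 0 := fun h ↦ hm (h ▸ dvd_zero p)
  have hr : m ∣ p ^ m.totient - 1 :=
    (Nat.modEq_iff_dvd' (Nat.pow_pos hpp.pos)).1
      (Nat.ModEq.pow_totient ((Nat.Prime.coprime_iff_not_dvd hpp).2 hm)).symm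
  have hN : 2 ≤ p ^ m.totient := hpp.two_le.trans
    (Nat.le_self_pow (Nat.totient_pos.2 (Nat.pos_of_ne_zero hm0)).ne' p)
  have hζ : IsPrimitiveRoot (((z : Sˣ) : S) ^ m) (p ^ a) :=
    hzn.pow (Nat.pos_of_ne_zero hn) (mul_comm _ _)
  set ζ : S := ((z : Sˣ) : S) ^ m
  cases a with
  | zero =>
    refine ⟨p, hp0, hp, _, hN, dvd_pow_sub_of_forall φ hφ dvd_rfl hr fun g ↦ ?_⟩
    have := hpow g
    rw [pow_zero, one_mul] at this
    rw [this, sub_self]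
    exact dvd_zero _
  | succ b =>
    have hdvd : ∀ i, ζ - 1 ∣ ζ ^ i - 1 := fun i ↦ by simpa using sub_dvd_pow_sub_pow ζ 1 i
    refine ⟨ζ - 1, sub_ne_zero.2 (hζ.ne_one (Nat.one_lt_pow (by omega) hpp.one_lt)), fun hu ↦ hp ?_,
      _, hN, dvd_pow_sub_of_forall φ hφ ?_ hr fun g ↦ ?_⟩
    -- Expanding `((ζ - 1) + 1) ^ p ^ (b + 1) = 1` modulo `p` shows that `p` divides a power of `ζ -
    -- 1`.
    · obtain ⟨c, hc⟩ := exists_add_pow_prime_pow_eq hpp (ζ - 1) 1 (b + 1)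
      rw [sub_add_cancel, hζ.pow_eq_one, one_pow] at hc
      refine isUnit_of_dvd_unit (y := (ζ - 1) ^ p ^ (b + 1)) ⟨-((ζ - 1) * c), ?_⟩ (hu.pow _)
      linear_combination -hc
    · have hη : IsPrimitiveRoot (ζ ^ p ^ b) p :=
        hζ.pow (Nat.pow_pos hpp.pos) (pow_succ _ _)
      have h1 := hη.geom_sum_eq_zero hpp.one_lt
      have h2 : (p : S) = -∑ i ∈ Finset.range p, ((ζ ^ p ^ b) ^ i - 1) := by
        rw [Finset.sum_sub_distrib, h1]
        simp
      rw [h2, dvd_neg]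
      exact Finset.dvd_sum fun i _ ↦ by rw [← pow_mul]; exact hdvd _
    · have h1 : (φ (MonoidAlgebra.of ℤ_[p] G g) ^ m) ^ p ^ (b + 1) = 1 := by
        rw [← pow_mul, mul_comm, hpow]
      have : NeZero (p ^ (b + 1)) := ⟨(Nat.pow_pos hpp.pos).ne'⟩
      obtain ⟨i, -, hi⟩ := hζ.eq_pow_of_pow_eq_one h1
      rw [← hi]
      exact hdvd i

end

section

variable {p : ℕ} [Fact p.Prime] {G : Type*} [CommGroup G]

/-- A minimal prime consists of zero divisors, whereas nonzero scalars are non-zero-divisors of the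
group ring. -/
theorem isTorsionFree_quotient {P : Ideal (MonoidAlgebra ℤ_[p] G)} (hP : P ∈ minimalPrimes _) :
    Module.IsTorsionFree ℤ_[p] (MonoidAlgebra ℤ_[p] G ⧸ P) := by
  have := hP.1.1
  refine Module.isTorsionFree_iff_smul_eq_zero.2 fun r x ↦
    fun h ↦ or_iff_not_imp_left.2 fun hr ↦ ?_
  obtain ⟨y, rfl⟩ := Ideal.Quotient.mk_surjective x
  change Ideal.Quotient.mk P (r • y) = 0 at h
  rw [Ideal.Quotient.eq_zero_iff_mem, Algebra.smul_def] at h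
  refine Ideal.Quotient.eq_zero_iff_mem.2 ((this.mem_or_mem h).resolve_left fun h1 ↦
    Set.disjoint_left.1 (Ideal.disjoint_nonZeroDivisors_of_mem_minimalPrimes hP) h1
      (mem_nonZeroDivisors_iff_left.2 fun z hz ↦ ?_))
  rw [← Algebra.smul_def] at hz
  exact (smul_eq_zero.1 hz).resolve_left hr

theorem natCast_quotient_ne_zero {P : Ideal (MonoidAlgebra ℤ_[p] G)} (hP : P ∈ minimalPrimes _) :
    (p : MonoidAlgebra ℤ_[p] G ⧸ P) ≠ 0 := by
  have := hP.1.1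
  have := isTorsionFree_quotient hP
  rw [← map_natCast (algebraMap ℤ_[p] (MonoidAlgebra ℤ_[p] G ⧸ P)), Ne,
    FaithfulSMul.algebraMap_eq_zero_iff]
  exact PadicInt.irreducible_p.ne_zero

end

section

variable (p : ℕ) [Fact p.Prime] (G : Type*) [CommGroup G] [Finite G]

instance isReduced_monoidAlgebra : IsReduced (MonoidAlgebra ℤ_[p] G) := by
  have : NeZero (Nat.card G : ℚ_[p]) := ⟨Nat.cast_ne_zero.2 Nat.card_pos.ne'⟩
  have h2 : IsReduced (MonoidAlgebra ℚ_[p] G) := inferInstance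
  refine isReduced_of_injective
    (MonoidAlgebra.mapRingHom G (algebraMap ℤ_[p] ℚ_[p])) ?_
  exact MonoidAlgebra.map_injective (algebraMap ℤ_[p] ℚ_[p]).toAddMonoidHom
    (FaithfulSMul.algebraMap_injective ℤ_[p] ℚ_[p])

variable {p G}

theorem isDiscreteValuationRing_quotient {P : Ideal (MonoidAlgebra ℤ_[p] G)}
    (hP : P ∈ minimalPrimes _) :
    ∃ _ : IsDomain (MonoidAlgebra ℤ_[p] G ⧸ P), IsDiscreteValuationRing (MonoidAlgebra ℤ_[p] G ⧸ P) := by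
  have := hP.1.1
  have := isTorsionFree_quotient hP
  have : IsNoetherianRing (MonoidAlgebra ℤ_[p] G) := IsNoetherianRing.of_finite ℤ_[p] _
  obtain ⟨_, _, _, _⟩ := exists_compact_topology (p := p) (S := MonoidAlgebra ℤ_[p] G ⧸ P)
  obtain ⟨ϖ, h0, hu, N, hN, h⟩ := exists_dvd_pow_sub (Ideal.Quotient.mk P)
    Ideal.Quotient.mk_surjective (natCast_quotient_ne_zero hP) not_isUnit_natCast
  exact ⟨inferInstance, isDiscreteValuationRing_of_dvd_pow_sub h0 hu hN h⟩

/-- All elements satisfy `x ^ N ≡ x` modulo `p` for some `N ≥ 2`. As `p ∉ P`, this gives `P ⊆ P ^ 2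
+ p P`, and Nakayama's lemma over `ℤ_[p]` concludes. -/
theorem isIdempotentElem_of_not_dvd (hG : ¬ p ∣ Nat.card G) {P : Ideal (MonoidAlgebra ℤ_[p] G)}
    (hP : P ∈ minimalPrimes _) : IsIdempotentElem P := by
  have hPp := hP.1.1
  have hpp : p.Prime := Fact.out
  have hr : Nat.card G ∣ p ^ (Nat.card G).totient - 1 :=
    (Nat.modEq_iff_dvd' (Nat.pow_pos hpp.pos)).1
      (Nat.ModEq.pow_totient ((Nat.Prime.coprime_iff_not_dvd hpp).2 hG)).symm
  have hN : 2 ≤ p ^ (Nat.card G).totient := hpp.two_le.trans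
    (Nat.le_self_pow (Nat.totient_pos.2 Nat.card_pos).ne' p)
  have hdvd := dvd_pow_sub_of_forall (RingHom.id (MonoidAlgebra ℤ_[p] G)) Function.surjective_id
    (dvd_refl (p : MonoidAlgebra ℤ_[p] G)) hr fun g ↦ by
      rw [RingHom.id_apply, ← map_pow, pow_card_eq_one', map_one, sub_self]
      exact dvd_zero _
  have hle : P.restrictScalars ℤ_[p] ≤ (P * P).restrictScalars ℤ_[p] ⊔
      Ideal.span {(p : ℤ_[p])} • P.restrictScalars ℤ_[p] := by
    intro x hx
    obtain ⟨y, hy⟩ := hdvd x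
    have hx' : x ∈ P := hx
    have h1 : x ^ p ^ (Nat.card G).totient ∈ P * P := by
      rw [← pow_two]
      exact Ideal.pow_le_pow_right hN (Ideal.pow_mem_pow hx' _)
    have h2 : (p : MonoidAlgebra ℤ_[p] G) * y ∈ P :=
      hy ▸ P.sub_mem (Ideal.mul_le_left h1) hx'
    have h3 : y ∈ P := (hPp.mem_or_mem h2).resolve_left fun h4 ↦ natCast_quotient_ne_zero hP
      (by rw [← map_natCast (Ideal.Quotient.mk P)]; exact Ideal.Quotient.eq_zero_iff_mem.2 h4)
    refine Submodule.mem_sup.2 ⟨_, h1, -((p : ℤ_[p]) • y),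
      neg_mem (Submodule.smul_mem_smul (Ideal.mem_span_singleton_self _) h3), ?_⟩
    rw [Algebra.smul_def, map_natCast, ← hy]
    ring
  refine le_antisymm Ideal.mul_le_left
    (Submodule.le_of_le_smul_of_le_jacobson_bot
      (N' := P.restrictScalars ℤ_[p]) (N := (P * P).restrictScalars ℤ_[p])
      (IsNoetherian.noetherian _) ?_ hle)
  rw [← PadicInt.maximalIdeal_eq_span_p]
  exact IsLocalRing.maximalIdeal_le_jacobson _

end

end ProChar

namespace ProChar

/-! ### Group rings of power series rings and their components -/

section Swap

variable (σ S G : Type*) [CommRing S] [CommGroup G]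

/-- The identification of the group ring of a power series ring with a subring of the power series
ring over the group ring. -/
noncomputable def swapHom :
    MonoidAlgebra (MvPowerSeries σ S) G →+* MvPowerSeries σ (MonoidAlgebra S G) :=
  MonoidAlgebra.liftNCRingHom (MvPowerSeries.map (algebraMap S (MonoidAlgebra S G)))
    ((MvPowerSeries.C : _ →+* MvPowerSeries σ (MonoidAlgebra S G)).toMonoidHom.comp
      (MonoidAlgebra.of S G)) fun _ _ ↦ Commute.all _ _

variable {σ S G}

theorem swapHom_single (g : G) (r : MvPowerSeries σ S) :
    swapHom σ S G (MonoidAlgebra.single g r) =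
      MvPowerSeries.map (algebraMap S (MonoidAlgebra S G)) r *
        MvPowerSeries.C (MonoidAlgebra.of S G g) :=
  MonoidAlgebra.liftNC_single _ _ _ _

theorem coeff_swapHom (f : MonoidAlgebra (MvPowerSeries σ S) G) (d : σ →₀ ℕ) (g : G) :
    (MvPowerSeries.coeff d (swapHom σ S G f)).coeff g = MvPowerSeries.coeff d (f.coeff g) := by
  induction f using MonoidAlgebra.induction_linear with
  | zero => simp
  | add f f' hf hf' => simp [hf, hf']
  | single h r =>
    classical
    rw [swapHom_single, MvPowerSeries.coeff_mul_C, MvPowerSeries.coeff_map]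
    simp [Finsupp.single_apply]
    split_ifs <;> simp

theorem swapHom_bijective [Finite G] : Function.Bijective (swapHom σ S G) := by
  refine ⟨fun f f' h ↦ ?_, fun F ↦ ?_⟩
  · ext g d
    rw [← coeff_swapHom, ← coeff_swapHom, h]
  · refine ⟨MonoidAlgebra.ofCoeff (Finsupp.equivFunOnFinite.symm fun g d ↦
      (MvPowerSeries.coeff d F).coeff g), ?_⟩
    ext d g
    rw [coeff_swapHom]
    rfl

end Swap

section Map

variable {S S' : Type*} [CommRing S] [CommRing S'] (φ : S →+* S')

theorem toFin_map (n : ℕ) (f : MvPowerSeries ℕ S) :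
    toFin S' n (MvPowerSeries.map φ f) = MvPowerSeries.map φ (toFin S n f) := by
  ext d
  simp [coeff_toFin]

theorem map_surjective {σ : Type*} {φ : S →+* S'} (hφ : Function.Surjective φ) :
    Function.Surjective (MvPowerSeries.map (σ := σ) φ) := fun f ↦ by
  choose g hg using fun d ↦ hφ (MvPowerSeries.coeff d f)
  exact ⟨g, by ext d; exact hg d⟩

theorem finStep_map (n : ℕ) (f : MvPowerSeries (Fin (n + 1)) S) :
    finStep S' n (MvPowerSeries.map φ f) = MvPowerSeries.map φ (finStep S n f) := by
  ext d
  simp [coeff_finStep]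

end Map

/-! ### The decomposition of the group rings into components -/

section Components

variable (p : ℕ) [Fact p.Prime] (G : Type*) [CommGroup G]

theorem toFin_swapHom (n : ℕ) (f : Alg p G) :
    toFin _ n (swapHom ℕ ℤ_[p] G f) = swapHom (Fin n) ℤ_[p] G (toLevel p G n f) := by
  ext d g
  rw [coeff_toFin, coeff_swapHom, coeff_swapHom, toLevel, MonoidAlgebra.coeff_mapRingHom]
  exact (coeff_toFin n _ d).symm

theorem finStep_swapHom (n : ℕ) (f : AlgLevel p G (n + 1)) :
    finStep _ n (swapHom (Fin (n + 1)) ℤ_[p] G f) = swapHom (Fin n) ℤ_[p] G (levelProj p G n f) := by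
  ext d g
  rw [coeff_finStep, coeff_swapHom, coeff_swapHom, levelProj, MonoidAlgebra.coeff_mapRingHom]
  exact (coeff_finStep n _ d).symm

/-- The components of `ℤ_p[G]`. -/
abbrev Component (ψ : minimalPrimes (MonoidAlgebra ℤ_[p] G)) : Type _ :=
  MonoidAlgebra ℤ_[p] G ⧸ (ψ : Ideal (MonoidAlgebra ℤ_[p] G))

/-- The projection of the group ring of a power series ring to a component. -/
noncomputable def toComponent (σ : Type*) (ψ : minimalPrimes (MonoidAlgebra ℤ_[p] G)) :
    MonoidAlgebra (MvPowerSeries σ ℤ_[p]) G →+* MvPowerSeries σ (Component p G ψ) :=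
  (MvPowerSeries.map (Ideal.Quotient.mk (ψ : Ideal (MonoidAlgebra ℤ_[p] G)))).comp
    (swapHom σ ℤ_[p] G)

variable {p G} {ψ : minimalPrimes (MonoidAlgebra ℤ_[p] G)}

theorem toFin_toComponent (n : ℕ) (f : Alg p G) :
    toFin _ n (toComponent p G ℕ ψ f) = toComponent p G (Fin n) ψ (toLevel p G n f) := by
  rw [toComponent, toComponent, RingHom.comp_apply, RingHom.comp_apply, toFin_map, toFin_swapHom]

theorem finStep_toComponent (n : ℕ) (f : AlgLevel p G (n + 1)) :
    finStep _ n (toComponent p G (Fin (n + 1)) ψ f) =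
      toComponent p G (Fin n) ψ (levelProj p G n f) := by
  rw [toComponent, toComponent, RingHom.comp_apply, RingHom.comp_apply, finStep_map,
    finStep_swapHom]

theorem toComponent_eq_zero_iff {σ : Type*} (f : MonoidAlgebra (MvPowerSeries σ ℤ_[p]) G) :
    toComponent p G σ ψ f = 0 ↔
      ∀ d, MvPowerSeries.coeff d (swapHom σ ℤ_[p] G f) ∈ (ψ : Ideal (MonoidAlgebra ℤ_[p] G)) := by
  simp_rw [MvPowerSeries.ext_iff, toComponent, RingHom.comp_apply, MvPowerSeries.coeff_map,
    map_zero, Ideal.Quotient.eq_zero_iff_mem]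

variable [Finite G]

theorem toComponent_surjective (σ : Type*) : Function.Surjective (toComponent p G σ ψ) :=
  (map_surjective Ideal.Quotient.mk_surjective).comp swapHom_bijective.2

theorem exists_swapHom_eq_C (σ : Type*) (x : MonoidAlgebra ℤ_[p] G) :
    ∃ f : MonoidAlgebra (MvPowerSeries σ ℤ_[p]) G, swapHom σ ℤ_[p] G f = MvPowerSeries.C x :=
  swapHom_bijective.2 _

instance : IsDomain (Component p G ψ) := (isDiscreteValuationRing_quotient ψ.2).1

instance : IsDiscreteValuationRing (Component p G ψ) := (isDiscreteValuationRing_quotient ψ.2).2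

instance : IsNoetherianRing (MonoidAlgebra ℤ_[p] G) := IsNoetherianRing.of_finite ℤ_[p] _

instance : Finite (minimalPrimes (MonoidAlgebra ℤ_[p] G)) :=
  (minimalPrimes.finite_of_isNoetherianRing _).to_subtype

theorem finiteMultiplicity_C {O : Type*} [CommRing O] [IsDomain O] [IsDiscreteValuationRing O]
    {σ : Type*} {ϖ : O} (hϖ : Irreducible ϖ) {x : MvPowerSeries σ O} (hx : x ≠ 0) :
    FiniteMultiplicity (MvPowerSeries.C ϖ) x := by
  obtain ⟨k, g, rfl, d, hd⟩ := exists_eq_C_pow_mul hϖ hx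
  refine ⟨k, fun h ↦ hϖ.not_isUnit (isUnit_of_dvd_unit ?_ hd)⟩
  rw [pow_succ] at h
  exact (C_dvd_iff ϖ g).1
    ((mul_dvd_mul_iff_left (pow_ne_zero k (prime_C hϖ).ne_zero)).1 h) d

theorem le_of_ker_toComponent_le {σ : Type*} {ψ ψ' : minimalPrimes (MonoidAlgebra ℤ_[p] G)}
    (h : RingHom.ker (toComponent p G σ ψ) ≤ RingHom.ker (toComponent p G σ ψ')) :
    ψ.1 ≤ ψ'.1 := by
  classical
  intro x hx
  obtain ⟨X, hX⟩ := exists_swapHom_eq_C σ x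
  have h1 := (toComponent_eq_zero_iff X).1 (h ((toComponent_eq_zero_iff X).2 fun d ↦ ?_)) 0
  · rwa [hX, MvPowerSeries.coeff_zero_C] at h1
  · rw [hX, MvPowerSeries.coeff_C]
    split_ifs
    exacts [hx, zero_mem _]

theorem hasComponents_toComponent (σ : Type*) :
    HasComponents (fun ψ ↦ MvPowerSeries σ (Component p G ψ)) (toComponent p G σ) where
  surjective ψ := toComponent_surjective σ
  eq_zero f hf := by
    refine swapHom_bijective.1 ?_
    rw [map_zero]
    ext1 d
    have h1 : MvPowerSeries.coeff d (swapHom σ ℤ_[p] G f) ∈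
        sInf (minimalPrimes (MonoidAlgebra ℤ_[p] G)) := by
      rw [Ideal.mem_sInf]
      exact fun {P} hP ↦ (toComponent_eq_zero_iff (ψ := ⟨P, hP⟩) f).1 (hf _) d
    rw [minimalPrimes, Ideal.sInf_minimalPrimes] at h1
    exact eq_zero_of_pow_eq_zero h1.choose_spec
  eq_of_ker_le ψ ψ' h := by
    have h1 := le_of_ker_toComponent_le h
    exact Subtype.ext (le_antisymm h1 (ψ'.2.2 ψ.2.1 h1))
  exists_comap_eq ψ ψ' f hf hne hker := by
    -- A constant in the kernel of the component `ψ'` but not of `ψ` is divisible by `f`. Hence `f`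
    -- is the uniformizer of `O_ψ` up to a unit.
    obtain ⟨x, hx, hxψ⟩ : ∃ x ∈ ψ'.1, x ∉ ψ.1 := by
      by_contra! h
      exact hne (Subtype.ext (le_antisymm (ψ.2.2 ψ'.2.1 h) h))
    obtain ⟨X, hX⟩ := exists_swapHom_eq_C σ x
    have hX' : ∀ ψ'', toComponent p G σ ψ'' X = MvPowerSeries.C (Ideal.Quotient.mk ψ''.1 x) :=
      fun ψ'' ↦ by rw [toComponent, RingHom.comp_apply, hX, MvPowerSeries.map_C]
    have hfX : X ∈ (Ideal.span {f}).comap (toComponent p G σ ψ) := hker (by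
      rw [RingHom.mem_ker, hX', Ideal.Quotient.eq_zero_iff_mem.2 hx, map_zero])
    rw [Ideal.mem_comap, hX', Ideal.mem_span_singleton] at hfX
    obtain ⟨ϖ, hϖ⟩ := IsDiscreteValuationRing.exists_irreducible (Component p G ψ)
    obtain ⟨ϖ', hϖ'⟩ := IsDiscreteValuationRing.exists_irreducible (Component p G ψ')
    obtain ⟨k, u, hu⟩ := IsDiscreteValuationRing.eq_unit_mul_pow_irreducible
      (x := Ideal.Quotient.mk ψ.1 x) (fun h ↦ hxψ (Ideal.Quotient.eq_zero_iff_mem.1 h)) hϖ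
    rw [hu, map_mul, map_pow] at hfX
    have hfϖ : f ∣ MvPowerSeries.C ϖ :=
      hf.dvd_of_dvd_pow ((hf.dvd_or_dvd hfX).resolve_left fun h ↦
        hf.not_isUnit (isUnit_of_dvd_unit h (u.isUnit.map _)))
    have hspan : Ideal.span {f} = Ideal.span {MvPowerSeries.C ϖ} :=
      Ideal.span_singleton_eq_span_singleton.2 (hf.associated_of_dvd (prime_C hϖ) hfϖ)
    have hmem : ∀ (χ : minimalPrimes (MonoidAlgebra ℤ_[p] G)) (ϖ : Component p G χ)
        (F : MonoidAlgebra (MvPowerSeries σ ℤ_[p]) G), Irreducible ϖ →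
        (F ∈ (Ideal.span {MvPowerSeries.C ϖ}).comap (toComponent p G σ χ) ↔
          ∀ d, MvPowerSeries.coeff d (swapHom σ ℤ_[p] G F) ∈
            (IsLocalRing.maximalIdeal (Component p G χ)).comap (Ideal.Quotient.mk χ.1)) := by
      intro χ ϖ F hϖ
      simp_rw [Ideal.mem_comap, Ideal.mem_span_singleton, C_dvd_iff, hϖ.maximalIdeal_eq,
        Ideal.mem_span_singleton, toComponent, RingHom.comp_apply, MvPowerSeries.coeff_map]
    rw [hspan] at hker ⊢
    have hle : ψ'.1 ≤ (IsLocalRing.maximalIdeal (Component p G ψ)).comap (Ideal.Quotient.mk ψ.1) := by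
      intro y hy
      obtain ⟨Y, hY⟩ := exists_swapHom_eq_C σ y
      have h1 := (hmem ψ ϖ Y hϖ).1 (hker ((toComponent_eq_zero_iff Y).2 fun d ↦ ?_)) 0
      · rwa [hY, MvPowerSeries.coeff_zero_C] at h1
      · classical
        rw [hY, MvPowerSeries.coeff_C]
        split_ifs
        exacts [hy, zero_mem _]
    -- Both contractions are maximal ideals of `ℤ_p[G]`. The first contains `ψ'`, so it lies in the
    -- second because the quotient by `ψ'` is local.
    have heq : (IsLocalRing.maximalIdeal (Component p G ψ)).comap (Ideal.Quotient.mk ψ.1) =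
        (IsLocalRing.maximalIdeal (Component p G ψ')).comap (Ideal.Quotient.mk ψ'.1) := by
      have hmax : ((IsLocalRing.maximalIdeal (Component p G ψ)).comap
          (Ideal.Quotient.mk ψ.1)).IsMaximal :=
        Ideal.comap_isMaximal_of_surjective _ Ideal.Quotient.mk_surjective
      have hmax' : ((IsLocalRing.maximalIdeal (Component p G ψ')).comap
          (Ideal.Quotient.mk ψ'.1)).IsMaximal :=
        Ideal.comap_isMaximal_of_surjective _ Ideal.Quotient.mk_surjective
      refine hmax.eq_of_le hmax'.ne_top ?_
      have hle' : RingHom.ker (Ideal.Quotient.mk ψ'.1) ≤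
          (IsLocalRing.maximalIdeal (Component p G ψ)).comap (Ideal.Quotient.mk ψ.1) := by
        rwa [Ideal.mk_ker]
      rw [← Ideal.map_le_iff_le_comap]
      exact IsLocalRing.le_maximalIdeal fun h ↦ hmax.ne_top (by
        rw [← sup_eq_left.2 hle', RingHom.ker_eq_comap_bot,
          ← Ideal.comap_map_of_surjective _ Ideal.Quotient.mk_surjective, h, Ideal.comap_top])
    refine ⟨MvPowerSeries.C ϖ', prime_C hϖ', fun x hx ↦ finiteMultiplicity_C hϖ' hx, ?_⟩
    ext F
    rw [hmem ψ ϖ F hϖ, hmem ψ' ϖ' F hϖ', heq]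

end Components

end ProChar

namespace ProChar

/-! ### Base change of presentations and invariants -/

section BaseChange

variable {A B M : Type*} [CommRing A] [CommRing B] [AddCommGroup M] [Module A M]

theorem exists_presentation_baseChange (f : A →+* B) {d : ℕ} {T : Matrix (Fin d) (Fin d) A}
    {π : (Fin d → A) →ₗ[A] M} (hπ : Function.Surjective π)
    (hker : LinearMap.ker π = LinearMap.range T.mulVecLin) :
    ∃ π' : (Fin d → B) →ₗ[B] BaseChange M f, Function.Surjective π' ∧
      LinearMap.ker π' = LinearMap.range (T.map f).mulVecLin := by
  let : Algebra A B := f.toAlgebra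
  let e : B ⊗[A] (Fin d → A) ≃ₗ[B] (Fin d → B) := TensorProduct.piScalarRight A B B (Fin d)
  have hcomm : (T.map f).mulVecLin ∘ₗ e.toLinearMap = e.toLinearMap ∘ₗ T.mulVecLin.baseChange B := by
    ext i j
    have h1 : (fun j ↦ f ((Pi.single i (1 : A) : Fin d → A) j)) = Pi.single i 1 := by
      ext j
      by_cases h : j = i
      · subst h; simp
      · simp [h]
    simp [e, h1, Algebra.smul_def, RingHom.algebraMap_toAlgebra]
  have hex : Function.Exact (T.mulVecLin.baseChange B) (π.baseChange B) :=
    lTensor_exact B (LinearMap.exact_iff.2 hker) hπ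
  have hsurj : Function.Surjective (π.baseChange B) := LinearMap.lTensor_surjective B hπ
  refine ⟨(π.baseChange B) ∘ₗ e.symm.toLinearMap, hsurj.comp e.symm.surjective, ?_⟩
  ext v
  obtain ⟨w, rfl⟩ := e.surjective v
  have h1 : (π.baseChange B ∘ₗ e.symm.toLinearMap) (e w) = π.baseChange B w := by simp
  rw [LinearMap.mem_ker]
  refine (Eq.congr_left h1).trans ((hex w).trans ⟨?_, ?_⟩)
  · rintro ⟨u, rfl⟩
    exact ⟨e u, LinearMap.congr_fun hcomm u⟩
  · rintro ⟨u, hu⟩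
    refine ⟨e.symm u, e.injective ?_⟩
    have := LinearMap.congr_fun hcomm (e.symm u)
    rw [LinearMap.comp_apply, LinearMap.comp_apply, LinearEquiv.coe_coe,
      LinearEquiv.apply_symm_apply] at this
    exact this.symm.trans hu

end BaseChange

/-! ### Transition maps and the vanishing of the invariants -/

section Levels

variable (p : ℕ) [Fact p.Prime] (G : Type*) [CommGroup G]

theorem levelProj_toLevel (n : ℕ) (f : Alg p G) :
    levelProj p G n (toLevel p G (n + 1) f) = toLevel p G n f := by
  refine MonoidAlgebra.ext (Finsupp.ext fun g ↦ ?_)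
  rw [levelProj, toLevel, toLevel, MonoidAlgebra.coeff_mapRingHom, MonoidAlgebra.coeff_mapRingHom,
    MonoidAlgebra.coeff_mapRingHom]
  exact finStep_toFin n _

theorem levelProj_lastVar (n : ℕ) : levelProj p G n (lastVar p G n) = 0 := by
  classical
  have h : Rn.proj p n (MvPowerSeries.X (Fin.last n)) = 0 := by
    ext x
    refine (coeff_finStep n _ x).trans ?_
    rw [MvPowerSeries.coeff_X, if_neg, map_zero]
    intro h
    have h1 := DFunLike.congr_fun h (Fin.last n)
    rw [Finsupp.embDomain_of_notMem_range _ _ _ (by simp)] at h1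
    simp at h1
  rw [levelProj, lastVar, MonoidAlgebra.coe_algebraMap]
  simp [h]

theorem lastVar_dvd_of_levelProj_eq_zero {n : ℕ} {b : AlgLevel p G (n + 1)}
    (h : levelProj p G n b = 0) : lastVar p G n ∣ b := by
  simpa [h] using lastVar_dvd_sub p G n b

theorem eq_zero_of_lastVar_mul {n : ℕ} {b : AlgLevel p G (n + 1)}
    (h : lastVar p G n * b = 0) : b = 0 := by
  rw [lastVar, ← Algebra.smul_def] at h
  refine MonoidAlgebra.ext (Finsupp.ext fun g ↦ ?_)
  have h1 : (MvPowerSeries.X (Fin.last n) : Rn p (n + 1)) * b.coeff g = 0 := by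
    have := congrArg (fun x : AlgLevel p G (n + 1) ↦ x.coeff g) h
    simpa using this
  exact (mul_eq_zero.1 h1).resolve_left (nonZeroDivisors.ne_zero MvPowerSeries.X_mem_nonzeroDivisors)

/-- If the last variable `X` kills the class of `v`, then `X • v = T y`. Modulo `X` the matrix is
injective, so `y = X • y'`, and cancelling `X` gives `v = T y'`. -/
theorem subsingleton_invariants {n d : ℕ} {N : Type*} [AddCommGroup N]
    [Module (AlgLevel p G (n + 1)) N] {T : Matrix (Fin d) (Fin d) (AlgLevel p G (n + 1))}
    {π : (Fin d → AlgLevel p G (n + 1)) →ₗ[AlgLevel p G (n + 1)] N} (hπ : Function.Surjective π)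
    (hker : LinearMap.ker π = LinearMap.range T.mulVecLin)
    (hdet : levelProj p G n T.det ∈ (AlgLevel p G n)⁰) :
    Subsingleton (Invariants p G n N) := by
  refine ⟨fun a b ↦ ?_⟩
  have key : ∀ x : Submodule.torsionBy (AlgLevel p G (n + 1)) N (lastVar p G n), x = 0 := by
    rintro ⟨x, hx⟩
    rw [Submodule.mem_torsionBy_iff] at hx
    obtain ⟨v, rfl⟩ := hπ x
    have h1 : lastVar p G n • v ∈ LinearMap.range T.mulVecLin := by
      rw [← hker, LinearMap.mem_ker, map_smul, hx]
    obtain ⟨y, hy⟩ := h1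
    rw [Matrix.mulVecLin_apply] at hy
    have h2 : (T.map (levelProj p G n)).mulVec (levelProj p G n ∘ y) = 0 := by
      ext1 i
      rw [← RingHom.map_mulVec, hy]
      simp [levelProj_lastVar]
    have h3 : levelProj p G n ∘ y = 0 := by
      refine mulVecLin_injective (T := T.map (levelProj p G n)) ?_ (by simpa using h2)
      rwa [← RingHom.mapMatrix_apply, ← RingHom.map_det]
    choose y' hy' using fun i ↦ lastVar_dvd_of_levelProj_eq_zero p G (congrFun h3 i)
    have h4 : y = lastVar p G n • y' := funext hy'
    have h5 : v = T.mulVec y' := by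
      ext1 i
      rw [h4, Matrix.mulVec_smul] at hy
      have := congrFun hy i
      rw [← sub_eq_zero]
      refine eq_zero_of_lastVar_mul p G ?_
      rw [mul_sub, sub_eq_zero]
      exact this.symm
    refine Subtype.ext ?_
    change π v = 0
    rw [← LinearMap.mem_ker, hker, h5]
    exact ⟨y', rfl⟩
  exact (key a).trans (key b).symm

end Levels

end ProChar

namespace ProChar

/-! ### Passage between the levels -/

section Lift

variable {p : ℕ} [Fact p.Prime] {G : Type*} [CommGroup G]

theorem exists_map_eq_of_toFin_eq_zero {S S' : Type*} [CommRing S] [CommRing S'] {φ : S →+* S'}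
    (hφ : Function.Surjective φ) {n : ℕ} {h : MvPowerSeries ℕ S'} (hh : toFin S' n h = 0) :
    ∃ H : MvPowerSeries ℕ S, MvPowerSeries.map φ H = h ∧ toFin S n H = 0 := by
  classical
  -- Lifting coefficients with `0` sent to `0` keeps the vanishing at level `n`.
  have h1 : ∀ y : S', ∃ x : S, φ x = y ∧ (y = 0 → x = 0) := fun y ↦ by
    by_cases hy : y = 0
    · exact ⟨0, by rw [map_zero, hy], fun _ ↦ rfl⟩
    · exact ⟨_, (hφ y).choose_spec, fun h ↦ absurd h hy⟩
  choose s hs hs0 using h1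
  let H : MvPowerSeries ℕ S := fun d ↦ s (MvPowerSeries.coeff d h)
  have hH : ∀ d, MvPowerSeries.coeff d H = s (MvPowerSeries.coeff d h) := fun _ ↦ rfl
  refine ⟨H, ?_, ?_⟩
  · ext d
    rw [MvPowerSeries.coeff_map, hH, hs]
  · ext d
    rw [coeff_toFin, hH, map_zero]
    refine hs0 _ ?_
    rw [← coeff_toFin, hh, map_zero]

variable [Finite G] {ψ : minimalPrimes (MonoidAlgebra ℤ_[p] G)}

theorem toLevel_surjective (n : ℕ) : Function.Surjective (toLevel p G n) := fun f ↦ by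
  obtain ⟨F, hF⟩ := toFin_surjective n (swapHom (Fin n) ℤ_[p] G f)
  obtain ⟨F, rfl⟩ := swapHom_bijective.2 F
  rw [toFin_swapHom] at hF
  exact ⟨F, swapHom_bijective.1 hF⟩

theorem exists_toComponent_eq {n : ℕ} {h : MvPowerSeries ℕ (Component p G ψ)}
    (hh : toFin _ n h = 0) : ∃ Z, toComponent p G ℕ ψ Z = h ∧ toLevel p G n Z = 0 := by
  obtain ⟨H, hH, hH0⟩ := exists_map_eq_of_toFin_eq_zero Ideal.Quotient.mk_surjective hh
  obtain ⟨Z, rfl⟩ := swapHom_bijective.2 H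
  refine ⟨Z, hH, swapHom_bijective.1 ?_⟩
  rw [← toFin_swapHom, hH0, map_zero]

/-- Lift an element together with the cofactor of its divisibility. The discrepancy vanishes at
level `n`, so it comes from an element of `A` that also vanishes there and may be subtracted. -/
theorem map_comap_span (n : ℕ) (g : MvPowerSeries ℕ (Component p G ψ)) :
    ((Ideal.span {g}).comap (toComponent p G ℕ ψ)).map (toLevel p G n) =
      (Ideal.span {toFin _ n g}).comap (toComponent p G (Fin n) ψ) := by
  refine le_antisymm (Ideal.map_le_iff_le_comap.2 fun x hx ↦ ?_) fun y hy ↦ ?_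
  · rw [Ideal.mem_comap, Ideal.mem_span_singleton] at hx
    rw [Ideal.mem_comap, Ideal.mem_comap, Ideal.mem_span_singleton, ← toFin_toComponent]
    exact map_dvd _ hx
  · obtain ⟨Y, rfl⟩ := toLevel_surjective n y
    obtain ⟨c, hc⟩ := Ideal.mem_span_singleton.1 hy
    obtain ⟨c, rfl⟩ := toFin_surjective n c
    obtain ⟨Z, hZ, hZ0⟩ := exists_toComponent_eq (n := n) (h := toComponent p G ℕ ψ Y - g * c) (by
      rw [map_sub, map_mul, toFin_toComponent, hc, sub_self])
    rw [← sub_zero (toLevel p G n Y), ← hZ0, ← map_sub]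
    refine Ideal.mem_map_of_mem _ (Ideal.mem_span_singleton.2 ⟨c, ?_⟩)
    rw [map_sub, hZ, sub_sub_cancel]

/-- Closedness of finitely generated ideals, transported through `swapHom` to power series over the
compact ring `ℤ_p[G]`. -/
theorem mem_of_forall_toLevel {I : Ideal (Alg p G)} (hI : I.FG) (n₀ : ℕ) {f : Alg p G}
    (h : ∀ n, n₀ ≤ n → toLevel p G n f ∈ I.map (toLevel p G n)) : f ∈ I := by
  obtain ⟨_, _, _, _⟩ := exists_compact_topology (p := p) (S := MonoidAlgebra ℤ_[p] G)
  have h1 : swapHom ℕ ℤ_[p] G f ∈ I.map (swapHom ℕ ℤ_[p] G) := by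
    refine mem_of_forall_toFin (hI.map _) n₀ fun n hn ↦ ?_
    obtain ⟨g, hg, hgf⟩ :=
      (Ideal.mem_map_iff_of_surjective (toLevel p G n) (toLevel_surjective n)).1 (h n hn)
    exact ⟨_, Ideal.mem_map_of_mem _ hg, by rw [toFin_swapHom, toFin_swapHom, hgf]⟩
  obtain ⟨g, hg, hgf⟩ := (Ideal.mem_map_iff_of_surjective (swapHom ℕ ℤ_[p] G) swapHom_bijective.2).1 h1
  rwa [← swapHom_bijective.1 hgf]

noncomputable instance : Fintype (minimalPrimes (MonoidAlgebra ℤ_[p] G)) := Fintype.ofFinite _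

instance (n : ℕ) : UniqueFactorizationMonoid (MvPowerSeries (Fin n) (Component p G ψ)) := by
  have := isTorsionFree_quotient ψ.2
  obtain ⟨_, _, _, _⟩ := exists_compact_topology (p := p) (S := Component p G ψ)
  exact uniqueFactorizationMonoid_mvPowerSeries n

theorem exists_stable_components {δ : Alg p G} (hδ : δ ∈ (Alg p G)⁰) :
    ∃ (n₀ : ℕ) (s : ∀ ψ, Multiset (MvPowerSeries ℕ (Component p G ψ))), 1 ≤ n₀ ∧
      (∀ ψ, Associated (s ψ).prod (toComponent p G ℕ ψ δ)) ∧
      (∀ ψ, ∀ f ∈ s ψ, Prime f ∧ ∀ x, x ≠ 0 → FiniteMultiplicity f x) ∧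
      ∀ n, n₀ ≤ n → ∀ ψ, toComponent p G (Fin n) ψ (toLevel p G n δ) ≠ 0 ∧
        ∀ f ∈ s ψ, Prime (toFin _ n f) := by
  have h : ∀ ψ, ∃ (n₀ : ℕ) (s : Multiset (MvPowerSeries ℕ (Component p G ψ))),
      Associated s.prod (toComponent p G ℕ ψ δ) ∧
      (∀ f ∈ s, Prime f ∧ ∀ x, x ≠ 0 → FiniteMultiplicity f x) ∧
      ∀ n, n₀ ≤ n → toComponent p G (Fin n) ψ (toLevel p G n δ) ≠ 0 ∧
        ∀ f ∈ s, Prime (toFin _ n f) := by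
    intro ψ
    have := isTorsionFree_quotient ψ.2
    obtain ⟨_, _, _, _⟩ := exists_compact_topology (p := p) (S := Component p G ψ)
    obtain ⟨n₀, s, hs, h⟩ := exists_stable_factors
      (((hasComponents_toComponent ℕ).mem_nonZeroDivisors_iff δ).1 hδ ψ)
    refine ⟨n₀, s, hs, fun f hf ↦ ⟨prime_of_forall_toFin n₀ fun n hn ↦ (h n hn).2 f hf, fun x hx ↦
      finiteMultiplicity_of_toFin (fun n hn ↦ (h n hn).2 f hf) hx⟩, fun n hn ↦ ?_⟩
    rw [← toFin_toComponent]
    exact h n hn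
  choose n₀ s hs hp h using h
  -- One bound for the finitely many components; the `+ 1` ensures `1 ≤ n₀`, as amenability is only
  -- assumed from level one on.
  exact ⟨Finset.univ.sup n₀ + 1, s, by omega, hs, hp, fun n hn ψ ↦ h ψ n
    ((Finset.le_sup (Finset.mem_univ ψ)).trans (by omega))⟩

end Lift

/-! ### Group orders prime to `p` -/

section Idempotent

/-- With `K` the kernel, the preimage of `(φ a)` is `(a) + K`. In the product of two such ideals, `K
* K = K` absorbs the mixed terms. -/
theorem comap_span_mul {A B : Type*} [CommRing A] [CommRing B] {φ : A →+* B}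
    (hφ : Function.Surjective φ) (hK : IsIdempotentElem (RingHom.ker φ)) (f g : B) :
    (Ideal.span {f}).comap φ * (Ideal.span {g}).comap φ = (Ideal.span {f * g}).comap φ := by
  have h : ∀ a, (Ideal.span {φ a}).comap φ = Ideal.span {a} ⊔ RingHom.ker φ := fun a ↦ by
    rw [← Ideal.comap_map_of_surjective' φ hφ, Ideal.map_span, Set.image_singleton]
  obtain ⟨a, rfl⟩ := hφ f
  obtain ⟨b, rfl⟩ := hφ g
  rw [← map_mul, h, h, h, ← Ideal.span_singleton_mul_span_singleton, Ideal.sup_mul, Ideal.mul_sup,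
    Ideal.mul_sup, hK.eq]
  have h1 : Ideal.span {a} * RingHom.ker φ ≤ RingHom.ker φ := Ideal.mul_le_right
  have h2 : RingHom.ker φ * Ideal.span {b} ≤ RingHom.ker φ := Ideal.mul_le_left
  rw [sup_eq_right.2 h2, sup_assoc, sup_eq_right.2 h1]

theorem prod_comap_span {A B : Type*} [CommRing A] [CommRing B] {φ : A →+* B}
    (hφ : Function.Surjective φ) (hK : IsIdempotentElem (RingHom.ker φ)) (s : Multiset B) :
    (s.map fun f ↦ (Ideal.span {f}).comap φ).prod = (Ideal.span {s.prod}).comap φ := by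
  induction s using Multiset.induction with
  | empty => simp [Ideal.one_eq_top]
  | cons a s ih => rw [Multiset.map_cons, Multiset.prod_cons, Multiset.prod_cons, ih,
      comap_span_mul hφ hK]

variable {p : ℕ} [Fact p.Prime] {G : Type*} [CommGroup G] [Finite G]

theorem isIdempotentElem_ker_toComponent (hG : ¬ p ∣ Nat.card G) (σ : Type*)
    (ψ : minimalPrimes (MonoidAlgebra ℤ_[p] G)) :
    IsIdempotentElem (RingHom.ker (toComponent p G σ ψ)) := by
  classical
  obtain ⟨e, he, hP⟩ := (Ideal.isIdempotentElem_iff_of_fg _ (IsNoetherian.noetherian ψ.1)).1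
    (isIdempotentElem_of_not_dvd hG ψ.2)
  have heψ : e ∈ ψ.1 := hP ▸ Ideal.mem_span_singleton_self e
  obtain ⟨E, hE⟩ := exists_swapHom_eq_C σ e
  have hEk : E ∈ RingHom.ker (toComponent p G σ ψ) := (toComponent_eq_zero_iff E).2 fun d ↦ by
    rw [hE, MvPowerSeries.coeff_C]
    split_ifs
    exacts [heψ, zero_mem _]
  refine le_antisymm Ideal.mul_le_left fun f hf ↦ ?_
  have h1 : E * f = f := swapHom_bijective.1 (by
    ext1 d
    rw [map_mul, hE, MvPowerSeries.coeff_C_mul]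
    have h2 := (toComponent_eq_zero_iff f).1 hf d
    rw [hP] at h2
    obtain ⟨c, hc⟩ := Ideal.mem_span_singleton.1 h2
    rw [hc, ← mul_assoc, he.eq])
  rw [← h1]
  exact Ideal.mul_mem_mul hEk hf

end Idempotent

end ProChar

namespace ProChar

/-! ### Characteristic ideals of the levels -/

theorem fg_of_isCharIdeal {A M : Type*} [CommRing A] [AddCommGroup M] [Module A M]
    (ham : IsAmenable A M) {I : Ideal A} (h : IsCharIdeal A M I) : I.FG := by
  obtain ⟨hfin, m, e, f, -, rfl⟩ := h
  refine Finset.prod_induction _ Ideal.FG (fun _ _ ↦ Submodule.FG.mul) ?_ fun q hq ↦ ?_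
  · exact ⟨{1}, by simp⟩
  · exact (ham.fg q (by simpa using hq)).pow

theorem existsUnique_of_forall_iff {α : Type*} {P : α → Prop} {a : α} (h : ∀ b, P b ↔ b = a) :
    ∃! b, P b :=
  ⟨a, (h a).2 rfl, fun b ↦ (h b).1⟩

theorem charIdeal_eq {A M : Type*} [CommRing A] [AddCommGroup M] [Module A M] {J : Ideal A}
    (h : ∀ I, IsCharIdeal A M I ↔ I = J) : charIdeal A M = J := by
  have h1 : ∃ I, IsCharIdeal A M I := ⟨J, (h J).2 rfl⟩
  rw [charIdeal, dif_pos h1]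
  exact (h _).1 h1.choose_spec

section

variable {p : ℕ} [Fact p.Prime] {G : Type*} [CommGroup G]

/-- Membership at a high level descends along the transition maps, so finitely many initial levels
are irrelevant. -/
theorem forall_toLevel_mem_iff {c : ∀ n, Ideal (AlgLevel p G n)} {n₀ : ℕ} (n₁ : ℕ)
    (hc : ∀ n, n₀ ≤ n → (c (n + 1)).map (levelProj p G n) ≤ c n) (x : Alg p G) :
    (∀ n, n₀ ≤ n → toLevel p G n x ∈ c n) ↔
      ∀ n, max n₀ n₁ ≤ n → toLevel p G n x ∈ c n := by
  refine ⟨fun h n hn ↦ h n (le_trans (le_max_left _ _) hn), fun h n hn ↦ ?_⟩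
  have hdown : ∀ k, toLevel p G (n + k) x ∈ c (n + k) → toLevel p G n x ∈ c n := by
    intro k
    induction k with
    | zero => exact id
    | succ k ih =>
      intro hk
      refine ih ?_
      rw [← levelProj_toLevel]
      exact hc _ (by omega) (Ideal.mem_map_of_mem _ hk)
  exact hdown (max n₀ n₁) (h _ (by omega))

variable [Finite G]

theorem mem_nonZeroDivisors_iff_toComponent {σ : Type*}
    (a : MonoidAlgebra (MvPowerSeries σ ℤ_[p]) G) :
    a ∈ (MonoidAlgebra (MvPowerSeries σ ℤ_[p]) G)⁰ ↔ ∀ ψ, toComponent p G σ ψ a ≠ 0 :=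
  (hasComponents_toComponent σ).mem_nonZeroDivisors_iff a

theorem isCharIdeal_iff_toComponent {σ N : Type*} [AddCommGroup N]
    [Module (MonoidAlgebra (MvPowerSeries σ ℤ_[p]) G) N] {d : ℕ}
    {T : Matrix (Fin d) (Fin d) (MonoidAlgebra (MvPowerSeries σ ℤ_[p]) G)}
    {π : (Fin d → MonoidAlgebra (MvPowerSeries σ ℤ_[p]) G) →ₗ[MonoidAlgebra (MvPowerSeries σ ℤ_[p]) G]
      N} (ham : IsAmenable (MonoidAlgebra (MvPowerSeries σ ℤ_[p]) G) N)
    (hπ : Function.Surjective π) (hker : LinearMap.ker π = LinearMap.range T.mulVecLin)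
    (htors : Module.IsTorsion (MonoidAlgebra (MvPowerSeries σ ℤ_[p]) G) N)
    (s : ∀ ψ, Multiset (MvPowerSeries σ (Component p G ψ)))
    (hs : ∀ ψ, Associated (s ψ).prod (toComponent p G σ ψ T.det))
    (hp : ∀ ψ, ∀ f ∈ s ψ, Prime f ∧ ∀ x, x ≠ 0 → FiniteMultiplicity f x)
    (I : Ideal (MonoidAlgebra (MvPowerSeries σ ℤ_[p]) G)) :
    IsCharIdeal (MonoidAlgebra (MvPowerSeries σ ℤ_[p]) G) N I ↔
      I = ∏ ψ, ((s ψ).map fun f ↦ (Ideal.span {f}).comap (toComponent p G σ ψ)).prod :=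
  (hasComponents_toComponent σ).isCharIdeal_iff ham hπ hker htors s hs hp I

variable {M : Type*} [AddCommGroup M] [Module (Alg p G) M] {d : ℕ}
  {T : Matrix (Fin d) (Fin d) (Alg p G)} {π : (Fin d → Alg p G) →ₗ[Alg p G] M}

theorem map_prod_map_comap_span (n : ℕ)
    (s : ∀ ψ, Multiset (MvPowerSeries ℕ (Component p G ψ))) :
    (∏ ψ, ((s ψ).map fun f ↦ (Ideal.span {f}).comap (toComponent p G ℕ ψ)).prod).map
        (toLevel p G n) =
      ∏ ψ, ((s ψ).map fun f ↦
        (Ideal.span {toFin _ n f}).comap (toComponent p G (Fin n) ψ)).prod := by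
  rw [← Ideal.mapHom_apply, map_prod]
  refine Finset.prod_congr rfl fun ψ _ ↦ ?_
  rw [← Multiset.prod_hom, Multiset.map_map]
  exact congrArg Multiset.prod (Multiset.map_congr rfl fun f _ ↦ map_comap_span n f)

theorem isTorsion_level_iff (hπ : Function.Surjective π)
    (hker : LinearMap.ker π = LinearMap.range T.mulVecLin) (n : ℕ) :
    Module.IsTorsion (AlgLevel p G n) (Level p G M n) ↔
      ∀ ψ, toComponent p G (Fin n) ψ (toLevel p G n T.det) ≠ 0 := by
  obtain ⟨π', hπ', hker'⟩ := exists_presentation_baseChange (toLevel p G n) hπ hker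
  have hdet : (T.map (toLevel p G n)).det = toLevel p G n T.det := by
    rw [← RingHom.mapMatrix_apply, ← RingHom.map_det]
  rw [← mem_nonZeroDivisors_iff_toComponent, ← hdet]
  exact ⟨det_mem_nonZeroDivisors hπ' hker', isTorsion_of_det_mem hπ' hker'⟩

theorem isCharIdeal_level_iff (hπ : Function.Surjective π)
    (hker : LinearMap.ker π = LinearMap.range T.mulVecLin) {n : ℕ}
    (ham : IsAmenable (AlgLevel p G n) (Level p G M n))
    (htors : Module.IsTorsion (AlgLevel p G n) (Level p G M n))
    (s : ∀ ψ, Multiset (MvPowerSeries (Fin n) (Component p G ψ)))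
    (hs : ∀ ψ, Associated (s ψ).prod (toComponent p G (Fin n) ψ (toLevel p G n T.det)))
    (hp : ∀ ψ, ∀ f ∈ s ψ, Prime f) (I : Ideal (AlgLevel p G n)) :
    IsCharIdeal (AlgLevel p G n) (Level p G M n) I ↔
      I = ∏ ψ, ((s ψ).map fun f ↦ (Ideal.span {f}).comap (toComponent p G (Fin n) ψ)).prod := by
  obtain ⟨π', hπ', hker'⟩ := exists_presentation_baseChange (toLevel p G n) hπ hker
  have hdet : (T.map (toLevel p G n)).det = toLevel p G n T.det := by
    rw [← RingHom.mapMatrix_apply, ← RingHom.map_det]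
  refine isCharIdeal_iff_toComponent ham hπ' hker' htors s ?_
    (fun ψ f hf ↦ ⟨hp ψ f hf, fun x hx ↦ ?_⟩) I
  · rwa [hdet]
  · exact FiniteMultiplicity.of_not_isUnit (hp ψ f hf).not_isUnit hx

theorem existsUnique_isCharIdeal_and_exists_isProCharIdealFrom (hπ : Function.Surjective π)
    (hker : LinearMap.ker π = LinearMap.range T.mulVecLin)
    (htors : Module.IsTorsion (Alg p G) M) (ham : IsAmenable (Alg p G) M)
    (hamn : ∀ n, 1 ≤ n → IsAmenable (AlgLevel p G n) (Level p G M n)) :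
    (∃! I, IsCharIdeal (Alg p G) M I) ∧
      ∃ n₀, 1 ≤ n₀ ∧ IsProCharIdealFrom p G (Level p G M) n₀ (charIdeal (Alg p G) M) := by
  have hδ : T.det ∈ (Alg p G)⁰ := det_mem_nonZeroDivisors hπ hker htors
  obtain ⟨n₀, s, hn₀, hs, hp, h⟩ := exists_stable_components hδ
  have hJ := isCharIdeal_iff_toComponent ham hπ hker htors s hs hp
  generalize hJs : ∏ ψ, ((s ψ).map fun f ↦ (Ideal.span {f}).comap (toComponent p G ℕ ψ)).prod = J
    at hJ
  refine ⟨existsUnique_of_forall_iff hJ, n₀, hn₀, ?_⟩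
  rw [charIdeal_eq hJ]
  have ht : ∀ n, n₀ ≤ n → Module.IsTorsion (AlgLevel p G n) (Level p G M n) := fun n hn ↦
    (isTorsion_level_iff hπ hker n).2 fun ψ ↦ (h n hn ψ).1
  -- The reductions of the stable factors are prime factorizations at level `n`, so they compute the
  -- characteristic ideal there, and it is the image of `J`.
  have hJn : ∀ n, n₀ ≤ n → ∀ I, IsCharIdeal (AlgLevel p G n) (Level p G M n) I ↔
      I = J.map (toLevel p G n) := by
    intro n hn I
    rw [isCharIdeal_level_iff hπ hker (hamn n (hn₀.trans hn)) (ht n hn)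
      (fun ψ ↦ (s ψ).map (toFin _ n)) (fun ψ ↦ ?_) (fun ψ f hf ↦ ?_)]
    · rw [← hJs, map_prod_map_comap_span]
      simp_rw [Multiset.map_map, Function.comp_def]
    · rw [Multiset.prod_hom, ← toFin_toComponent]
      exact (hs ψ).map _
    · obtain ⟨g, hg, rfl⟩ := Multiset.mem_map.1 hf
      exact (h n hn ψ).2 g hg
  have hc : ∀ n, n₀ ≤ n → charIdeal (AlgLevel p G n) (Level p G M n) = J.map (toLevel p G n) :=
    fun n hn ↦ charIdeal_eq (hJn n hn)
  refine ⟨ht, fun n hn ↦ existsUnique_of_forall_iff (hJn n hn), fun n hn ↦ ?_,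
    fun x ↦ ⟨fun hx n hn ↦ ?_, fun hx ↦ ?_⟩⟩
  · rw [hc n hn, hc (n + 1) (hn.trans n.le_succ), Ideal.map_map]
    refine le_of_eq (congrArg (Ideal.map · J) (RingHom.ext fun x ↦ levelProj_toLevel p G n x))
  · rw [hc n hn]
    exact Ideal.mem_map_of_mem _ hx
  · refine mem_of_forall_toLevel (fg_of_isCharIdeal ham ((hJ J).2 rfl)) n₀ fun n hn ↦ ?_
    rw [← hc n hn]
    exact hx n hn

/-- Idempotent kernels let the preimages of the prime factors multiply to the preimage of their
product, so the factorization disappears from the formula. -/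
theorem isCharIdeal_level_iff_of_not_dvd (hπ : Function.Surjective π)
    (hker : LinearMap.ker π = LinearMap.range T.mulVecLin) (hG : ¬ p ∣ Nat.card G) {n : ℕ}
    (ham : IsAmenable (AlgLevel p G n) (Level p G M n))
    (htors : Module.IsTorsion (AlgLevel p G n) (Level p G M n)) (I : Ideal (AlgLevel p G n)) :
    IsCharIdeal (AlgLevel p G n) (Level p G M n) I ↔
      I = ∏ ψ, (Ideal.span {toComponent p G (Fin n) ψ (toLevel p G n T.det)}).comap
        (toComponent p G (Fin n) ψ) := by
  have hne := (isTorsion_level_iff hπ hker n).1 htors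
  have hf := fun ψ ↦ UniqueFactorizationMonoid.factors_prod (hne ψ)
  rw [isCharIdeal_level_iff hπ hker ham htors _ hf
    fun ψ f hf ↦ UniqueFactorizationMonoid.prime_of_factor f hf]
  refine Eq.congr_right (Finset.prod_congr rfl fun ψ _ ↦ ?_)
  rw [prod_comap_span (toComponent_surjective _) (isIdempotentElem_ker_toComponent hG _ _),
    Ideal.span_singleton_eq_span_singleton.2 (hf ψ)]

theorem map_levelProj_prod_comap_le (δ : Alg p G) (n : ℕ) :
    (∏ ψ, (Ideal.span {toComponent p G (Fin (n + 1)) ψ (toLevel p G (n + 1) δ)}).comap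
        (toComponent p G (Fin (n + 1)) ψ)).map (levelProj p G n) ≤
      ∏ ψ, (Ideal.span {toComponent p G (Fin n) ψ (toLevel p G n δ)}).comap
        (toComponent p G (Fin n) ψ) := by
  rw [← Ideal.mapHom_apply, map_prod]
  refine Finset.prod_le_prod' fun ψ _ ↦ Ideal.map_le_iff_le_comap.2 fun x hx ↦ ?_
  rw [Ideal.mem_comap, Ideal.mem_span_singleton] at hx
  rw [Ideal.mem_comap, Ideal.mem_comap, Ideal.mem_span_singleton, ← finStep_toComponent,
    ← levelProj_toLevel, ← finStep_toComponent]
  exact map_dvd _ hx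

theorem isTorsion_level_of_le (hπ : Function.Surjective π)
    (hker : LinearMap.ker π = LinearMap.range T.mulVecLin) {m n : ℕ} (hmn : m ≤ n)
    (htors : Module.IsTorsion (AlgLevel p G m) (Level p G M m)) :
    Module.IsTorsion (AlgLevel p G n) (Level p G M n) := by
  rw [isTorsion_level_iff hπ hker] at htors ⊢
  induction n, hmn using Nat.le_induction with
  | base => exact htors
  | succ n _ ih =>
    intro ψ h0
    refine ih ψ ?_
    rw [← levelProj_toLevel, ← finStep_toComponent, h0, map_zero]

/-- The factorization-free formula gives the transition maps from every torsion level on. The limits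
from `n₀` and from `n₁` are then both equal to the limit from the larger of the two. -/
theorem isProCharIdealFrom_of_not_dvd (hπ : Function.Surjective π)
    (hker : LinearMap.ker π = LinearMap.range T.mulVecLin)
    (hamn : ∀ n, 1 ≤ n → IsAmenable (AlgLevel p G n) (Level p G M n)) (hG : ¬ p ∣ Nat.card G)
    {n₀ n₁ : ℕ} (hn₀ : 1 ≤ n₀) (htors : Module.IsTorsion (AlgLevel p G n₀) (Level p G M n₀))
    {J : Ideal (Alg p G)} (h : IsProCharIdealFrom p G (Level p G M) n₁ J) :
    IsProCharIdealFrom p G (Level p G M) n₀ J := by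
  have ht : ∀ n, n₀ ≤ n → Module.IsTorsion (AlgLevel p G n) (Level p G M n) := fun n hn ↦
    isTorsion_level_of_le hπ hker hn htors
  have hJ := fun n (hn : n₀ ≤ n) ↦
    isCharIdeal_level_iff_of_not_dvd hπ hker hG (hamn n (hn₀.trans hn)) (ht n hn)
  have hmap : ∀ n, n₀ ≤ n → (charIdeal (AlgLevel p G (n + 1)) (Level p G M (n + 1))).map
      (levelProj p G n) ≤ charIdeal (AlgLevel p G n) (Level p G M n) := by
    intro n hn
    rw [charIdeal_eq (hJ n hn), charIdeal_eq (hJ (n + 1) (hn.trans n.le_succ))]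
    exact map_levelProj_prod_comap_le _ n
  have hex : ∀ n, n₀ ≤ n → ∃! I, IsCharIdeal (AlgLevel p G n) (Level p G M n) I := fun n hn ↦
    existsUnique_of_forall_iff (hJ n hn)
  have hmem : ∀ x, x ∈ J ↔ ∀ n, n₀ ≤ n →
      toLevel p G n x ∈ charIdeal (AlgLevel p G n) (Level p G M n) := by
    intro x
    have h1 := forall_toLevel_mem_iff (c := fun n ↦ charIdeal (AlgLevel p G n) (Level p G M n))
      n₀ h.map_le x
    have h2 := forall_toLevel_mem_iff (c := fun n ↦ charIdeal (AlgLevel p G n) (Level p G M n))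
      n₁ hmap x
    rw [max_comm] at h1
    exact (h.mem_iff x).trans (h1.trans h2.symm)
  exact { isTorsion := ht, existsUnique := hex, map_le := hmap, mem_iff := hmem }

end

end ProChar

theorem mainTheorem6 (p : ℕ) [Fact p.Prime] {G : Type*} [CommGroup G] [Finite G]
    {M : Type*} [AddCommGroup M] [Module (ProChar.Alg p G) M]
    (hquad : ProChar.IsQuadraticallyPresented (ProChar.Alg p G) M)
    (htors : Module.IsTorsion (ProChar.Alg p G) M)
    (ham : ProChar.IsAmenable (ProChar.Alg p G) M)
    (hamn : ∀ n, 1 ≤ n → ProChar.IsAmenable (ProChar.AlgLevel p G n) (ProChar.Level p G M n)) :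
    (∀ n, Module.IsTorsion (ProChar.AlgLevel p G n) (ProChar.Level p G M n) →
      ProChar.IsPseudoNull (ProChar.AlgLevel p G n)
        (ProChar.Invariants p G n (ProChar.Level p G M (n + 1)))) ∧
    (∃! I, ProChar.IsCharIdeal (ProChar.Alg p G) M I) ∧
    (∃ n₀, 1 ≤ n₀ ∧ ProChar.IsProCharIdealFrom p G (ProChar.Level p G M) n₀
      (ProChar.charIdeal (ProChar.Alg p G) M)) ∧
    (¬ p ∣ Nat.card G → ∀ n₀, 1 ≤ n₀ →
      Module.IsTorsion (ProChar.AlgLevel p G n₀) (ProChar.Level p G M n₀) →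
      ProChar.IsProCharIdealFrom p G (ProChar.Level p G M) n₀
        (ProChar.charIdeal (ProChar.Alg p G) M)) := by
  obtain ⟨d, T, π, hπ, hker⟩ := hquad.exists_matrix
  obtain ⟨h1, n₁, hn₁, h2⟩ := ProChar.existsUnique_isCharIdeal_and_exists_isProCharIdealFrom
    hπ hker htors ham hamn
  refine ⟨fun n hn ↦ ?_, h1, ⟨n₁, hn₁, h2⟩, fun hG n₀ hn₀ ht ↦
    ProChar.isProCharIdealFrom_of_not_dvd hπ hker hamn hG hn₀ ht h2⟩
  obtain ⟨π', hπ', hker'⟩ :=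
    ProChar.exists_presentation_baseChange (ProChar.toLevel p G (n + 1)) hπ hker
  -- Torsion at level `n` says that the determinant at level `n + 1` reduces to a non-zero-divisor,
  -- which is what kills the invariants altogether.
  have hsub := ProChar.subsingleton_invariants p G hπ' hker' (by
    rw [← RingHom.mapMatrix_apply, ← RingHom.map_det, ProChar.levelProj_toLevel,
      ProChar.mem_nonZeroDivisors_iff_toComponent]
    exact (ProChar.isTorsion_level_iff hπ hker n).1 hn)
  rw [ProChar.isPseudoNull_iff]
  exact fun q _ m ↦ ⟨1, fun h ↦ q.2.ne_top ((Ideal.eq_top_iff_one _).2 h), Subsingleton.elim _ _⟩
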